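/- **Conventions.** Let $S$ be an associative unital ring, let $V$ be an $S$-bimodule, and let $T=T_S(V)=\bigoplus_{m\ge 0}T^m$ be its tensor ring ($T^0=S$, $T^m=V^{\otimes m}$, with $\otimes=\otimes_S$). Let $p^m:T\to T^m$ be the projections and $T^{\le m}=\bigoplus_{k\le m}T^k$. Fix an integer $n\ge 2$ and an $S$-subbimodule $P\subseteq T^{\le n}$, and let $R:=p^n(P)\subseteq T^n$, regarded as a graded bimodule concentrated in degree $n$. Put $A:=A(R)=T/\langle R\rangle$, a graded ring with $A^0=S$, and $U(P):=T/\langle P\rangle$, filtered by the images $U(P)^{\le m}$ of the $T^{\le m}$ (with $U(P)^{\le -1}=0$). One says that $U(P)$ is a *PBW-deformation* of $A$ if the canonical map of graded $S$-rings $\Phi:A(R)\to\operatorname{gr}U(P)$, which sends $x+\langle R\rangle$ with $x\in T^m$ to $(x+\langle P\rangle)+U(P)^{\le m-1}$, is an isomorphism. A *filtered map* $\alpha:R\to T$ is a morphism of $S$-bimodules with $\alpha(R)\subseteq T^{\le n}$ and $p^n(\alpha(r))=r$ for all $r\in R$. Its components are $\alpha_i:=p^{n-i}\alpha:R\to T^{n-i}$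 for $0\le i\le n$, so that $\alpha=\sum_{i=0}^n\alpha_i$ and $\alpha_0$ is the inclusion. Let $X:=(R\otimes V)\cap(V\otimes R)$, the intersection being taken in $T^{n+1}$; that is, $X$ is the fibre product of the canonical maps $V\otimes R\to T^{n+1}$ and $R\otimes V\to T^{n+1}$ (literally an intersection when these maps are injective). For $x\in X$ let $(V\otimes\alpha_i-\alpha_i\otimes V)(x)\in T^{n+1-i}$ denote the image of the $V\otimes R$-component of $x$ under $V\otimes\alpha_i$ minus the image of its $R\otimes V$-component under $\alpha_i\otimes V$. One says that $\alpha$ satisfies the conditions $(\mathcal J'_0)$–$(\mathcal J'_n)$ if for all $x\in X$ and all $0<i<n$: $$(V\otimes\alpha_1-\alpha_1\otimes V)(x)\in R,\tag{$\mathcal J'_0$}$$ $$\alpha_i\big((V\otimes\alpha_1-\alpha_1\otimes V)(x)\big)=(V\otimes\alpha_{i+1}-\alpha_{i+1}\otimes V)(x),\tag{$\mathcal J'_i$}$$ $$\alpha_n\big((V\otimes\alpha_1-\alpha_1\otimes V)(x)\big)=0.\tag{$\mathcal J'_n$}$$ Finally, $\operatorname{Tor}^A_3(S,S)$ is taken with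 $S$ a right and a left $A$-module through the projection $A\to A^0=S$, and it carries the internal grading induced by that of $A$; it is called *$(n+1)$-pure* if it is concentrated in internal degree $n+1$ (it may be zero). **Theorem.** Assume that $A^1$ and $R$ are projective as left $S$-modules and that $\operatorname{Tor}_3^A(S,S)$ is $(n+1)$-pure. Then $U(P)$ is a PBW-deformation of $A$ if and only if there is a filtered map $\alpha:R\to T$ such that $P=\alpha(R)$ and either $\operatorname{Tor}_3^A(S,S)=0$ or $\alpha$ satisfies $(\mathcal J'_0)$–$(\mathcal J'_n)$. -/

import Mathlib

open MulOpposite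
open scoped TensorProduct DirectSum

universe u v w a b c

/-! ### Tensor products over a noncommutative ring, bimodule maps, sub-bimodules -/

/-- The tensor product `M ⊗_S N` of a right `S`-module `M` and a left `S`-module `N`,
for an arbitrary ring `S`: the quotient of `M ⊗_ℤ N` by the relations `m s ⊗ n = m ⊗ s n`. -/
def BalTensor (S : Type u) [Ring S] (M : Type v) [AddCommGroup M] [Module Sᵐᵒᵖ M]
    (N : Type w) [AddCommGroup N] [Module S N] : Type (max v w) :=
  (M ⊗[ℤ] N) ⧸ AddSubgroup.closure
    {z : M ⊗[ℤ] N | ∃ (m : M) (s : S) (n : N), z = (op s • m) ⊗ₜ[ℤ] n - m ⊗ₜ[ℤ] (s • n)}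

namespace BalTensor

section

variable (S : Type u) [Ring S] {M : Type v} [AddCommGroup M] [Module Sᵐᵒᵖ M]
  {N : Type w} [AddCommGroup N] [Module S N]

noncomputable instance : AddCommGroup (BalTensor S M N) :=
  inferInstanceAs (AddCommGroup ((M ⊗[ℤ] N) ⧸ AddSubgroup.closure
    {z : M ⊗[ℤ] N | ∃ (m : M) (s : S) (n : N), z = (op s • m) ⊗ₜ[ℤ] n - m ⊗ₜ[ℤ] (s • n)}))

/-- The canonical surjection `M ⊗_ℤ N → M ⊗_S N`. -/
noncomputable def mk : M ⊗[ℤ] N →+ BalTensor S M N :=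
  QuotientAddGroup.mk' _

/-- The pure tensor `m ⊗ n`. -/
noncomputable def tmul (m : M) (n : N) : BalTensor S M N :=
  mk S (m ⊗ₜ[ℤ] n)

variable {S}

/-- The additive map out of `M ⊗_S N` given by a biadditive `S`-balanced map. -/
noncomputable def lift {Q : Type a} [AddCommGroup Q] (f : M →+ N →+ Q)
    (hf : ∀ (m : M) (s : S) (n : N), f (op s • m) n = f m (s • n)) : BalTensor S M N →+ Q :=
  QuotientAddGroup.lift _
    (TensorProduct.liftAddHom f (fun r m n => by simp)) (by
      rw [AddSubgroup.closure_le]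
      rintro z ⟨m, s, n, rfl⟩
      simp [AddMonoidHom.mem_ker, hf])

/-- `M ⊗ g : M ⊗_S N → M ⊗_S N'` for a left `S`-linear map `g`. -/
noncomputable def lTensor (M : Type v) [AddCommGroup M] [Module Sᵐᵒᵖ M]
    {N' : Type a} [AddCommGroup N'] [Module S N'] (g : N →ₗ[S] N') :
    BalTensor S M N →+ BalTensor S M N' :=
  QuotientAddGroup.map _ _ (g.toAddMonoidHom.toIntLinearMap.lTensor M).toAddMonoidHom (by
    rw [AddSubgroup.closure_le]
    rintro z ⟨m, s, n, rfl⟩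
    exact AddSubgroup.subset_closure ⟨m, s, g n, by simp⟩)

/-- `f ⊗ N : M ⊗_S N → M' ⊗_S N` for a right `S`-linear map `f`. -/
noncomputable def rTensor (N : Type w) [AddCommGroup N] [Module S N]
    {M' : Type a} [AddCommGroup M'] [Module Sᵐᵒᵖ M'] (f : M →ₗ[Sᵐᵒᵖ] M') :
    BalTensor S M N →+ BalTensor S M' N :=
  QuotientAddGroup.map _ _ (f.toAddMonoidHom.toIntLinearMap.rTensor N).toAddMonoidHom (by
    rw [AddSubgroup.closure_le]
    rintro z ⟨m, s, n, rfl⟩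
    exact AddSubgroup.subset_closure ⟨f m, s, n, by simp⟩)

end

end BalTensor

/-- Morphisms of `S`-bimodules. -/
structure BimodHom (S : Type u) [Ring S] (M : Type v) [AddCommGroup M] [Module S M]
    [Module Sᵐᵒᵖ M] (N : Type w) [AddCommGroup N] [Module S N] [Module Sᵐᵒᵖ N]
    extends M →ₗ[S] N where
  map_right : ∀ (s : S) (m : M), toFun (op s • m) = op s • toFun m

namespace BimodHom

variable {S : Type u} [Ring S] {M : Type v} [AddCommGroup M] [Module S M] [Module Sᵐᵒᵖ M]
  {N : Type w} [AddCommGroup N] [Module S N] [Module Sᵐᵒᵖ N]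

instance : FunLike (BimodHom S M N) M N where
  coe f := f.toFun
  coe_injective := by
    rintro ⟨f, hf⟩ ⟨g, hg⟩ h
    congr
    exact DFunLike.coe_injective h

/-- A bimodule map, as a map of right modules. -/
def toRight (f : BimodHom S M N) : M →ₗ[Sᵐᵒᵖ] N where
  toFun := f
  map_add' := f.toLinearMap.map_add
  map_smul' s m := f.map_right s.unop m

/-- Composition of bimodule maps. -/
def comp {Q : Type a} [AddCommGroup Q] [Module S Q] [Module Sᵐᵒᵖ Q]
    (g : BimodHom S N Q) (f : BimodHom S M N) : BimodHom S M Q where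
  toLinearMap := g.toLinearMap.comp f.toLinearMap
  map_right s m := by
    have h1 := f.map_right s m
    have h2 := g.map_right s (f m)
    change g.toFun (f.toFun (op s • m)) = op s • g.toFun (f.toFun m)
    rw [h1]
    exact h2

/-- The zero bimodule map. -/
instance : Zero (BimodHom S M N) where
  zero := { toLinearMap := 0, map_right := fun s m => by simp }

end BimodHom

/-- Sub-bimodules of an `S`-bimodule. -/
structure SubBimod (S : Type u) [Ring S] (M : Type v) [AddCommGroup M] [Module S M]
    [Module Sᵐᵒᵖ M] extends Submodule S M where
  right_mem : ∀ (s : S) {m : M}, m ∈ carrier → op s • m ∈ carrier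

namespace SubBimod

variable {S : Type u} [Ring S] {M : Type v} [AddCommGroup M] [Module S M] [Module Sᵐᵒᵖ M]

instance : SetLike (SubBimod S M) M where
  coe P := P.carrier
  coe_injective := by
    rintro ⟨P, hP⟩ ⟨Q, hQ⟩ h
    congr
    exact SetLike.coe_injective h

instance : AddSubgroupClass (SubBimod S M) M where
  add_mem {P} := P.toSubmodule.add_mem
  zero_mem P := P.toSubmodule.zero_mem
  neg_mem {P} := P.toSubmodule.neg_mem

instance : SMulMemClass (SubBimod S M) S M where
  smul_mem {P} s _ h := P.toSubmodule.smul_mem s h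

instance (P : SubBimod S M) : SMul Sᵐᵒᵖ P where
  smul s x := ⟨s • x.1, P.right_mem s.unop x.2⟩

instance (P : SubBimod S M) : Module Sᵐᵒᵖ P :=
  Function.Injective.module Sᵐᵒᵖ (AddSubgroupClass.subtype P) Subtype.coe_injective
    (fun _ _ => rfl)

/-- The inclusion of a sub-bimodule. -/
def incl (P : SubBimod S M) : BimodHom S P M where
  toFun x := x
  map_add' _ _ := rfl
  map_smul' _ _ := rfl
  map_right _ _ := rfl

/-- The image of a sub-bimodule under a bimodule map. -/
def map {N : Type w} [AddCommGroup N] [Module S N] [Module Sᵐᵒᵖ N]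
    (f : BimodHom S M N) (P : SubBimod S M) : SubBimod S N where
  toSubmodule := P.toSubmodule.map f.toLinearMap
  right_mem := by
    rintro s _ ⟨x, hx, rfl⟩
    exact ⟨op s • x, P.right_mem s hx, f.map_right s x⟩

/-- The image of a bimodule map. -/
def range {N : Type w} [AddCommGroup N] [Module S N] [Module Sᵐᵒᵖ N]
    (f : BimodHom S M N) : SubBimod S N where
  toSubmodule := LinearMap.range f.toLinearMap
  right_mem := by
    rintro s _ ⟨x, rfl⟩
    exact ⟨op s • x, f.map_right s x⟩

end SubBimod

/-! ### The tensor ring of a bimodule and its grading -/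

/-- The defining relations of the tensor ring: `S` maps in by a ring homomorphism, `V` by an
additive map, and the two actions of `S` on `V` become multiplications. -/
inductive TensorRing.Rel (S : Type u) [Ring S] (V : Type v) [AddCommGroup V] [Module S V]
    [Module Sᵐᵒᵖ V] : FreeAlgebra ℤ (S ⊕ V) → FreeAlgebra ℤ (S ⊕ V) → Prop
  | one : Rel S V (FreeAlgebra.ι ℤ (Sum.inl 1)) 1
  | add (s t : S) : Rel S V (FreeAlgebra.ι ℤ (Sum.inl (s + t)))
      (FreeAlgebra.ι ℤ (Sum.inl s) + FreeAlgebra.ι ℤ (Sum.inl t))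
  | mul (s t : S) : Rel S V (FreeAlgebra.ι ℤ (Sum.inl (s * t)))
      (FreeAlgebra.ι ℤ (Sum.inl s) * FreeAlgebra.ι ℤ (Sum.inl t))
  | vadd (x y : V) : Rel S V (FreeAlgebra.ι ℤ (Sum.inr (x + y)))
      (FreeAlgebra.ι ℤ (Sum.inr x) + FreeAlgebra.ι ℤ (Sum.inr y))
  | left (s : S) (x : V) : Rel S V (FreeAlgebra.ι ℤ (Sum.inr (s • x)))
      (FreeAlgebra.ι ℤ (Sum.inl s) * FreeAlgebra.ι ℤ (Sum.inr x))
  | right (s : S) (x : V) : Rel S V (FreeAlgebra.ι ℤ (Sum.inr (op s • x)))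
      (FreeAlgebra.ι ℤ (Sum.inr x) * FreeAlgebra.ι ℤ (Sum.inl s))

/-- The tensor ring `T_S(V)` of an `S`-bimodule `V`: the universal ring with a ring homomorphism
from `S` and an `S`-bimodule map from `V`. -/
def TensorRing (S : Type u) [Ring S] (V : Type v) [AddCommGroup V] [Module S V]
    [Module Sᵐᵒᵖ V] : Type (max u v) :=
  RingQuot (TensorRing.Rel S V)

namespace TensorRing

section

variable (S : Type u) [Ring S] (V : Type v) [AddCommGroup V] [Module S V] [Module Sᵐᵒᵖ V]

instance : Ring (TensorRing S V) := inferInstanceAs (Ring (RingQuot (TensorRing.Rel S V)))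

/-- The structure map `S → T_S(V)`. -/
def scalar : S →+* TensorRing S V where
  toFun s := RingQuot.mkRingHom (Rel S V) (FreeAlgebra.ι ℤ (Sum.inl s))
  map_one' := (RingQuot.mkRingHom_rel Rel.one).trans (map_one _)
  map_mul' s t := (RingQuot.mkRingHom_rel (Rel.mul s t)).trans (map_mul _ _ _)
  map_zero' := by
    have h := (RingQuot.mkRingHom_rel (Rel.add (S := S) (V := V) 0 0)).trans (map_add _ _ _)
    rw [add_zero] at h
    exact left_eq_add.mp h
  map_add' s t := (RingQuot.mkRingHom_rel (Rel.add s t)).trans (map_add _ _ _)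

/-- The canonical map `V → T_S(V)`. -/
def ι : V →+ TensorRing S V :=
  AddMonoidHom.mk' (fun x => (RingQuot.mkRingHom (Rel S V) (FreeAlgebra.ι ℤ (Sum.inr x)) :
      RingQuot (Rel S V)))
    (fun x y => (RingQuot.mkRingHom_rel (Rel.vadd x y)).trans (map_add _ _ _))

instance : Module S (TensorRing S V) := Module.compHom _ (scalar S V)

instance : Module Sᵐᵒᵖ (TensorRing S V) := Module.compHom _ (scalar S V).op

variable {S V}

theorem smul_def (s : S) (t : TensorRing S V) : s • t = scalar S V s * t := rfl

theorem op_smul_def (s : S) (t : TensorRing S V) : op s • t = t * scalar S V s := rfl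

theorem ι_smul (s : S) (x : V) : ι S V (s • x) = scalar S V s * ι S V x :=
  (RingQuot.mkRingHom_rel (Rel.left s x)).trans (map_mul _ _ _)

theorem ι_op_smul (s : S) (x : V) : ι S V (op s • x) = ι S V x * scalar S V s :=
  (RingQuot.mkRingHom_rel (Rel.right s x)).trans (map_mul _ _ _)

/-- The universal property of `T_S(V)`. -/
def lift {B : Type w} [Ring B] (f : S →+* B) (g : V →+ B)
    (hl : ∀ (s : S) (x : V), g (s • x) = f s * g x)
    (hr : ∀ (s : S) (x : V), g (op s • x) = g x * f s) : TensorRing S V →+* B :=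
  RingQuot.lift ⟨(FreeAlgebra.lift ℤ (Sum.elim f g)).toRingHom, by
    intro p q h
    cases h <;> simp [hl, hr]⟩

theorem lift_scalar {B : Type w} [Ring B] (f : S →+* B) (g : V →+ B) (hl hr) (s : S) :
    lift f g hl hr (scalar S V s) = f s := by
  change RingQuot.lift _ (RingQuot.mkRingHom _ _) = _
  rw [RingQuot.lift_mkRingHom_apply]
  simp

theorem lift_ι {B : Type w} [Ring B] (f : S →+* B) (g : V →+ B) (hl hr) (x : V) :
    lift f g hl hr (ι S V x) = g x := by
  change RingQuot.lift _ (RingQuot.mkRingHom _ _) = _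
  rw [RingQuot.lift_mkRingHom_apply]
  simp

theorem hom_ext {B : Type w} [Ring B] {f g : TensorRing S V →+* B}
    (h1 : ∀ s, f (scalar S V s) = g (scalar S V s)) (h2 : ∀ x, f (ι S V x) = g (ι S V x)) :
    f = g := by
  apply RingQuot.ringQuot_ext (r := Rel S V)
  have h : ((f.comp (RingQuot.mkRingHom (Rel S V))).toIntAlgHom :
      FreeAlgebra ℤ (S ⊕ V) →ₐ[ℤ] B) = (g.comp (RingQuot.mkRingHom (Rel S V))).toIntAlgHom := by
    apply FreeAlgebra.hom_ext
    funext i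
    rcases i with s | x
    · exact h1 s
    · exact h2 x
  ext t
  exact DFunLike.congr_fun h t

variable (S V)

/-- The ring homomorphism `T → T[X]` with `s ↦ s` on `S` and `x ↦ x X` on `V`. It sends an element
with homogeneous components `t_m` to the polynomial `∑ t_m X ^ m`. -/
noncomputable def weight : TensorRing S V →+* Polynomial (TensorRing S V) :=
  lift (Polynomial.C.comp (scalar S V))
    ((Polynomial.monomial 1).toAddMonoidHom.comp (ι S V))
    (fun s x => by simp [ι_smul, Polynomial.C_mul_monomial])
    (fun s x => by simp [ι_op_smul, Polynomial.monomial_mul_C])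

theorem weight_scalar (s : S) : weight S V (scalar S V s) = Polynomial.C (scalar S V s) :=
  lift_scalar _ _ _ _ s

theorem weight_ι (x : V) : weight S V (ι S V x) = Polynomial.monomial 1 (ι S V x) :=
  lift_ι _ _ _ _ x

/-- The projection `p^m : T → T` onto the homogeneous component of degree `m`. -/
noncomputable def proj (m : ℕ) : BimodHom S (TensorRing S V) (TensorRing S V) where
  toFun t := (weight S V t).coeff m
  map_add' s t := by simp
  map_smul' s t := by simp [smul_def, weight_scalar]
  map_right s t := by simp [op_smul_def, weight_scalar]

/-- The homogeneous component `T^m`, the image of `V ⊗ ⋯ ⊗ V` (`m` factors):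
`T^0 = S` and `T^(m+1) = V T^m`. -/
def homog : ℕ → Submodule S (TensorRing S V)
  | 0 => Submodule.span S {1}
  | m + 1 => Submodule.span S {x | ∃ (y : V) (t : TensorRing S V), t ∈ homog m ∧ x = ι S V y * t}

/-- The standard filtration `T^{≤ m}`. -/
def filt (m : ℕ) : Submodule S (TensorRing S V) :=
  ⨆ (k : ℕ) (_ : k ≤ m), homog S V k

variable {S V}

/-- On `T^m`, the projection `p^m` is the identity and `p^k` vanishes for `k ≠ m`. -/
theorem weight_of_mem_homog {m : ℕ} {t : TensorRing S V} (ht : t ∈ homog S V m) :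
    weight S V t = Polynomial.monomial m t := by
  induction m generalizing t with
  | zero =>
    obtain ⟨s, rfl⟩ := Submodule.mem_span_singleton.mp ht
    simp [smul_def, weight_scalar]
  | succ m ih =>
    induction ht using Submodule.span_induction with
    | mem x hx =>
      obtain ⟨y, t, ht, rfl⟩ := hx
      simp [weight_ι, ih ht, Polynomial.monomial_mul_monomial, add_comm]
    | zero => simp
    | add x y _ _ hx hy => simp [hx, hy]
    | smul s x _ hx => simp [smul_def, weight_scalar, hx, Polynomial.C_mul_monomial]

theorem homog_mul {i j : ℕ} {x y : TensorRing S V} (hx : x ∈ homog S V i)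
    (hy : y ∈ homog S V j) : x * y ∈ homog S V (i + j) := by
  induction i generalizing x with
  | zero =>
    obtain ⟨s, rfl⟩ := Submodule.mem_span_singleton.mp hx
    rw [zero_add, smul_def, mul_one, ← smul_def]
    exact Submodule.smul_mem _ s hy
  | succ i ih =>
    rw [Nat.succ_add]
    induction hx using Submodule.span_induction with
    | mem x hx =>
      obtain ⟨z, t, ht, rfl⟩ := hx
      exact Submodule.subset_span ⟨z, t * y, ih ht, mul_assoc _ _ _⟩
    | zero => simp
    | add x z _ _ hx hz => rw [add_mul]; exact add_mem hx hz
    | smul s x _ hx =>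
      rw [smul_def, mul_assoc, ← smul_def]
      exact Submodule.smul_mem _ s hx

theorem homog_le_filt {k m : ℕ} (h : k ≤ m) : homog S V k ≤ filt S V m :=
  le_iSup₂_of_le k h le_rfl

theorem filt_mono {k m : ℕ} (h : k ≤ m) : filt S V k ≤ filt S V m :=
  iSup₂_le fun _ hi => homog_le_filt (hi.trans h)

theorem one_mem_homog : (1 : TensorRing S V) ∈ homog S V 0 :=
  Submodule.mem_span_singleton_self 1

theorem filt_induction {m : ℕ} {p : TensorRing S V → Prop} {x : TensorRing S V}
    (hx : x ∈ filt S V m) (h1 : ∀ k ≤ m, ∀ y ∈ homog S V k, p y) (h0 : p 0)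
    (ha : ∀ y z, p y → p z → p (y + z)) : p x := by
  induction hx using Submodule.iSup_induction' with
  | mem k y hy =>
    by_cases hk : k ≤ m
    · exact h1 k hk y (by simpa [hk] using hy)
    · have : y = 0 := by simpa [hk] using hy
      exact this ▸ h0
  | zero => exact h0
  | add y z _ _ hy hz => exact ha y z hy hz

theorem filt_mul {i j : ℕ} {x y : TensorRing S V} (hx : x ∈ filt S V i)
    (hy : y ∈ filt S V j) : x * y ∈ filt S V (i + j) := by
  refine filt_induction (p := fun x => x * y ∈ filt S V (i + j)) hx ?_ (by simp) ?_
  · intro k hk z hz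
    refine filt_induction (p := fun y => z * y ∈ filt S V (i + j)) hy ?_ (by simp) ?_
    · intro l hl t ht
      exact homog_le_filt (add_le_add hk hl) (homog_mul hz ht)
    · intro t t' h h'
      rw [mul_add]
      exact add_mem h h'
  · intro t t' h h'
    rw [add_mul]
    exact add_mem h h'

variable (S V)

/-- The augmentation `T_S(V) → T^0 = S`, which kills `V`. -/
def augmentation : TensorRing S V →+* S :=
  lift (RingHom.id S) 0 (by simp) (by simp)

variable {S V}

theorem augmentation_proj {m : ℕ} (hm : m ≠ 0) (t : TensorRing S V) :
    augmentation S V (proj S V m t) = 0 := by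
  have h : (Polynomial.mapRingHom (augmentation S V)).comp (weight S V)
      = Polynomial.C.comp (augmentation S V) := by
    apply hom_ext
    · intro s
      simp [weight_scalar]
    · intro x
      have h0 : augmentation S V (ι S V x) = 0 := lift_ι _ _ _ _ x
      simp [weight_ι, h0]
  have h1 := congrArg (fun q => Polynomial.coeff q m) (DFunLike.congr_fun h t)
  simp only [RingHom.comp_apply, Polynomial.coe_mapRingHom, Polynomial.coeff_map,
    Polynomial.coeff_C, if_neg hm] at h1
  exact h1

end

end TensorRing

/-! ### Filtered rings and their associated graded rings -/

/-- Increasing `ℕ`-filtrations of a ring. -/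
structure RingFilt (U : Type u) [Ring U] where
  F : ℕ → AddSubgroup U
  mono : Monotone F
  one_mem : (1 : U) ∈ F 0
  mul_mem : ∀ {i j : ℕ} {x y : U}, x ∈ F i → y ∈ F j → x * y ∈ F (i + j)

namespace RingFilt

variable {U : Type u} [Ring U] (F : RingFilt U)

/-- `F^{m-1} U`, where `F^{-1} U = 0`. -/
def prev : ℕ → AddSubgroup U
  | 0 => ⊥
  | m + 1 => F.F m

/-- The component `gr^m U = F^m U / F^{m-1} U`. -/
def Gr (m : ℕ) : Type u := F.F m ⧸ (F.prev m).addSubgroupOf (F.F m)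

instance (m : ℕ) : AddCommGroup (F.Gr m) :=
  inferInstanceAs (AddCommGroup (F.F m ⧸ (F.prev m).addSubgroupOf (F.F m)))

/-- The class in `gr^m U` of an element of `F^m U`. -/
def cls (m : ℕ) : F.F m →+ F.Gr m := QuotientAddGroup.mk' _

variable {F}

theorem cls_surjective (m : ℕ) : Function.Surjective (F.cls m) :=
  QuotientAddGroup.mk'_surjective _

theorem cls_eq_zero {m : ℕ} {x : F.F m} (h : (x : U) ∈ F.prev m) : F.cls m x = 0 :=
  (QuotientAddGroup.eq_zero_iff x).mpr h

theorem prev_mul {i j : ℕ} {x y : U} (hx : x ∈ F.prev i) (hy : y ∈ F.F j) :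
    x * y ∈ F.prev (i + j) := by
  cases i with
  | zero =>
    have : x = 0 := hx
    rw [this, zero_mul]
    exact zero_mem _
  | succ i =>
    rw [Nat.succ_add]
    exact F.mul_mem hx hy

theorem mul_prev {i j : ℕ} {x y : U} (hx : x ∈ F.F i) (hy : y ∈ F.prev j) :
    x * y ∈ F.prev (i + j) := by
  cases j with
  | zero =>
    have : y = 0 := hy
    rw [this, mul_zero]
    exact zero_mem _
  | succ j => exact F.mul_mem hx hy

/-- The multiplication `F^i U × F^j U → gr^{i+j} U`. -/
def mulAux (i j : ℕ) : F.F i →+ F.F j →+ F.Gr (i + j) :=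
  AddMonoidHom.mk' (fun x => AddMonoidHom.mk'
      (fun y : F.F j => F.cls (i + j) ⟨x.1 * y.1, F.mul_mem x.2 y.2⟩)
      (fun y z => by
        rw [← map_add]
        congr 1
        exact Subtype.ext (mul_add _ _ _)))
    (fun x y => by
      ext z
      change F.cls (i + j) _ = F.cls (i + j) _ + F.cls (i + j) _
      rw [← map_add]
      congr 1
      exact Subtype.ext (add_mul _ _ _))

/-- The multiplication `gr^i U × gr^j U → gr^{i+j} U` induced by that of `U`. -/
def mul (i j : ℕ) : F.Gr i →+ F.Gr j →+ F.Gr (i + j) :=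
  QuotientAddGroup.lift _
    (AddMonoidHom.mk' (fun x => QuotientAddGroup.lift _ (mulAux i j x)
        (fun y hy => cls_eq_zero (mul_prev x.2 hy)))
      (fun x y => by
        refine AddMonoidHom.ext fun z => ?_
        obtain ⟨z, rfl⟩ := cls_surjective j z
        exact DFunLike.congr_fun (map_add (mulAux i j) x y) z))
    (fun x hx => by
      refine AddMonoidHom.ext fun y => ?_
      obtain ⟨y, rfl⟩ := cls_surjective j y
      exact cls_eq_zero (prev_mul hx y.2))

theorem mul_cls {i j : ℕ} (x : F.F i) (y : F.F j) :
    mul i j (F.cls i x) (F.cls j y) = F.cls (i + j) ⟨x.1 * y.1, F.mul_mem x.2 y.2⟩ := rfl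

theorem sigma_cls_ext {i j : ℕ} (h : i = j) (x : F.F i) (y : F.F j) (hxy : (x : U) = y) :
    (⟨i, F.cls i x⟩ : GradedMonoid F.Gr) = ⟨j, F.cls j y⟩ := by
  subst h
  rw [Subtype.ext hxy]

instance : GradedMonoid.GOne F.Gr where
  one := F.cls 0 ⟨1, F.one_mem⟩

instance : GradedMonoid.GMul F.Gr where
  mul x y := mul _ _ x y

instance : DirectSum.GRing F.Gr where
  mul_zero x := map_zero (mul _ _ x)
  zero_mul y := DFunLike.congr_fun (map_zero (mul _ _)) y
  mul_add x y z := map_add (mul _ _ x) y z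
  add_mul x y z := DFunLike.congr_fun (map_add (mul _ _) x y) z
  one_mul := by
    rintro ⟨i, x⟩
    obtain ⟨x, rfl⟩ := cls_surjective i x
    exact sigma_cls_ext (zero_add i) _ _ (one_mul _)
  mul_one := by
    rintro ⟨i, x⟩
    obtain ⟨x, rfl⟩ := cls_surjective i x
    exact sigma_cls_ext (add_zero i) _ _ (mul_one _)
  mul_assoc := by
    rintro ⟨i, x⟩ ⟨j, y⟩ ⟨k, z⟩
    obtain ⟨x, rfl⟩ := cls_surjective i x
    obtain ⟨y, rfl⟩ := cls_surjective j y
    obtain ⟨z, rfl⟩ := cls_surjective k z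
    exact sigma_cls_ext (add_assoc i j k) _ _ (mul_assoc _ _ _)
  natCast m := m • F.cls 0 ⟨1, F.one_mem⟩
  natCast_zero := zero_smul _ _
  natCast_succ m := succ_nsmul _ _
  intCast m := m • F.cls 0 ⟨1, F.one_mem⟩
  intCast_ofNat m := natCast_zsmul _ _
  intCast_negSucc_ofNat m := by
    exact negSucc_zsmul _ _

variable (F)

/-- The associated graded ring `gr U = ⊕ F^m U / F^{m-1} U`. -/
abbrev GrRing : Type u := ⨁ m, F.Gr m

end RingFilt

/-! ### The rings `A(R)` and `U(P)`, and PBW-deformations -/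

section Quotients

variable {S : Type u} [Ring S] {V : Type v} [AddCommGroup V] [Module S V] [Module Sᵐᵒᵖ V]

/-- The quotient `T / ⟨X⟩` of the tensor ring by the two-sided ideal generated by a sub-bimodule
`X`. It is written `A(X)` when `X` is graded, and `U(X)` in general. -/
def QuotRing (X : SubBimod S (TensorRing S V)) : Type (max u v) :=
  (TwoSidedIdeal.span (X : Set (TensorRing S V))).ringCon.Quotient

namespace QuotRing

instance (X : SubBimod S (TensorRing S V)) : Ring (QuotRing X) :=
  inferInstanceAs (Ring (TwoSidedIdeal.span (X : Set (TensorRing S V))).ringCon.Quotient)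

/-- The canonical projection `T → T / ⟨X⟩`. -/
def mk (X : SubBimod S (TensorRing S V)) : TensorRing S V →+* QuotRing X :=
  (TwoSidedIdeal.span (X : Set (TensorRing S V))).ringCon.mk'

/-- `T / ⟨X⟩` as a left `S`-module. -/
instance (X : SubBimod S (TensorRing S V)) : Module S (QuotRing X) :=
  Module.compHom _ ((mk X).comp (TensorRing.scalar S V))

/-- The projection `T → T / ⟨X⟩` as a left `S`-linear map. -/
def mkₗ (X : SubBimod S (TensorRing S V)) : TensorRing S V →ₗ[S] QuotRing X where
  toFun := mk X
  map_add' := map_add _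
  map_smul' _ _ := map_mul (mk X) _ _

/-- The image of `T^m` in `T / ⟨X⟩`; for graded `X` it is the homogeneous component of degree `m`. -/
def homog (X : SubBimod S (TensorRing S V)) (m : ℕ) : Submodule S (QuotRing X) :=
  (TensorRing.homog S V m).map (mkₗ X)

/-- The filtration of `U(X)` by the images of the `T^{≤ m}`. -/
def filtration (X : SubBimod S (TensorRing S V)) : RingFilt (QuotRing X) where
  F m := ((TensorRing.filt S V m).map (mkₗ X)).toAddSubgroup
  mono _ _ h := Submodule.map_mono (TensorRing.filt_mono h)
  one_mem := ⟨1, TensorRing.homog_le_filt le_rfl TensorRing.one_mem_homog, map_one (mk X)⟩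
  mul_mem := by
    rintro i j _ _ ⟨x, hx, rfl⟩ ⟨y, hy, rfl⟩
    exact ⟨x * y, TensorRing.filt_mul hx hy, map_mul (mk X) x y⟩

/-- For `x ∈ T^m`, the class of `x + ⟨X⟩` in `gr^m U(X)`, viewed in `gr U(X)`. -/
def symb (X : SubBimod S (TensorRing S V)) (m : ℕ) (x : TensorRing S V)
    (hx : x ∈ TensorRing.homog S V m) : (filtration X).GrRing :=
  DirectSum.of (filtration X).Gr m
    ((filtration X).cls m ⟨mk X x, x, TensorRing.homog_le_filt le_rfl hx, rfl⟩)

/-- When the augmentation of `T` vanishes on `X`, the augmentation `A(X) → A(X)^0 = S`. -/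
def augmentation (X : SubBimod S (TensorRing S V))
    (hX : ∀ x ∈ X, TensorRing.augmentation S V x = 0) : QuotRing X →+* S :=
  RingCon.lift _ (TensorRing.augmentation S V) (by
    have h : TwoSidedIdeal.span (X : Set (TensorRing S V))
        ≤ TwoSidedIdeal.ker (TensorRing.augmentation S V) :=
      TwoSidedIdeal.span_le.mpr fun x hx => (TwoSidedIdeal.mem_ker _).mpr (hX x hx)
    intro x y hxy
    have h1 := h ((TwoSidedIdeal.rel_iff _ x y).mp hxy)
    rw [TwoSidedIdeal.mem_ker, map_sub, sub_eq_zero] at h1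
    exact h1)

end QuotRing

/-- `U(P)` is a PBW-deformation of `A(R)`: the canonical map `Φ : A(R) → gr U(P)`, which sends
`x + ⟨R⟩` with `x ∈ T^m` to the class of `x + ⟨P⟩` modulo `U(P)^{≤ m-1}`, is (well defined and) an
isomorphism. This condition on homogeneous elements determines `Φ`; it makes `Φ` a graded map and,
for `m = 0`, a map of `S`-rings. -/
def IsPBWDeformation (R P : SubBimod S (TensorRing S V)) : Prop :=
  ∃ Φ : QuotRing R ≃+* (QuotRing.filtration P).GrRing,
    ∀ (m : ℕ) (x : TensorRing S V) (hx : x ∈ TensorRing.homog S V m),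
      Φ (QuotRing.mk R x) = QuotRing.symb P m x hx

/-- For `P ⊆ T^{≤ n}`, the `n`-pure bimodule of relations `R = p^n(P)`. -/
noncomputable def pureRel (n : ℕ) (P : SubBimod S (TensorRing S V)) :
    SubBimod S (TensorRing S V) :=
  P.map (TensorRing.proj S V n)

theorem augmentation_pureRel {n : ℕ} (hn : 2 ≤ n) (P : SubBimod S (TensorRing S V)) :
    ∀ x ∈ pureRel n P, TensorRing.augmentation S V x = 0 := by
  rintro _ ⟨x, _, rfl⟩
  exact TensorRing.augmentation_proj (by omega) x

/-! ### Filtered maps and the Jacobi-type conditions -/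

/-- Morphisms of filtered bimodules `α : R → T` from a graded sub-bimodule `R` of `T`:
`α(R^m) ⊆ T^{≤ m}`. As usual, the component of degree `0` is required to be the inclusion. -/
structure FilteredMap (R : SubBimod S (TensorRing S V)) extends
    BimodHom S R (TensorRing S V) where
  filtered : ∀ (m : ℕ) (r : R), (r : TensorRing S V) ∈ TensorRing.homog S V m →
    toFun r ∈ TensorRing.filt S V m
  leading : ∀ (m : ℕ) (r : R), (r : TensorRing S V) ∈ TensorRing.homog S V m →
    TensorRing.proj S V m (toFun r) = r

/-- For `n`-pure `R`, the component `α_i = p^{n-i} α` of degree `-i` of `α` (zero if `i > n`). -/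
noncomputable def FilteredMap.component {R : SubBimod S (TensorRing S V)} (α : FilteredMap R)
    (n i : ℕ) : BimodHom S R (TensorRing S V) :=
  if i ≤ n then (TensorRing.proj S V (n - i)).comp α.toBimodHom else 0

variable (S V) in
/-- The multiplication `V ⊗_S T → T`. -/
noncomputable def mulLeft : BalTensor S V (TensorRing S V) →+ TensorRing S V :=
  BalTensor.lift (AddMonoidHom.mul.comp (TensorRing.ι S V)) (fun x s t => by
    simp [TensorRing.ι_op_smul, TensorRing.smul_def, mul_assoc])

variable (S V) in
/-- The multiplication `T ⊗_S V → T`. -/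
noncomputable def mulRight : BalTensor S (TensorRing S V) V →+ TensorRing S V :=
  BalTensor.lift (AddMonoidHom.mul.compl₂ (TensorRing.ι S V))
    (fun t s x => by simp [TensorRing.ι_smul, TensorRing.op_smul_def, mul_assoc])

/-- `V ⊗ f : V ⊗_S R → V ⊗_S T`, followed by the multiplication `V ⊗_S T → T`. -/
noncomputable def leftTensor {R : SubBimod S (TensorRing S V)}
    (f : BimodHom S R (TensorRing S V)) : BalTensor S V R →+ TensorRing S V :=
  (mulLeft S V).comp (BalTensor.lTensor V f.toLinearMap)

/-- `f ⊗ V : R ⊗_S V → T ⊗_S V`, followed by the multiplication `T ⊗_S V → T`. -/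
noncomputable def rightTensor {R : SubBimod S (TensorRing S V)}
    (f : BimodHom S R (TensorRing S V)) : BalTensor S R V →+ TensorRing S V :=
  (mulRight S V).comp (BalTensor.rTensor V f.toRight)

/-- `X = (V ⊗ R) ∩ (R ⊗ V)`, that is, the fibre product of `V ⊗_S R` and `R ⊗_S V` over `T`. Its
elements are the pairs of an element of `V ⊗_S R` and an element of `R ⊗_S V` with the same image
in `T`. -/
noncomputable def overlap (R : SubBimod S (TensorRing S V)) :
    AddSubgroup (BalTensor S V R × BalTensor S R V) :=
  ((leftTensor R.incl).comp (AddMonoidHom.fst _ _)).eqLocus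
    ((rightTensor R.incl).comp (AddMonoidHom.snd _ _))

/-- The map `V ⊗ f - f ⊗ V : X → T`. -/
noncomputable def overlapDiff {R : SubBimod S (TensorRing S V)}
    (f : BimodHom S R (TensorRing S V)) : overlap R →+ TensorRing S V :=
  ((leftTensor f).comp (AddMonoidHom.fst _ _) -
    (rightTensor f).comp (AddMonoidHom.snd _ _)).comp (overlap R).subtype

/-- The conditions `(J'_0)`, `(J'_i)` for `0 < i < n`, and `(J'_n)` on a filtered map
`α : R → T`, where `R` is `n`-pure: for every `x ∈ X`, the element
`r = (V ⊗ α_1 - α_1 ⊗ V)(x)` lies in `R`, `α_i(r) = (V ⊗ α_{i+1} - α_{i+1} ⊗ V)(x)` for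
`0 < i < n`, and `α_n(r) = 0`. -/
def FilteredMap.Jacobi {R : SubBimod S (TensorRing S V)} (α : FilteredMap R) (n : ℕ) : Prop :=
  ∀ x : overlap R, ∃ r : R,
    (r : TensorRing S V) = overlapDiff (α.component n 1) x ∧
    (∀ i : ℕ, 0 < i → i < n → α.component n i r = overlapDiff (α.component n (i + 1)) x) ∧
    α.component n n r = 0

end Quotients

/-! ### Internally graded Tor -/

section Tor

/-- A left module over `A` together with a family of subgroups, its homogeneous components. -/
structure GrMod (A : Type a) [Ring A] where
  carrier : Type a
  [addCommGroup : AddCommGroup carrier]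
  [module : Module A carrier]
  deg : ℕ → AddSubgroup carrier

namespace GrMod

variable {A : Type a} [Ring A]

instance : CoeSort (GrMod A) (Type a) := ⟨GrMod.carrier⟩
instance (N : GrMod A) : AddCommGroup N := N.addCommGroup
instance (N : GrMod A) : Module A N := N.module

/-- The free graded module with one basis element, of degree `m`, for every `m` and every
homogeneous element of degree `m` of `N`. Here `𝒜` is the grading of `A`. -/
noncomputable def free (𝒜 : ℕ → AddSubgroup A) (N : GrMod A) : GrMod A where
  carrier := (Σ m, N.deg m) →₀ A
  deg k :=
    { carrier := {f | ∀ i, f i ∈ (if i.1 ≤ k then 𝒜 (k - i.1) else ⊥ : AddSubgroup A)}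
      zero_mem' := fun _ => zero_mem _
      add_mem' := fun hf hg i => add_mem (hf i) (hg i)
      neg_mem' := fun hf i => neg_mem (hf i) }

/-- The map from the free graded module on the homogeneous elements of `N` to `N`. -/
noncomputable def cover (𝒜 : ℕ → AddSubgroup A) (N : GrMod A) : free 𝒜 N →ₗ[A] N :=
  Finsupp.linearCombination A (fun i : Σ m, N.deg m => (i.2 : N))

/-- The kernel of `cover`, with the grading induced from the free module. -/
noncomputable def syzygy (𝒜 : ℕ → AddSubgroup A) (N : GrMod A) : GrMod A where
  carrier := LinearMap.ker (cover 𝒜 N)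
  deg k := ((free 𝒜 N).deg k).comap (LinearMap.ker (cover 𝒜 N)).subtype.toAddMonoidHom

/-- Iterated syzygies. -/
noncomputable def syzygies (𝒜 : ℕ → AddSubgroup A) (N : GrMod A) : ℕ → GrMod A
  | 0 => N
  | i + 1 => syzygy 𝒜 (syzygies 𝒜 N i)

/-- The `i`-th term of the canonical graded free resolution of `N`. -/
noncomputable def res (𝒜 : ℕ → AddSubgroup A) (N : GrMod A) (i : ℕ) : GrMod A :=
  free 𝒜 (syzygies 𝒜 N i)

/-- The differential of the canonical graded free resolution. -/
noncomputable def resD (𝒜 : ℕ → AddSubgroup A) (N : GrMod A) (i : ℕ) :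
    res 𝒜 N (i + 1) →ₗ[A] res 𝒜 N i :=
  (LinearMap.ker (cover 𝒜 (syzygies 𝒜 N i))).subtype.comp (cover 𝒜 (syzygies 𝒜 N (i + 1)))

end GrMod

variable {A : Type a} [Ring A] (𝒜 : ℕ → AddSubgroup A)
  (M : Type b) [AddCommGroup M] [Module Aᵐᵒᵖ M] (ℳ : ℕ → AddSubgroup M) (N : GrMod A)

/-- The cycles of degree `j` of the complex `M ⊗_A Q`, where `Q` is the canonical graded free
resolution of `N`. -/
noncomputable def torCycles : (j : ℕ) → AddSubgroup (BalTensor A M (N.res 𝒜 j))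
  | 0 => ⊤
  | j + 1 => (BalTensor.lTensor M (N.resD 𝒜 j)).ker

/-- `Tor_j^A(M, N)`. -/
def GrTor (j : ℕ) : Type (max a b) :=
  torCycles 𝒜 M N j ⧸
    (BalTensor.lTensor M (N.resD 𝒜 j)).range.addSubgroupOf (torCycles 𝒜 M N j)

noncomputable instance (j : ℕ) : AddCommGroup (GrTor 𝒜 M N j) :=
  inferInstanceAs (AddCommGroup (torCycles 𝒜 M N j ⧸
    (BalTensor.lTensor M (N.resD 𝒜 j)).range.addSubgroupOf (torCycles 𝒜 M N j)))

/-- The homogeneous component of degree `m` of `M ⊗_A Q_j`. -/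
noncomputable def tensorDeg (j m : ℕ) : AddSubgroup (BalTensor A M (N.res 𝒜 j)) :=
  AddSubgroup.closure {z | ∃ (k l : ℕ) (x : M) (q : N.res 𝒜 j), k + l = m ∧ x ∈ ℳ k ∧
    q ∈ (N.res 𝒜 j).deg l ∧ z = BalTensor.tmul A x q}

/-- The homogeneous component `Tor_{j,m}^A(M, N)` of internal degree `m`: the classes of the
cycles of degree `m`. -/
noncomputable def GrTor.component (j m : ℕ) : AddSubgroup (GrTor 𝒜 M N j) :=
  ((tensorDeg 𝒜 M ℳ N j m).addSubgroupOf (torCycles 𝒜 M N j)).map (QuotientAddGroup.mk' _)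

/-- The ring `S`, viewed as a left and right `A`-module through a ring homomorphism `A → S`. -/
def AugMod {S : Type c} [Ring S] (_ : A →+* S) : Type (max a c) := ULift.{a} S

namespace AugMod

variable {S : Type c} [Ring S] (ε : A →+* S)

instance : AddCommGroup (AugMod ε) := inferInstanceAs (AddCommGroup (ULift.{a} S))

instance : Module A (AugMod ε) :=
  Module.compHom (ULift.{a} S) ε

instance : Module Aᵐᵒᵖ (AugMod ε) :=
  Module.compHom (ULift.{a} S) ε.op

/-- `S` is concentrated in degree `0`. -/
def deg : ℕ → AddSubgroup (AugMod ε)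
  | 0 => ⊤
  | _ + 1 => ⊥

end AugMod

end Tor

section TorQuot

variable {S : Type u} [Ring S] {V : Type v} [AddCommGroup V] [Module S V] [Module Sᵐᵒᵖ V]

/-- The grading of `A(R)`. -/
def gradingA (R : SubBimod S (TensorRing S V)) (m : ℕ) : AddSubgroup (QuotRing R) :=
  (QuotRing.homog R m).toAddSubgroup

/-- `S` as a graded left `A(R)`-module, concentrated in degree `0`. -/
def gradedS (R : SubBimod S (TensorRing S V))
    (hR : ∀ x ∈ R, TensorRing.augmentation S V x = 0) : GrMod.{max u v} (QuotRing R) where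
  carrier := AugMod.{max u v, u} (QuotRing.augmentation R hR)
  deg := AugMod.deg _

/-- `Tor_j^A(S, S)` for `A = A(R)`, with `S` an `A`-module on both sides through `A → A^0 = S`. -/
abbrev TorSS (R : SubBimod S (TensorRing S V))
    (hR : ∀ x ∈ R, TensorRing.augmentation S V x = 0) (j : ℕ) : Type (max u v) :=
  GrTor (gradingA R) (AugMod (QuotRing.augmentation R hR)) (gradedS R hR) j

/-- `Tor_j^A(S, S)` is `k`-pure: it is concentrated in internal degree `k`. -/
def TorSSIsPure (R : SubBimod S (TensorRing S V))
    (hR : ∀ x ∈ R, TensorRing.augmentation S V x = 0) (j k : ℕ) : Prop :=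
  GrTor.component (gradingA R) (AugMod (QuotRing.augmentation R hR)) (AugMod.deg _)
    (gradedS R hR) j k = ⊤

end TorQuot

/-! Let ⟨P⟩ and ⟨R⟩ be the two-sided ideals. U(P) is a PBW-deformation exactly when all leading
terms of ⟨P⟩ lie in ⟨R⟩ (`isPBWDeformation_iff`).

Necessity (`exists_filteredMap`). As ⟨R⟩ starts in degree n, the ideal ⟨P⟩ meets T^{≤n-1} in 0, so
an element of ⟨P⟩ ∩ T^{≤n} is determined by its degree n part. Hence p^n : P → R is bijective and α
is its inverse. The element (V⊗α - α⊗V)(x) lies in ⟨P⟩ ∩ T^{≤n}, so it is α of its own degree n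
part; read in each degree, these are the Jacobi conditions (`FilteredMap.jacobi_iff`). They hold
whether or not Tor_3 vanishes.

Sufficiency. Let I_m be the sum of the T^i P T^j with i+n+j ≤ m (`relFilt`). The degree m parts of
I_m lie in ⟨R⟩, so it is enough that I_{m+1} ∩ T^{≤m} ⊆ I_m (`mem_relFilt_of_mem_filt`). Modulo I_m
and I_m V, an element of I_{m+1} has the form Σ y_r α(r) with y in T⊗R of degree m+1. If its degree
m+1 part cancels, then y becomes a cycle of A⊗R → A⊗V. Now A⊗R → A⊗V → A → S → 0 is the beginning of
a minimal graded projective resolution, so Tor_3 controls the generators of the kernel of A⊗R → A⊗V: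
it is generated in degree n+1 if Tor_3 is pure (`QuotRing.mem_genDeg_of_pure`) and is 0 if Tor_3 =
0. Its elements of degree n+1 come from X (`exists_overlap_of_mem_kerDeg`), and for x in X the
Jacobi conditions give (V⊗α)(x) = α(r) + (α⊗V)(x), an element of P + PV. Hence Σ y_r α(r) lies in
I_m + I_m V. Finally an element of I_m V of degree at most m is in I_m: strip the last letter and
use induction on m (`mem_relFilt_of_mem_relFiltMulι`).

Projectivity of V and R enters through linear sections σ of S^(V) → V and σ' of S^(R) → R. They make
A⊗V and A⊗R images of idempotents on free modules, and `deriv σ` inverts the multiplication T⊗V →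
T_+. -/

namespace TensorRing

variable {S : Type u} [Ring S] {V : Type v} [AddCommGroup V] [Module S V] [Module Sᵐᵒᵖ V]

/-! ### Homogeneous components of the tensor ring. -/

theorem scalar_mem_homog (s : S) : scalar S V s ∈ homog S V 0 :=
  Submodule.mem_span_singleton.mpr ⟨s, by rw [smul_def, mul_one]⟩

theorem exists_scalar_of_mem_homog_zero {t : TensorRing S V} (ht : t ∈ homog S V 0) :
    ∃ s, t = scalar S V s := by
  obtain ⟨s, rfl⟩ := Submodule.mem_span_singleton.mp ht
  exact ⟨s, by rw [smul_def, mul_one]⟩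

theorem ι_mem_homog (x : V) : ι S V x ∈ homog S V 1 :=
  Submodule.subset_span ⟨x, 1, one_mem_homog, (mul_one _).symm⟩

/-- Lets additivity be used once for products with fixed outer factors; one-sided products are the
cases where an outer factor is 1. -/
theorem mul_mem_of_mem_closure {B : Type w} [Ring B] {X : Set B} {K : AddSubgroup B} {a b c : B}
    (hb : b ∈ AddSubgroup.closure X) (h : ∀ x ∈ X, a * x * c ∈ K) : a * b * c ∈ K :=
  (AddSubgroup.closure_le
    (K.comap ((AddMonoidHom.mulRight c).comp (AddMonoidHom.mulLeft a)))).mpr h hb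

/-- `homog` is defined by splitting off the first letter. The resolution below consists of left
modules, so the last letter has to be split off instead. -/
theorem mem_closure_of_mem_homog_succ {m : ℕ} {x : TensorRing S V} (hx : x ∈ homog S V (m + 1)) :
    x ∈ AddSubgroup.closure {z | ∃ t ∈ homog S V m, ∃ y : V, z = t * ι S V y} := by
  have key : ∀ m (s : S) (x : TensorRing S V),
      x ∈ AddSubgroup.closure {z | ∃ t ∈ homog S V m, ∃ y : V, z = t * ι S V y} →
      s • x ∈ AddSubgroup.closure {z | ∃ t ∈ homog S V m, ∃ y : V, z = t * ι S V y} := by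
    intro m s x hx
    rw [smul_def, ← mul_one (_ * x)]
    refine mul_mem_of_mem_closure hx ?_
    rintro _ ⟨t, ht, y, rfl⟩
    exact AddSubgroup.subset_closure ⟨s • t, Submodule.smul_mem _ s ht, y,
      by simp only [smul_def, mul_assoc, mul_one]⟩
  induction m generalizing x with
  | zero =>
    induction hx using Submodule.span_induction with
    | mem x hx =>
      obtain ⟨y, t, ht, rfl⟩ := hx
      obtain ⟨s, rfl⟩ := exists_scalar_of_mem_homog_zero ht
      exact AddSubgroup.subset_closure ⟨1, one_mem_homog, op s • y, by rw [one_mul, ι_op_smul]⟩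
    | zero => exact zero_mem _
    | add x y _ _ hx hy => exact add_mem hx hy
    | smul s x _ hx => exact key _ s x hx
  | succ m ih =>
    induction hx using Submodule.span_induction with
    | mem x hx =>
      obtain ⟨y, t, ht, rfl⟩ := hx
      rw [← mul_one (_ * t)]
      refine mul_mem_of_mem_closure (ih ht) ?_
      rintro _ ⟨t, ht, z, rfl⟩
      exact AddSubgroup.subset_closure ⟨ι S V y * t, Submodule.subset_span ⟨y, t, ht, rfl⟩, z,
        by rw [mul_one, mul_assoc]⟩
    | zero => exact zero_mem _
    | add x y _ _ hx hy => exact add_mem hx hy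
    | smul s x _ hx => exact key _ s x hx

/-- The elements of bounded degree form a subring containing S and V, and the universal property
factors the identity of T through it. -/
theorem exists_mem_filt (t : TensorRing S V) : ∃ m, t ∈ filt S V m := by
  let B : Subring (TensorRing S V) :=
    { carrier := {t | ∃ m, t ∈ filt S V m}
      zero_mem' := ⟨0, zero_mem _⟩
      one_mem' := ⟨0, homog_le_filt le_rfl one_mem_homog⟩
      add_mem' := fun ⟨i, hi⟩ ⟨j, hj⟩ => ⟨max i j,
        add_mem (filt_mono (le_max_left i j) hi) (filt_mono (le_max_right i j) hj)⟩
      neg_mem' := fun ⟨i, hi⟩ => ⟨i, neg_mem hi⟩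
      mul_mem' := fun ⟨i, hi⟩ ⟨j, hj⟩ => ⟨i + j, filt_mul hi hj⟩ }
  have h1 : ∀ s, scalar S V s ∈ B := fun s => ⟨0, homog_le_filt le_rfl (scalar_mem_homog s)⟩
  have h2 : ∀ x, ι S V x ∈ B := fun x => ⟨1, homog_le_filt le_rfl (ι_mem_homog x)⟩
  let F : TensorRing S V →+* B := lift ((scalar S V).codRestrict B h1)
    ((ι S V).codRestrict B.toAddSubgroup h2)
    (fun s x => Subtype.ext (ι_smul s x)) (fun s x => Subtype.ext (ι_op_smul s x))
  have h : B.subtype.comp F = RingHom.id _ := by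
    apply hom_ext
    · intro s
      exact congrArg Subtype.val (lift_scalar _ _ _ _ s)
    · intro x
      exact congrArg Subtype.val (lift_ι _ _ _ _ x)
  have h3 := DFunLike.congr_fun h t
  rw [← show (F t : TensorRing S V) = t from h3]
  exact (F t).2

theorem proj_apply (m : ℕ) (t : TensorRing S V) : proj S V m t = (weight S V t).coeff m := rfl

theorem proj_add (m : ℕ) (x y : TensorRing S V) :
    proj S V m (x + y) = proj S V m x + proj S V m y := by simp [proj_apply]

theorem proj_zero (m : ℕ) : proj S V m (0 : TensorRing S V) = 0 := by simp [proj_apply]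

theorem proj_neg (m : ℕ) (x : TensorRing S V) : proj S V m (-x) = -proj S V m x := by
  simp [proj_apply]

theorem proj_sub (m : ℕ) (x y : TensorRing S V) :
    proj S V m (x - y) = proj S V m x - proj S V m y := by simp [proj_apply]

theorem proj_of_mem_homog {m : ℕ} {t : TensorRing S V} (ht : t ∈ homog S V m) (k : ℕ) :
    proj S V k t = if m = k then t else 0 := by
  rw [proj_apply, weight_of_mem_homog ht, Polynomial.coeff_monomial]

theorem proj_same {m : ℕ} {t : TensorRing S V} (ht : t ∈ homog S V m) : proj S V m t = t := by
  rw [proj_of_mem_homog ht, if_pos rfl]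

theorem proj_ne {m k : ℕ} {t : TensorRing S V} (ht : t ∈ homog S V m) (h : m ≠ k) :
    proj S V k t = 0 := by
  rw [proj_of_mem_homog ht, if_neg h]

theorem proj_mem (k : ℕ) (t : TensorRing S V) : proj S V k t ∈ homog S V k := by
  obtain ⟨m, hm⟩ := exists_mem_filt t
  refine filt_induction (p := fun t => proj S V k t ∈ homog S V k) hm ?_ ?_ ?_
  · intro i _ y hy
    rw [proj_of_mem_homog hy]
    split_ifs with h
    · exact h ▸ hy
    · exact zero_mem _
  · rw [proj_zero]; exact zero_mem _
  · intro y z hy hz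
    rw [proj_add]; exact add_mem hy hz

theorem proj_eq_zero {m k : ℕ} {t : TensorRing S V} (ht : t ∈ filt S V m) (h : m < k) :
    proj S V k t = 0 := by
  refine filt_induction (p := fun t => proj S V k t = 0) ht ?_ (proj_zero k) ?_
  · intro i hi y hy
    exact proj_ne hy (by omega)
  · intro y z hy hz
    rw [proj_add, hy, hz, add_zero]

theorem sub_proj_mem {m : ℕ} {t : TensorRing S V} (ht : t ∈ filt S V (m + 1)) :
    t - proj S V (m + 1) t ∈ filt S V m := by
  refine filt_induction (p := fun t => t - proj S V (m + 1) t ∈ filt S V m) ht ?_ ?_ ?_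
  · intro i hi y hy
    rw [proj_of_mem_homog hy]
    split_ifs with h
    · rw [sub_self]; exact zero_mem _
    · rw [sub_zero]; exact homog_le_filt (by omega) hy
  · rw [proj_zero, sub_zero]; exact zero_mem _
  · intro y z hy hz
    rw [proj_add, add_sub_add_comm]; exact add_mem hy hz

theorem mem_filt_of_proj_eq_zero {m : ℕ} {t : TensorRing S V} (ht : t ∈ filt S V (m + 1))
    (h : proj S V (m + 1) t = 0) : t ∈ filt S V m := by
  have := sub_proj_mem ht
  rwa [h, sub_zero] at this

theorem mem_homog_zero_of_mem_filt {t : TensorRing S V} (ht : t ∈ filt S V 0) :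
    t ∈ homog S V 0 := by
  refine filt_induction (p := fun t => t ∈ homog S V 0) ht ?_ (zero_mem _)
    (fun y z hy hz => add_mem hy hz)
  intro i hi y hy
  rwa [Nat.le_zero.mp hi] at hy

theorem eq_zero_of_proj {t : TensorRing S V} (h : ∀ k, proj S V k t = 0) : t = 0 := by
  obtain ⟨m, hm⟩ := exists_mem_filt t
  induction m with
  | zero => rw [← h 0, proj_same (mem_homog_zero_of_mem_filt hm)]
  | succ m ih => exact ih (mem_filt_of_proj_eq_zero hm (h _))

theorem ext_proj {t t' : TensorRing S V} (h : ∀ k, proj S V k t = proj S V k t') : t = t' :=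
  sub_eq_zero.mp (eq_zero_of_proj fun k => by rw [proj_sub, h, sub_self])

theorem proj_mul_left {i : ℕ} {x : TensorRing S V} (hx : x ∈ homog S V i) (k : ℕ)
    (y : TensorRing S V) : proj S V (i + k) (x * y) = x * proj S V k y := by
  rw [proj_apply, map_mul, weight_of_mem_homog hx, add_comm i k, Polynomial.coeff_monomial_mul,
    proj_apply]

theorem proj_mul_right {j : ℕ} {y : TensorRing S V} (hy : y ∈ homog S V j) (k : ℕ)
    (x : TensorRing S V) : proj S V (k + j) (x * y) = proj S V k x * y := by
  rw [proj_apply, map_mul, weight_of_mem_homog hy, Polynomial.coeff_mul_monomial,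
    proj_apply]

theorem proj_zero_mul_ι (x : TensorRing S V) (y : V) : proj S V 0 (x * ι S V y) = 0 := by
  rw [proj_apply, map_mul, weight_ι, Polynomial.mul_coeff_zero, Polynomial.coeff_monomial]
  simp

theorem proj_zero_ι_mul (x : TensorRing S V) (y : V) : proj S V 0 (ι S V y * x) = 0 := by
  rw [proj_apply, map_mul, weight_ι, Polynomial.mul_coeff_zero, Polynomial.coeff_monomial]
  simp

/-- Every element of `T` is the sum of its homogeneous components. -/
theorem sum_proj {m : ℕ} {t : TensorRing S V} (ht : t ∈ filt S V m) :
    t = ∑ k ∈ Finset.range (m + 1), proj S V k t := by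
  induction m generalizing t with
  | zero => simp [proj_same (mem_homog_zero_of_mem_filt ht)]
  | succ m ih =>
    rw [Finset.sum_range_succ]
    have h := ih (sub_proj_mem ht)
    rw [← sub_eq_iff_eq_add]
    refine h.trans (Finset.sum_congr rfl fun k hk => ?_)
    rw [proj_sub, proj_ne (proj_mem (m + 1) t) (by have := Finset.mem_range.mp hk; omega), sub_zero]

theorem induction_homog {p : TensorRing S V → Prop} (t : TensorRing S V)
    (h1 : ∀ k, ∀ y ∈ homog S V k, p y) (h0 : p 0) (ha : ∀ y z, p y → p z → p (y + z)) : p t := by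
  obtain ⟨m, hm⟩ := exists_mem_filt t
  exact filt_induction hm (fun k _ => h1 k) h0 ha

/-- Generation of two-sided ideals by products with homogeneous elements. -/
theorem mem_closure_of_mem_span {X : Set (TensorRing S V)} {t : TensorRing S V}
    (ht : t ∈ TwoSidedIdeal.span X) :
    t ∈ AddSubgroup.closure {z | ∃ i j x y, ∃ p ∈ X, x ∈ homog S V i ∧ y ∈ homog S V j ∧
      z = x * p * y} := by
  rw [TwoSidedIdeal.mem_span_iff_mem_addSubgroup_closure] at ht
  induction ht using AddSubgroup.closure_induction with
  | mem z hz =>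
    obtain ⟨_, ⟨x, -, p, hp, rfl⟩, y, -, rfl⟩ := hz
    dsimp only
    refine induction_homog (p := fun x => x * p * y ∈ _) x (fun i x hx => ?_) ?_ ?_
    · refine induction_homog (p := fun y => x * p * y ∈ _) y (fun j y hy => ?_) ?_ ?_
      · exact AddSubgroup.subset_closure ⟨i, j, x, y, p, hp, hx, hy, rfl⟩
      · rw [mul_zero]; exact zero_mem _
      · intro y z hy hz; rw [mul_add]; exact add_mem hy hz
    · rw [zero_mul, zero_mul]; exact zero_mem _
    · intro y z hy hz; rw [add_mul, add_mul]; exact add_mem hy hz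
  | zero => exact zero_mem _
  | add x y _ _ hx hy => exact add_mem hx hy
  | neg x _ hx => exact neg_mem hx

/-! ### Right-hand partial derivatives on the tensor ring. -/

section Derivative

variable (S V) in
/-- The additive maps from the left linear forms on `V` to `T`. -/
def FormMap : Type (max u v) := (V →ₗ[S] S) →+ TensorRing S V

instance : AddCommGroup (FormMap S V) :=
  inferInstanceAs (AddCommGroup ((V →ₗ[S] S) →+ TensorRing S V))

instance : FunLike (FormMap S V) (V →ₗ[S] S) (TensorRing S V) :=
  inferInstanceAs (FunLike ((V →ₗ[S] S) →+ TensorRing S V) _ _)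

theorem FormMap.ext {m m' : FormMap S V} (h : ∀ f, m f = m' f) : m = m' := AddMonoidHom.ext h

/-- T × S acts on the left through T and, below, on the right through S. With t embedded as (t,
ε(t)), a square-zero extension then encodes a derivation satisfying ∂(tu) = t ∂u + (∂t) ε(u). All
forms are treated at once because x ↦ x s changes the form f into `formMul s f`. -/
instance : Module (TensorRing S V × S) (FormMap S V) where
  smul r m := (AddMonoidHom.mulLeft r.1).comp m
  one_smul m := FormMap.ext fun f => one_mul (m f)
  mul_smul r r' m := FormMap.ext fun f => mul_assoc r.1 r'.1 (m f)
  smul_zero r := FormMap.ext fun _ => mul_zero r.1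
  smul_add r m m' := FormMap.ext fun f => mul_add r.1 (m f) (m' f)
  add_smul r r' m := FormMap.ext fun f => add_mul r.1 r'.1 (m f)
  zero_smul m := FormMap.ext fun f => zero_mul (m f)

variable [SMulCommClass S Sᵐᵒᵖ V]

/-- The linear form `x ↦ f (x s)`. -/
def formMul (s : S) : (V →ₗ[S] S) →+ (V →ₗ[S] S) where
  toFun f :=
    { toFun := fun x => f (op s • x)
      map_add' := fun x y => by rw [smul_add, map_add]
      map_smul' := fun r x => by rw [← smul_comm, map_smul, RingHom.id_apply] }
  map_zero' := rfl
  map_add' _ _ := rfl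

instance : Module (TensorRing S V × S)ᵐᵒᵖ (FormMap S V) where
  smul r m := AddMonoidHom.comp m (formMul r.unop.2)
  one_smul m := FormMap.ext fun f => congrArg m (LinearMap.ext fun x => by
    exact congrArg f (one_smul Sᵐᵒᵖ x))
  mul_smul r r' m := FormMap.ext fun f => congrArg m (LinearMap.ext fun x => by
    exact congrArg f (mul_smul (op r.unop.2) (op r'.unop.2) x))
  smul_zero r := rfl
  smul_add r m m' := rfl
  add_smul r r' m := FormMap.ext fun f => by
    refine Eq.trans (congrArg m ?_) (AddMonoidHom.map_add m _ _)
    refine LinearMap.ext fun x => ?_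
    exact (congrArg f (add_smul (op r.unop.2) (op r'.unop.2) x)).trans (map_add f _ _)
  zero_smul m := FormMap.ext fun f => by
    refine Eq.trans (congrArg m ?_) (AddMonoidHom.map_zero m)
    refine LinearMap.ext fun x => ?_
    exact (congrArg f (zero_smul Sᵐᵒᵖ x)).trans (map_zero f)

instance : SMulCommClass (TensorRing S V × S) (TensorRing S V × S)ᵐᵒᵖ (FormMap S V) where
  smul_comm _ _ _ := rfl

variable (S V) in
/-- The map `x ↦ (f ↦ f x)`. -/
def formDual : V →+ FormMap S V where
  toFun x := (scalar S V).toAddMonoidHom.comp (LinearMap.evalAddMonoidHom x)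
  map_zero' := FormMap.ext fun f => (congrArg _ (map_zero f)).trans (map_zero (scalar S V))
  map_add' x y := FormMap.ext fun f =>
    (congrArg _ (map_add f x y)).trans (map_add (scalar S V) _ _)

omit [SMulCommClass S Sᵐᵒᵖ V] in
theorem formDual_apply (x : V) (f : V →ₗ[S] S) : formDual S V x f = scalar S V (f x) := rfl

variable (S V) in
/-- The map `x ↦ (x, 0) + (f ↦ f x)`. -/
def derivGen : V →+ TrivSqZeroExt (TensorRing S V × S) (FormMap S V) where
  toFun x := TrivSqZeroExt.inl (ι S V x, 0) + TrivSqZeroExt.inr (formDual S V x)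
  map_zero' := TrivSqZeroExt.ext (by simp) (by simp)
  map_add' x y := TrivSqZeroExt.ext (by simp) (by simp)

variable (S V) in
/-- The ring homomorphism `t ↦ (t, ε(t)) + ∂ t`, where `∂` is the derivation with
`∂ (x) (f) = f x` for `x ∈ V`. -/
noncomputable def derivHom : TensorRing S V →+* TrivSqZeroExt (TensorRing S V × S) (FormMap S V) :=
  lift ((TrivSqZeroExt.inlHom _ _).comp ((scalar S V).prod (RingHom.id S))) (derivGen S V)
    (fun s x => by
      refine TrivSqZeroExt.ext ?_ ?_
      · simp [derivGen, ι_smul]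
      · simp [derivGen]
        exact FormMap.ext fun f => (congrArg (scalar S V) (map_smul f s x)).trans
          (map_mul (scalar S V) _ _))
    (fun s x => by
      refine TrivSqZeroExt.ext ?_ ?_
      · simp [derivGen, ι_op_smul]
      · simp [derivGen]
        rfl)

variable (V) in
/-- The partial derivative along a left linear form `f`: the additive map with `t x ↦ t f(x)` for
`x ∈ V` which vanishes on `S`. -/
noncomputable def pderiv (f : V →ₗ[S] S) : TensorRing S V →+ TensorRing S V where
  toFun t := (derivHom S V t).snd f
  map_zero' := by rw [map_zero]; rfl
  map_add' x y := by rw [map_add]; rfl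

theorem derivHom_fst (t : TensorRing S V) : (derivHom S V t).fst.1 = t := by
  have h : ((RingHom.fst _ S).comp ((TrivSqZeroExt.fstHom ℤ (TensorRing S V × S)
      (FormMap S V)).toRingHom)).comp (derivHom S V) = RingHom.id _ := by
    apply hom_ext
    · intro s
      simp [derivHom, lift_scalar]
    · intro x
      simp [derivHom, lift_ι, derivGen]
  exact DFunLike.congr_fun h t

theorem pderiv_scalar (f : V →ₗ[S] S) (s : S) : pderiv V f (scalar S V s) = 0 := by
  change (derivHom S V (scalar S V s)).snd f = 0
  rw [derivHom, lift_scalar]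
  rfl

theorem pderiv_mul_ι (f : V →ₗ[S] S) (t : TensorRing S V) (x : V) :
    pderiv V f (t * ι S V x) = t * scalar S V (f x) := by
  change (derivHom S V (t * ι S V x)).snd f = _
  rw [map_mul, TrivSqZeroExt.snd_mul]
  have h1 : (derivHom S V (ι S V x)) = derivGen S V x := lift_ι _ _ _ _ x
  -- The term (∂t) ε(x) of the product rule vanishes because ε(x) = 0.
  have h2 : MulOpposite.op (derivHom S V (ι S V x)).fst • (derivHom S V t).snd = 0 := by
    refine FormMap.ext fun f => ?_
    rw [h1]
    have h3 : formMul (0 : S) f = 0 := LinearMap.ext fun x => by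
      exact (congrArg f (zero_smul Sᵐᵒᵖ x)).trans (map_zero f)
    have h4 : (derivGen S V x).fst.2 = (0 : S) := by simp [derivGen]
    change (derivHom S V t).snd (formMul ((derivGen S V x).fst.2) f) = 0
    rw [h4, h3]
    exact map_zero (show (V →ₗ[S] S) →+ TensorRing S V from (derivHom S V t).snd)
  rw [h2, add_zero, h1]
  change (derivHom S V t).fst.1 * (derivGen S V x).snd f = _
  rw [derivHom_fst]
  simp [derivGen, formDual_apply]

end Derivative

end TensorRing
namespace TensorRing

variable {S : Type u} [Ring S] {V : Type v} [AddCommGroup V] [Module S V] [Module Sᵐᵒᵖ V]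

theorem mem_closure_of_proj_zero {t : TensorRing S V} (h : proj S V 0 t = 0) :
    t ∈ AddSubgroup.closure {z | ∃ (t : TensorRing S V) (y : V), z = t * ι S V y} := by
  obtain ⟨m, hm⟩ := exists_mem_filt t
  rw [sum_proj hm, Finset.sum_range_succ', h, add_zero]
  refine sum_mem fun k _ => ?_
  exact AddSubgroup.closure_mono (by rintro z ⟨t, _, y, h⟩; exact ⟨t, y, h⟩)
    (mem_closure_of_mem_homog_succ (proj_mem (k + 1) t))

section Deriv

variable [SMulCommClass S Sᵐᵒᵖ V] (σ : V →ₗ[S] V →₀ S)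

theorem pderiv_finite (t : TensorRing S V) :
    (Function.support fun v => pderiv V ((Finsupp.lapply v).comp σ) t).Finite := by
  have key : ∀ z ∈ AddSubgroup.closure {z | ∃ (t : TensorRing S V) (y : V), z = t * ι S V y},
      (Function.support fun v => pderiv V ((Finsupp.lapply v).comp σ) z).Finite := by
    intro z hz
    induction hz using AddSubgroup.closure_induction with
    | mem z hz =>
      obtain ⟨t, y, rfl⟩ := hz
      refine (σ y).support.finite_toSet.subset fun v hv => ?_
      rw [Finset.mem_coe, Finsupp.mem_support_iff]
      intro h
      refine hv ?_
      dsimp only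
      rw [pderiv_mul_ι, LinearMap.comp_apply, Finsupp.lapply_apply, h, map_zero, mul_zero]
    | zero => simp
    | add x y _ _ hx hy =>
      refine (hx.union hy).subset ?_
      simp only [map_add]
      exact Function.support_add _ _
    | neg x _ hx => simpa only [map_neg, Function.support_fun_neg] using hx
  have h0 := key (t - proj S V 0 t)
    (mem_closure_of_proj_zero (by rw [proj_sub, proj_same (proj_mem 0 t), sub_self]))
  obtain ⟨s, hs⟩ := exists_scalar_of_mem_homog_zero (proj_mem 0 t)
  simpa only [map_sub, hs, pderiv_scalar, sub_zero] using h0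

/-- For a left linear map `σ : V → S^(V)`, the map `T → T^(V)` with `t x ↦ t σ(x)` for `x ∈ V`
which vanishes on `S`. -/
noncomputable def deriv : TensorRing S V →+ (V →₀ TensorRing S V) where
  toFun t := Finsupp.ofSupportFinite _ (pderiv_finite σ t)
  map_zero' := Finsupp.ext fun v => map_zero (pderiv V ((Finsupp.lapply v).comp σ))
  map_add' x y := Finsupp.ext fun v => map_add (pderiv V ((Finsupp.lapply v).comp σ)) x y

theorem deriv_scalar (s : S) : deriv σ (scalar S V s) = 0 :=
  Finsupp.ext fun _ => pderiv_scalar _ s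

theorem deriv_mul_ι (t : TensorRing S V) (x : V) :
    deriv σ (t * ι S V x) = t • (σ x).mapRange (scalar S V) (map_zero _) :=
  Finsupp.ext fun _ => pderiv_mul_ι _ t x

/-- Constants must be excluded: for u in S the right side is 0, while the left side need not be. -/
theorem deriv_mul (t : TensorRing S V) {u : TensorRing S V} (hu : proj S V 0 u = 0) :
    deriv σ (t * u) = t • deriv σ u := by
  have h := mem_closure_of_proj_zero hu
  clear hu
  induction h using AddSubgroup.closure_induction with
  | mem z hz =>
    obtain ⟨t', y, rfl⟩ := hz
    rw [← mul_assoc, deriv_mul_ι, deriv_mul_ι, mul_smul]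
  | zero => simp
  | add x y _ _ hx hy => rw [mul_add, map_add, map_add, hx, hy, smul_add]
  | neg x _ hx => rw [mul_neg, map_neg, map_neg, hx, smul_neg]

theorem deriv_mem_homog {m : ℕ} {u : TensorRing S V} (hu : u ∈ homog S V (m + 1)) (v : V) :
    deriv σ u v ∈ homog S V m := by
  have h := mem_closure_of_mem_homog_succ hu
  clear hu
  induction h using AddSubgroup.closure_induction with
  | mem z hz =>
    obtain ⟨t, ht, y, rfl⟩ := hz
    rw [deriv_mul_ι, Finsupp.smul_apply, Finsupp.mapRange_apply]
    exact homog_mul (j := 0) ht (scalar_mem_homog _)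
  | zero => simp
  | add x y _ _ hx hy => rw [map_add, Finsupp.add_apply]; exact add_mem hx hy
  | neg x _ hx => rw [map_neg, Finsupp.neg_apply]; exact neg_mem hx

variable {σ} (hσ : ∀ x, Finsupp.linearCombination S id (σ x) = x)

include hσ

omit [SMulCommClass S Sᵐᵒᵖ V] in
theorem linearCombination_mapRange (x : V) : Finsupp.linearCombination (TensorRing S V) (ι S V)
    ((σ x).mapRange (scalar S V) (map_zero _)) = ι S V x := by
  conv_rhs => rw [← hσ x]
  rw [Finsupp.linearCombination_apply, Finsupp.linearCombination_apply,
    Finsupp.sum_mapRange_index (h := fun v c => c • ι S V v) (fun _ => zero_smul _ _),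
    Finsupp.sum, Finsupp.sum, map_sum]
  exact Finset.sum_congr rfl fun v _ => (ι_smul _ _).symm

/-- So `deriv σ` splits the multiplication T^(V) → T_+, which identifies T_+ with T⊗V inside the
free module. -/
theorem linearCombination_deriv {u : TensorRing S V} (hu : proj S V 0 u = 0) :
    Finsupp.linearCombination (TensorRing S V) (ι S V) (deriv σ u) = u := by
  have h := mem_closure_of_proj_zero hu
  clear hu
  induction h using AddSubgroup.closure_induction with
  | mem z hz =>
    obtain ⟨t, y, rfl⟩ := hz
    rw [deriv_mul_ι, map_smul, linearCombination_mapRange hσ, smul_eq_mul]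
  | zero => simp
  | add x y _ _ hx hy => rw [map_add, map_add, hx, hy]
  | neg x _ hx => rw [map_neg, map_neg, hx]

end Deriv

end TensorRing
-- Ideals generated by a sub-bimodule and their quotient rings.
section Quotients

variable {S : Type u} [Ring S] {V : Type v} [AddCommGroup V] [Module S V] [Module Sᵐᵒᵖ V]

namespace QuotRing

open TensorRing

variable {X : SubBimod S (TensorRing S V)}

theorem mk_surjective (X : SubBimod S (TensorRing S V)) : Function.Surjective (mk X) :=
  RingCon.mk'_surjective _

theorem mk_eq_zero {t : TensorRing S V} :
    mk X t = 0 ↔ t ∈ TwoSidedIdeal.span (X : Set (TensorRing S V)) := by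
  rw [← map_zero (mk X)]
  exact (RingCon.eq _).trans ((TwoSidedIdeal.rel_iff _ _ _).trans (by rw [sub_zero]))

theorem mk_of_mem {t : TensorRing S V} (h : t ∈ X) : mk X t = 0 :=
  mk_eq_zero.mpr (TwoSidedIdeal.subset_span h)

/-- Ring homomorphisms from `T / ⟨X⟩`. -/
def lift {B : Type w} [Ring B] (f : TensorRing S V →+* B) (hf : ∀ x ∈ X, f x = 0) :
    QuotRing X →+* B :=
  RingCon.lift _ f (by
    have h : TwoSidedIdeal.span (X : Set (TensorRing S V)) ≤ TwoSidedIdeal.ker f :=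
      TwoSidedIdeal.span_le.mpr fun x hx => (TwoSidedIdeal.mem_ker _).mpr (hf x hx)
    intro x y hxy
    have h1 := h ((TwoSidedIdeal.rel_iff _ x y).mp hxy)
    rw [TwoSidedIdeal.mem_ker, map_sub, sub_eq_zero] at h1
    exact h1)

theorem lift_mk {B : Type w} [Ring B] (f : TensorRing S V →+* B) (hf : ∀ x ∈ X, f x = 0)
    (t : TensorRing S V) : lift f hf (mk X t) = f t := rfl

theorem mk_mem_homog {m : ℕ} {t : TensorRing S V} (h : t ∈ TensorRing.homog S V m) :
    mk X t ∈ homog X m := ⟨t, h, rfl⟩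

end QuotRing

namespace SubBimod

theorem smul_scalar_mem {X : SubBimod S (TensorRing S V)} {p : TensorRing S V} (hp : p ∈ X)
    (s : S) : TensorRing.scalar S V s * p ∈ X :=
  X.toSubmodule.smul_mem s hp

theorem mul_scalar_mem {X : SubBimod S (TensorRing S V)} {p : TensorRing S V} (hp : p ∈ X)
    (s : S) : p * TensorRing.scalar S V s ∈ X :=
  X.right_mem s hp

end SubBimod

namespace TensorRing

/-- A two-sided ideal generated by a sub-bimodule `X` is `T X + ⟨X⟩ V`. -/
theorem mem_sup_of_mem_span {X : SubBimod S (TensorRing S V)} {t : TensorRing S V}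
    (ht : t ∈ TwoSidedIdeal.span (X : Set (TensorRing S V))) :
    t ∈ AddSubgroup.closure {z | ∃ x, ∃ p ∈ X, z = x * p} ⊔
      AddSubgroup.closure {z | ∃ w ∈ TwoSidedIdeal.span (X : Set (TensorRing S V)), ∃ y : V,
        z = w * ι S V y} := by
  refine (AddSubgroup.closure_le _).mpr ?_ (mem_closure_of_mem_span ht)
  rintro _ ⟨i, j, x, y, p, hp, hx, hy, rfl⟩
  -- A right factor from S is absorbed by X; a right factor of positive degree ends in a letter of
  -- V, and what precedes that letter is in the ideal.
  cases j with
  | zero =>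
    obtain ⟨s, rfl⟩ := exists_scalar_of_mem_homog_zero hy
    exact AddSubgroup.mem_sup_left (AddSubgroup.subset_closure
      ⟨x, p * scalar S V s, SubBimod.mul_scalar_mem hp s, mul_assoc _ _ _⟩)
  | succ j =>
    refine AddSubgroup.mem_sup_right ?_
    rw [← mul_one (_ * y)]
    refine mul_mem_of_mem_closure (mem_closure_of_mem_homog_succ hy) ?_
    rintro _ ⟨y, hy, v, rfl⟩
    exact AddSubgroup.subset_closure ⟨x * p * y, TwoSidedIdeal.mul_mem_right _ _ _
      (TwoSidedIdeal.mul_mem_left _ _ _ (TwoSidedIdeal.subset_span hp)), v,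
      by simp only [mul_one, mul_assoc]⟩

section Pure

variable {n : ℕ} {X : SubBimod S (TensorRing S V)} (hX : ∀ x ∈ X, x ∈ homog S V n)

include hX

theorem mul_mul_mem_homog {i j : ℕ} {x p y : TensorRing S V} (hp : p ∈ X)
    (hx : x ∈ homog S V i) (hy : y ∈ homog S V j) : x * p * y ∈ homog S V (i + n + j) :=
  homog_mul (homog_mul hx (hX p hp)) hy

theorem proj_eq_zero_of_mem_span {t : TensorRing S V}
    (ht : t ∈ TwoSidedIdeal.span (X : Set (TensorRing S V))) {k : ℕ} (hk : k < n) :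
    proj S V k t = 0 := by
  have h := mem_closure_of_mem_span ht
  clear ht
  induction h using AddSubgroup.closure_induction with
  | mem z hz =>
    obtain ⟨i, j, x, y, p, hp, hx, hy, rfl⟩ := hz
    exact proj_ne (mul_mul_mem_homog hX hp hx hy) (by omega)
  | zero => rw [proj_zero]
  | add x y _ _ hx hy => rw [proj_add, hx, hy, add_zero]
  | neg x _ hx => rw [proj_neg, hx, neg_zero]

/-- In x p y of total degree n both outer factors are scalars, and X is a bimodule. -/
theorem proj_mem_of_mem_span {t : TensorRing S V}
    (ht : t ∈ TwoSidedIdeal.span (X : Set (TensorRing S V))) : proj S V n t ∈ X := by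
  have h := mem_closure_of_mem_span ht
  clear ht
  induction h using AddSubgroup.closure_induction with
  | mem z hz =>
    obtain ⟨i, j, x, y, p, hp, hx, hy, rfl⟩ := hz
    rw [proj_of_mem_homog (mul_mul_mem_homog hX hp hx hy)]
    split_ifs with h
    · obtain rfl : i = 0 := by omega
      obtain rfl : j = 0 := by omega
      obtain ⟨s, rfl⟩ := exists_scalar_of_mem_homog_zero hx
      obtain ⟨s', rfl⟩ := exists_scalar_of_mem_homog_zero hy
      exact SubBimod.mul_scalar_mem (SubBimod.smul_scalar_mem hp s) s'
    · exact zero_mem _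
  | zero => rw [proj_zero]; exact zero_mem _
  | add x y _ _ hx hy => rw [proj_add]; exact add_mem hx hy
  | neg x _ hx => rw [proj_neg]; exact neg_mem hx

end Pure

variable (S V) in
/-- The projection from the tensor ring onto its components of degree `≤ 1`. -/
noncomputable def linearPart [SMulCommClass S Sᵐᵒᵖ V] : TensorRing S V →+* TrivSqZeroExt S V :=
  lift (TrivSqZeroExt.inlHom S V) (TrivSqZeroExt.inrHom S V).toAddMonoidHom
    (fun s x => by simp [TrivSqZeroExt.inl_mul_inr])
    (fun s x => by simp [TrivSqZeroExt.inr_mul_inl])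

theorem ι_injective [SMulCommClass S Sᵐᵒᵖ V] : Function.Injective (ι S V) := by
  intro x y h
  have h1 := congrArg (fun t => (linearPart S V t).snd) h
  simpa [linearPart, lift_ι] using h1

end TensorRing

namespace QuotRing

open TensorRing

/-- If `X` is concentrated in degree `n ≥ 2`, then `V` is projective whenever the component of
degree `1` of `T / ⟨X⟩` is. -/
theorem projective_of_homog_one [SMulCommClass S Sᵐᵒᵖ V] {n : ℕ} (hn : 2 ≤ n)
    {X : SubBimod S (TensorRing S V)} (hX : ∀ x ∈ X, x ∈ TensorRing.homog S V n)
    [Module.Projective S (homog X 1)] : Module.Projective S V := by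
  let f : V →ₗ[S] homog X 1 :=
    { toFun := fun x => ⟨mk X (ι S V x), mk_mem_homog (ι_mem_homog x)⟩
      map_add' := fun x y => Subtype.ext (by simp)
      map_smul' := fun s x => Subtype.ext
        ((congrArg (mk X) (ι_smul s x)).trans (map_mul (mk X) _ _)) }
  refine Module.Projective.of_equiv (LinearEquiv.ofBijective f ⟨?_, ?_⟩).symm
  · rw [← LinearMap.ker_eq_bot, LinearMap.ker_eq_bot']
    intro x hx
    have h1 : mk X (ι S V x) = 0 := congrArg Subtype.val hx
    have h2 := proj_eq_zero_of_mem_span hX (mk_eq_zero.mp h1) (k := 1) (by omega)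
    rw [proj_same (ι_mem_homog x), ← map_zero (ι S V)] at h2
    exact ι_injective h2
  · rintro ⟨_, t, ht, rfl⟩
    suffices ∃ x, ι S V x = t from this.imp fun x hx => Subtype.ext (congrArg (mk X) hx)
    have h := mem_closure_of_mem_homog_succ (m := 0) ht
    clear ht
    induction h using AddSubgroup.closure_induction with
    | mem z hz =>
      obtain ⟨t, ht, y, rfl⟩ := hz
      obtain ⟨s, rfl⟩ := exists_scalar_of_mem_homog_zero ht
      exact ⟨s • y, ι_smul s y⟩
    | zero => exact ⟨0, map_zero _⟩
    | add x y _ _ hx hy =>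
      obtain ⟨⟨x', rfl⟩, ⟨y', rfl⟩⟩ := And.intro hx hy
      exact ⟨x' + y', map_add _ _ _⟩
    | neg x _ hx =>
      obtain ⟨x', rfl⟩ := hx
      exact ⟨-x', map_neg _ _⟩

end QuotRing

end Quotients
-- Symbols in the associated graded ring and the leading term criterion.
section Quotients

variable {S : Type u} [Ring S] {V : Type v} [AddCommGroup V] [Module S V] [Module Sᵐᵒᵖ V]

theorem pureRel_mem_homog (n : ℕ) (P : SubBimod S (TensorRing S V)) :
    ∀ x ∈ pureRel n P, x ∈ TensorRing.homog S V n := by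
  rintro _ ⟨x, _, rfl⟩
  exact TensorRing.proj_mem n x

theorem proj_mem_pureRel {n : ℕ} {P : SubBimod S (TensorRing S V)} {p : TensorRing S V}
    (hp : p ∈ P) : TensorRing.proj S V n p ∈ pureRel n P := ⟨p, hp, rfl⟩

namespace QuotRing

open TensorRing

variable {P : SubBimod S (TensorRing S V)}

theorem mk_sub_proj_mem_prev {m : ℕ} {t : TensorRing S V} (ht : t ∈ filt S V m) :
    mk P t - mk P (proj S V m t) ∈ (filtration P).prev m := by
  cases m with
  | zero =>
    rw [proj_same (mem_homog_zero_of_mem_filt ht), sub_self]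
    exact zero_mem _
  | succ m => exact ⟨t - proj S V (m + 1) t, sub_proj_mem ht, map_sub (mk P) _ _⟩

theorem cls_eq_symb {m : ℕ} {t : TensorRing S V} (ht : t ∈ filt S V m) :
    DirectSum.of (filtration P).Gr m ((filtration P).cls m ⟨mk P t, t, ht, rfl⟩) =
      symb P m (proj S V m t) (proj_mem m t) := by
  refine congrArg _ (sub_eq_zero.mp ?_)
  rw [← map_sub]
  exact RingFilt.cls_eq_zero (mk_sub_proj_mem_prev ht)

theorem symb_eq_zero_iff {m : ℕ} {t : TensorRing S V} (ht : t ∈ TensorRing.homog S V m) :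
    symb P m t ht = 0 ↔ mk P t ∈ (filtration P).prev m := by
  rw [symb, ← map_zero (DirectSum.of (filtration P).Gr m),
    (DirectSum.of_injective m).eq_iff]
  exact QuotientAddGroup.eq_zero_iff _

theorem symb_add {m : ℕ} {x y : TensorRing S V} (hx : x ∈ TensorRing.homog S V m)
    (hy : y ∈ TensorRing.homog S V m) :
    symb P m (x + y) (add_mem hx hy) = symb P m x hx + symb P m y hy := by
  rw [symb, symb, symb, ← map_add, ← map_add]
  refine congrArg _ (congrArg _ (Subtype.ext (map_add (mk P) x y)))

theorem symb_mul {i j : ℕ} {x y : TensorRing S V} (hx : x ∈ TensorRing.homog S V i)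
    (hy : y ∈ TensorRing.homog S V j) :
    symb P (i + j) (x * y) (homog_mul hx hy) = symb P i x hx * symb P j y hy := by
  refine Eq.trans ?_ (DirectSum.of_mul_of _ _).symm
  refine congrArg (DirectSum.of (filtration P).Gr (i + j)) ?_
  exact congrArg ((filtration P).cls (i + j)) (Subtype.ext (map_mul (mk P) x y))

theorem symb_one : symb P 0 1 one_mem_homog = 1 :=
  congrArg (DirectSum.of (filtration P).Gr 0)
    (congrArg ((filtration P).cls 0) (Subtype.ext (map_one (mk P))))

theorem symb_congr {i j : ℕ} {x y : TensorRing S V} (hx : x ∈ TensorRing.homog S V i)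
    (hy : y ∈ TensorRing.homog S V j) (hij : i = j) (h : x = y) :
    symb P i x hx = symb P j y hy := by
  subst hij; subst h; rfl

theorem symb_zero (m : ℕ) : symb P m 0 (zero_mem _) = 0 :=
  (symb_eq_zero_iff _).mpr (by rw [map_zero]; exact zero_mem _)

variable (P) in
/-- The ring homomorphism `S → gr U(P)`. -/
def symbScalar : S →+* (filtration P).GrRing where
  toFun s := symb P 0 (scalar S V s) (scalar_mem_homog s)
  map_one' := by
    rw [symb_congr (scalar_mem_homog 1) one_mem_homog rfl (map_one (scalar S V)), symb_one]
  map_mul' s s' := by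
    rw [symb_congr (scalar_mem_homog (s * s')) (homog_mul (scalar_mem_homog s) (scalar_mem_homog s'))
      rfl (map_mul (scalar S V) s s'), symb_mul]
  map_zero' := by
    rw [symb_congr (scalar_mem_homog 0) (zero_mem _) rfl (map_zero (scalar S V)), symb_zero]
  map_add' s s' := by
    rw [symb_congr (scalar_mem_homog (s + s')) (add_mem (scalar_mem_homog s) (scalar_mem_homog s'))
      rfl (map_add (scalar S V) s s'), symb_add]

variable (P) in
/-- The map `V → gr U(P)`. -/
def symbι : V →+ (filtration P).GrRing :=
  AddMonoidHom.mk' (fun x => symb P 1 (ι S V x) (ι_mem_homog x)) fun x y => by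
    rw [symb_congr (ι_mem_homog (x + y)) (add_mem (ι_mem_homog x) (ι_mem_homog y)) rfl
      (map_add (ι S V) x y), symb_add]

variable (P) in
/-- The ring homomorphism `T → gr U(P)` sending `x ∈ T^m` to its class in `gr^m U(P)`. -/
def symbHom : TensorRing S V →+* (filtration P).GrRing :=
  TensorRing.lift (symbScalar P) (symbι P)
    (fun s x => (symb_congr (ι_mem_homog (s • x)) (homog_mul (scalar_mem_homog s) (ι_mem_homog x))
      (zero_add 1).symm (ι_smul s x)).trans (symb_mul (scalar_mem_homog s) (ι_mem_homog x)))
    (fun s x => (symb_congr (ι_mem_homog (op s • x))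
      (homog_mul (ι_mem_homog x) (scalar_mem_homog s)) rfl
      (ι_op_smul s x)).trans (symb_mul (ι_mem_homog x) (scalar_mem_homog s)))

theorem symbHom_apply {m : ℕ} {t : TensorRing S V} (ht : t ∈ TensorRing.homog S V m) :
    symbHom P t = symb P m t ht := by
  induction m generalizing t with
  | zero =>
    obtain ⟨s, rfl⟩ := exists_scalar_of_mem_homog_zero ht
    exact lift_scalar _ _ _ _ s
  | succ m ih =>
    -- The membership is carried through the induction because `symb` depends on it.
    suffices ∃ h : t ∈ TensorRing.homog S V (m + 1), symbHom P t = symb P (m + 1) t h from this.2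
    have h := mem_closure_of_mem_homog_succ ht
    clear ht
    induction h using AddSubgroup.closure_induction with
    | mem z hz =>
      obtain ⟨t, ht, y, rfl⟩ := hz
      refine ⟨homog_mul ht (ι_mem_homog y), ?_⟩
      rw [map_mul, ih ht, symb_mul ht (ι_mem_homog y)]
      exact congrArg _ (lift_ι _ _ _ _ y)
    | zero =>
      refine ⟨zero_mem _, ?_⟩
      rw [map_zero, eq_comm, symb_eq_zero_iff, map_zero]
      exact zero_mem _
    | add x y _ _ hx hy =>
      obtain ⟨⟨hx, hx'⟩, ⟨hy, hy'⟩⟩ := And.intro hx hy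
      exact ⟨add_mem hx hy, by rw [map_add, hx', hy', symb_add]⟩
    | neg x _ hx =>
      obtain ⟨hx, hx'⟩ := hx
      refine ⟨neg_mem hx, ?_⟩
      rw [map_neg, hx', neg_eq_iff_add_eq_zero, ← symb_add, symb_eq_zero_iff, add_neg_cancel,
        map_zero]
      exact zero_mem _

/-- If the symbol of t vanishes, subtracting a term of lower filtration puts t in ⟨P⟩, so t is a
leading term of the ideal. In degree 0 there is nothing to subtract, since `prev` is then `⊥`. -/
theorem mem_span_of_sub_mem {m : ℕ} {t : TensorRing S V} (ht : t ∈ TensorRing.homog S V m)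
    (h : mk P t ∈ (filtration P).prev m) :
    ∃ t' ∈ TwoSidedIdeal.span (P : Set (TensorRing S V)), t' ∈ filt S V m ∧
      proj S V m t' = t := by
  cases m with
  | zero =>
    exact ⟨t, mk_eq_zero.mp h, homog_le_filt le_rfl ht, proj_same ht⟩
  | succ m =>
    obtain ⟨y, hy, hyt⟩ := h
    have hyt : mk P y = mk P t := hyt
    refine ⟨t - y, mk_eq_zero.mp (by rw [map_sub, hyt, sub_self]),
      sub_mem (homog_le_filt le_rfl ht) (filt_mono (Nat.le_succ m) hy), ?_⟩
    rw [proj_sub, proj_same ht, proj_eq_zero hy (Nat.lt_succ_self m), sub_zero]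

end QuotRing

open TensorRing QuotRing in
/-- `U(P)` is a PBW-deformation if and only if the leading terms of `⟨P⟩` lie in `⟨R⟩`. -/
theorem isPBWDeformation_iff {n : ℕ} {P : SubBimod S (TensorRing S V)}
    (hP : ∀ x ∈ P, x ∈ filt S V n) :
    IsPBWDeformation (pureRel n P) P ↔
      ∀ (m : ℕ) (t : TensorRing S V), t ∈ TwoSidedIdeal.span (P : Set (TensorRing S V)) →
        t ∈ filt S V m →
        proj S V m t ∈ TwoSidedIdeal.span (pureRel n P : Set (TensorRing S V)) := by
  constructor
  · rintro ⟨Φ, hΦ⟩ m t ht htm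
    rw [← mk_eq_zero, ← Φ.map_eq_zero_iff, hΦ m _ (proj_mem m t), symb_eq_zero_iff]
    have h := mk_sub_proj_mem_prev (P := P) htm
    rwa [mk_eq_zero.mpr ht, zero_sub, neg_mem_iff] at h
  · intro H
    -- For p in P the class of p^n(p) is minus that of the lower part of p, so its symbol in degree
    -- n is zero.
    have h0 : ∀ x ∈ pureRel n P, symbHom P x = 0 := by
      rintro _ ⟨p, hp, rfl⟩
      refine (symbHom_apply (proj_mem n p)).trans ((symb_eq_zero_iff _).mpr ?_)
      have h := mk_sub_proj_mem_prev (P := P) (hP p hp)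
      rwa [mk_of_mem hp, zero_sub, neg_mem_iff] at h
    refine ⟨RingEquiv.ofBijective (QuotRing.lift (symbHom P) h0) ⟨?_, ?_⟩,
      fun m x hx => symbHom_apply hx⟩
    · rw [injective_iff_map_eq_zero]
      intro z hz
      obtain ⟨t, rfl⟩ := mk_surjective _ z
      obtain ⟨M, hM⟩ := exists_mem_filt t
      rw [lift_mk] at hz
      rw [mk_eq_zero, sum_proj hM]
      refine sum_mem fun k hk => ?_
      -- The symbols of different components lie in different summands of gr U(P), so each of them
      -- vanishes.
      have h1 : symb P k (proj S V k t) (proj_mem k t) = 0 := by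
        have h2 := congrArg (fun z => DFinsupp.evalAddMonoidHom k z) hz
        rw [sum_proj hM, map_sum, map_sum, Finset.sum_eq_single k, map_zero,
          symbHom_apply (proj_mem k t)] at h2
        · have h3 : (filtration P).cls k ⟨mk P (proj S V k t), proj S V k t,
            homog_le_filt le_rfl (proj_mem k t), rfl⟩ = 0 := by
            rw [← h2]
            exact (DirectSum.of_eq_same k _).symm
          rw [symb, h3, map_zero]
        · intro l _ hl
          rw [symbHom_apply (proj_mem l t)]
          exact DirectSum.of_eq_of_ne _ _ _ (Ne.symm hl)
        · exact fun h => absurd hk h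
      obtain ⟨t', ht', htm, hpr⟩ := mem_span_of_sub_mem (proj_mem k t)
        ((symb_eq_zero_iff _).mp h1)
      rw [← hpr]
      exact H k t' ht' htm
    · intro z
      induction z using DirectSum.induction_on with
      | zero => exact ⟨0, map_zero _⟩
      | of m c =>
        obtain ⟨⟨_, t, ht, rfl⟩, rfl⟩ := RingFilt.cls_surjective m c
        exact ⟨mk _ (proj S V m t), (symbHom_apply (proj_mem m t)).trans (cls_eq_symb ht).symm⟩
      | add x y hx hy =>
        obtain ⟨⟨a, rfl⟩, ⟨b, rfl⟩⟩ := And.intro hx hy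
        exact ⟨a + b, map_add _ _ _⟩

end Quotients
-- Overlaps and the Jacobi conditions.
namespace BalTensor

variable {S : Type u} [Ring S] {M : Type v} [AddCommGroup M] [Module Sᵐᵒᵖ M]
  {N : Type w} [AddCommGroup N] [Module S N]

theorem induction_tmul {p : BalTensor S M N → Prop} (z : BalTensor S M N) (h0 : p 0)
    (h1 : ∀ m n, p (tmul S m n)) (ha : ∀ x y, p x → p y → p (x + y)) : p z := by
  obtain ⟨z, rfl⟩ := QuotientAddGroup.mk'_surjective _ z
  induction z using TensorProduct.induction_on with
  | zero => exact h0
  | tmul m n => exact h1 m n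
  | add x y hx hy => exact ha _ _ hx hy

theorem lTensor_tmul {N' : Type a} [AddCommGroup N'] [Module S N'] (g : N →ₗ[S] N') (m : M)
    (n : N) : lTensor M g (tmul S m n) = tmul S m (g n) := rfl

end BalTensor

section Overlap

open TensorRing

variable {S : Type u} [Ring S] {V : Type v} [AddCommGroup V] [Module S V] [Module Sᵐᵒᵖ V]
  {R : SubBimod S (TensorRing S V)}

theorem leftTensor_tmul (f : BimodHom S R (TensorRing S V)) (x : V) (r : R) :
    leftTensor f (BalTensor.tmul S x r) = ι S V x * f r := rfl

theorem rightTensor_tmul (f : BimodHom S R (TensorRing S V)) (r : R) (x : V) :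
    rightTensor f (BalTensor.tmul S r x) = f r * ι S V x := rfl

theorem leftTensor_mem {f : BimodHom S R (TensorRing S V)} {K : AddSubgroup (TensorRing S V)}
    (h : ∀ x r, ι S V x * f r ∈ K) (z : BalTensor S V R) : leftTensor f z ∈ K := by
  refine BalTensor.induction_tmul (p := fun z => leftTensor f z ∈ K) z ?_ h ?_
  · rw [map_zero]; exact zero_mem _
  · intro x y hx hy; rw [map_add]; exact add_mem hx hy

theorem rightTensor_mem {f : BimodHom S R (TensorRing S V)} {K : AddSubgroup (TensorRing S V)}
    (h : ∀ r x, f r * ι S V x ∈ K) (z : BalTensor S R V) : rightTensor f z ∈ K := by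
  refine BalTensor.induction_tmul (p := fun z => rightTensor f z ∈ K) z ?_ h ?_
  · rw [map_zero]; exact zero_mem _
  · intro x y hx hy; rw [map_add]; exact add_mem hx hy

theorem proj_succ_leftTensor (f : BimodHom S R (TensorRing S V)) (k : ℕ) (z : BalTensor S V R) :
    proj S V (k + 1) (leftTensor f z) = leftTensor ((proj S V k).comp f) z := by
  refine BalTensor.induction_tmul
    (p := fun z => proj S V (k + 1) (leftTensor f z) = leftTensor ((proj S V k).comp f) z) z ?_ ?_ ?_
  · rw [map_zero (leftTensor f), proj_zero, map_zero]
  · intro x r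
    rw [leftTensor_tmul, leftTensor_tmul, add_comm, proj_mul_left (ι_mem_homog x)]
    rfl
  · intro x y hx hy
    rw [map_add (leftTensor f), proj_add, hx, hy, map_add]

theorem proj_succ_rightTensor (f : BimodHom S R (TensorRing S V)) (k : ℕ) (z : BalTensor S R V) :
    proj S V (k + 1) (rightTensor f z) = rightTensor ((proj S V k).comp f) z := by
  refine BalTensor.induction_tmul
    (p := fun z => proj S V (k + 1) (rightTensor f z) = rightTensor ((proj S V k).comp f) z)
    z ?_ ?_ ?_
  · rw [map_zero (rightTensor f), proj_zero, map_zero]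
  · intro x r
    rw [rightTensor_tmul, rightTensor_tmul, proj_mul_right (ι_mem_homog r)]
    rfl
  · intro x y hx hy
    rw [map_add (rightTensor f), proj_add, hx, hy, map_add]

theorem overlapDiff_apply (f : BimodHom S R (TensorRing S V)) (x : overlap R) :
    overlapDiff f x = leftTensor f x.1.1 - rightTensor f x.1.2 := rfl

theorem proj_succ_overlapDiff (f : BimodHom S R (TensorRing S V)) (k : ℕ) (x : overlap R) :
    proj S V (k + 1) (overlapDiff f x) = overlapDiff ((proj S V k).comp f) x := by
  rw [overlapDiff_apply, proj_sub, proj_succ_leftTensor, proj_succ_rightTensor, overlapDiff_apply]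

theorem overlapDiff_incl (x : overlap R) : overlapDiff R.incl x = 0 :=
  sub_eq_zero.mpr x.2

theorem proj_zero_overlapDiff (f : BimodHom S R (TensorRing S V)) (x : overlap R) :
    proj S V 0 (overlapDiff f x) = 0 := by
  let K : AddSubgroup (TensorRing S V) := (proj S V 0).toLinearMap.toAddMonoidHom.ker
  exact sub_mem (leftTensor_mem (K := K) (fun x r => proj_zero_ι_mul _ _) _)
    (rightTensor_mem (K := K) (fun r x => proj_zero_mul_ι _ _) _)

theorem overlapDiff_mem_filt {f : BimodHom S R (TensorRing S V)} {n : ℕ}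
    (hf : ∀ r, f r ∈ filt S V n) (x : overlap R) : overlapDiff f x ∈ filt S V (n + 1) := by
  refine sub_mem (leftTensor_mem (K := (filt S V (n + 1)).toAddSubgroup) (fun x r => ?_) _)
    (rightTensor_mem (K := (filt S V (n + 1)).toAddSubgroup) (fun r x => ?_) _)
  · rw [add_comm]
    exact filt_mul (homog_le_filt le_rfl (ι_mem_homog x)) (hf r)
  · exact filt_mul (hf r) (homog_le_filt le_rfl (ι_mem_homog x))

theorem FilteredMap.component_of_le (α : FilteredMap R) {n i : ℕ} (h : i ≤ n) :
    α.component n i = (proj S V (n - i)).comp α.toBimodHom := if_pos h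

theorem FilteredMap.component_apply (α : FilteredMap R) {n i : ℕ} (h : i ≤ n) (r : R) :
    α.component n i r = proj S V (n - i) (α.toBimodHom r) := by
  rw [α.component_of_le h]
  rfl

theorem FilteredMap.overlapDiff_component (α : FilteredMap R) {n i : ℕ} (h : i ≤ n)
    (x : overlap R) : overlapDiff (α.component n i) x =
      proj S V (n - i + 1) (overlapDiff α.toBimodHom x) := by
  rw [α.component_of_le h, proj_succ_overlapDiff]

variable {n : ℕ} (hR : ∀ x ∈ R, x ∈ homog S V n)

include hR in
theorem FilteredMap.apply_mem_filt (α : FilteredMap R) (r : R) : α.toBimodHom r ∈ filt S V n :=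
  α.filtered n r (hR r r.2)

include hR in
theorem FilteredMap.proj_apply (α : FilteredMap R) (r : R) : proj S V n (α.toBimodHom r) = r :=
  α.leading n r (hR r r.2)

include hR in
/-- The leading term of `(V ⊗ α - α ⊗ V)(x)` vanishes. -/
theorem FilteredMap.overlapDiff_mem_filt (α : FilteredMap R) (x : overlap R) :
    overlapDiff α.toBimodHom x ∈ filt S V n := by
  refine mem_filt_of_proj_eq_zero (_root_.overlapDiff_mem_filt (α.apply_mem_filt hR) x) ?_
  rw [proj_succ_overlapDiff, ← overlapDiff_incl x]
  congr 2
  exact DFunLike.ext _ _ (α.proj_apply hR)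

include hR in
/-- The conditions `(J'_0)`, ..., `(J'_n)` say that `(V ⊗ α - α ⊗ V)(x)` lies in the image of `α`
for all `x ∈ X`. -/
theorem FilteredMap.jacobi_iff (hn : n ≠ 0) (α : FilteredMap R) :
    α.Jacobi n ↔ ∀ x : overlap R, ∃ r : R, α.toBimodHom r = overlapDiff α.toBimodHom x := by
  refine forall_congr' fun x => exists_congr fun r => ?_
  constructor
  · rintro ⟨h0, h1, h2⟩
    -- Comparison in each degree: above n both sides vanish, degree n is the condition defining r,
    -- degree n - i is the condition on α_i, and degree 0 is the last condition, since every term of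
    -- the right side has a factor in V.
    refine ext_proj fun k => ?_
    rcases lt_or_ge n k with hk | hk
    · rw [proj_eq_zero (α.apply_mem_filt hR r) hk, proj_eq_zero (α.overlapDiff_mem_filt hR x) hk]
    rcases hk.eq_or_lt with rfl | hkn
    · rw [α.proj_apply hR, h0, α.overlapDiff_component (by omega), Nat.sub_add_cancel (by omega)]
    rcases Nat.eq_zero_or_pos k with rfl | hk'
    · rw [proj_zero_overlapDiff, ← h2, α.component_apply le_rfl, Nat.sub_self]
    · have h3 := h1 (n - k) (by omega) (by omega)
      rw [α.component_apply (by omega), α.overlapDiff_component (by omega)] at h3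
      rwa [show n - (n - k) = k by omega, show n - (n - k + 1) + 1 = k by omega] at h3
  · intro h
    refine ⟨?_, ?_, ?_⟩
    · rw [α.overlapDiff_component (by omega), ← h, Nat.sub_add_cancel (by omega), α.proj_apply hR]
    · intro i hi hin
      rw [α.component_apply hin.le, h, α.overlapDiff_component (by omega)]
      congr 2
      omega
    · rw [α.component_apply le_rfl, h, Nat.sub_self, proj_zero_overlapDiff]

/-! ### Necessity: the filtered map of a PBW-deformation. -/

section Forward

variable {P : SubBimod S (TensorRing S V)}

-- Leading terms of ⟨P⟩ lie in ⟨R⟩, which is zero below degree n; so an element of degree below n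
-- loses its top component again and again.
include hR in
theorem eq_zero_of_leading (H : ∀ (m : ℕ) (t : TensorRing S V),
      t ∈ TwoSidedIdeal.span (P : Set (TensorRing S V)) → t ∈ filt S V m →
        proj S V m t ∈ TwoSidedIdeal.span (R : Set (TensorRing S V)))
    {m : ℕ} (hm : m < n) {t : TensorRing S V}
    (ht : t ∈ TwoSidedIdeal.span (P : Set (TensorRing S V))) (htm : t ∈ filt S V m) : t = 0 := by
  have h1 : ∀ m, m < n → t ∈ filt S V m → proj S V m t = 0 := fun m hm htm => by
    rw [← proj_same (proj_mem m t)]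
    exact proj_eq_zero_of_mem_span hR (H m t ht htm) hm
  induction m with
  | zero => rw [← h1 0 hm htm, proj_same (mem_homog_zero_of_mem_filt htm)]
  | succ m ih => exact ih (by omega) (mem_filt_of_proj_eq_zero htm (h1 _ hm htm))

/-- Two elements of ⟨P⟩ ∩ T^{≤n} with the same degree n part coincide, as their difference has
degree below n. This single uniqueness statement makes the inverse of p^n : P → R a bimodule map and
also yields the Jacobi conditions. -/
theorem exists_filteredMap (hn : n ≠ 0) (hP : ∀ x ∈ P, x ∈ filt S V n)
    (H : ∀ (m : ℕ) (t : TensorRing S V),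
      t ∈ TwoSidedIdeal.span (P : Set (TensorRing S V)) → t ∈ filt S V m →
        proj S V m t ∈ TwoSidedIdeal.span (pureRel n P : Set (TensorRing S V))) :
    ∃ α : FilteredMap (pureRel n P), P = SubBimod.range α.toBimodHom ∧ α.Jacobi n := by
  obtain ⟨n, rfl⟩ := Nat.exists_eq_succ_of_ne_zero hn
  have hR := pureRel_mem_homog (n + 1) P
  have huniq : ∀ t t', t ∈ TwoSidedIdeal.span (P : Set (TensorRing S V)) →
      t' ∈ TwoSidedIdeal.span (P : Set (TensorRing S V)) → t ∈ filt S V (n + 1) →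
      t' ∈ filt S V (n + 1) → proj S V (n + 1) t = proj S V (n + 1) t' → t = t' := by
    intro t t' h1 h2 h3 h4 h5
    refine sub_eq_zero.mp (eq_zero_of_leading hR H (Nat.lt_succ_self n) (sub_mem h1 h2)
      (mem_filt_of_proj_eq_zero (sub_mem h3 h4) ?_))
    rw [proj_sub, h5, sub_self]
  have hP' : ∀ x ∈ P, x ∈ TwoSidedIdeal.span (P : Set (TensorRing S V)) :=
    fun x hx => TwoSidedIdeal.subset_span hx
  have huniqP : ∀ t t', t ∈ P → t' ∈ P → proj S V (n + 1) t = proj S V (n + 1) t' → t = t' :=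
    fun t t' h1 h2 => huniq t t' (hP' t h1) (hP' t' h2) (hP t h1) (hP t' h2)
  have hex : ∀ r : pureRel (n + 1) P, ∃ p ∈ P, proj S V (n + 1) p = r := fun r => r.2
  choose f hf hpf using hex
  let α : FilteredMap (pureRel (n + 1) P) :=
    { toFun := f
      map_add' := fun r r' => huniqP _ _ (hf _) (add_mem (hf _) (hf _)) (by
        rw [proj_add, hpf, hpf, hpf]; rfl)
      map_smul' := fun s r => huniqP _ _ (hf _) (SubBimod.smul_scalar_mem (hf r) s) (by
        rw [hpf]
        exact (((proj S V (n + 1)).toLinearMap.map_smul s (f r)).trans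
          (congrArg (s • ·) (hpf r))).symm)
      map_right := fun s r => huniqP _ _ (hf _) (SubBimod.mul_scalar_mem (hf r) s) (by
        rw [hpf]
        exact (((proj S V (n + 1)).map_right s (f r)).trans
          (congrArg (op s • ·) (hpf r))).symm)
      -- The relations now have degree n + 1; a relation that is also homogeneous of another degree
      -- is zero.
      filtered := fun m r hr => by
        by_cases h : m = n + 1
        · exact h ▸ hP _ (hf r)
        · have h1 : f r = 0 := huniqP _ _ (hf r) (zero_mem _) (by
            rw [hpf, proj_zero, ← proj_same (hR r r.2), proj_ne hr h])
          exact h1.symm ▸ zero_mem _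
      leading := fun m r hr => by
        by_cases h : m = n + 1
        · exact h ▸ hpf r
        · have h2 : (r : TensorRing S V) = 0 := by rw [← proj_same (hR r r.2), proj_ne hr h]
          have h1 : f r = 0 := huniqP _ _ (hf r) (zero_mem _) (by rw [hpf, proj_zero, h2])
          exact (congrArg (proj S V m) h1).trans ((proj_zero m).trans h2.symm) }
  have hα : ∀ r, α.toBimodHom r ∈ TwoSidedIdeal.span (P : Set (TensorRing S V)) :=
    fun r => hP' _ (hf r)
  refine ⟨α, SetLike.ext fun x => ⟨fun hx => ?_, ?_⟩, (α.jacobi_iff hR hn).mpr fun x => ?_⟩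
  · exact ⟨⟨_, proj_mem_pureRel hx⟩, huniqP _ _ (hf _) hx (hpf _)⟩
  · rintro ⟨r, rfl⟩
    exact hf r
  · let I : AddSubgroup (TensorRing S V) :=
      (TwoSidedIdeal.span (P : Set (TensorRing S V))).asIdeal.toAddSubgroup
    have hy : overlapDiff α.toBimodHom x ∈ TwoSidedIdeal.span (P : Set (TensorRing S V)) :=
      sub_mem (leftTensor_mem (K := I) (fun x r => TwoSidedIdeal.mul_mem_left _ _ _ (hα r)) _)
        (rightTensor_mem (K := I) (fun r x => TwoSidedIdeal.mul_mem_right _ _ _ (hα r)) _)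
    have hyn := α.overlapDiff_mem_filt hR x
    -- The degree n part is in ⟨R⟩, hence in R, and α of it has the same degree n part as the
    -- overlap difference.
    have hyR := proj_mem_of_mem_span hR (H _ _ hy hyn)
    rw [proj_same (proj_mem _ _)] at hyR
    exact ⟨⟨_, hyR⟩, huniq _ _ (hα _) hy (α.apply_mem_filt hR _) hyn (α.proj_apply hR _)⟩

end Forward

end Overlap
-- Gradings of abelian groups.
/-- Projections exhibiting a family of subgroups `𝒜` as a grading of the abelian group `A`. -/
structure GroupGrading {A : Type a} [AddCommGroup A] (𝒜 : ℕ → AddSubgroup A) where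
  π : ℕ → A →+ A
  π_mem : ∀ k x, π k x ∈ 𝒜 k
  π_same : ∀ {k x}, x ∈ 𝒜 k → π k x = x
  π_ne : ∀ {k l x}, x ∈ 𝒜 k → k ≠ l → π l x = 0
  sum : ∀ x, ∃ m, ∀ M ≥ m, ∑ k ∈ Finset.range M, π k x = x

namespace GroupGrading

variable {A : Type a} [AddCommGroup A] {𝒜 : ℕ → AddSubgroup A} (G : GroupGrading 𝒜)
  {B : Type b} [AddCommGroup B] {ℬ : ℕ → AddSubgroup B} (H : GroupGrading ℬ)

theorem π_of_mem {k : ℕ} {x : A} (hx : x ∈ 𝒜 k) (l : ℕ) : G.π l x = if k = l then x else 0 := by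
  split_ifs with h
  · exact h ▸ G.π_same hx
  · exact G.π_ne hx h

theorem exists_sum (x : A) : ∃ M, ∑ k ∈ Finset.range M, G.π k x = x :=
  let ⟨M, hM⟩ := G.sum x
  ⟨M, hM M le_rfl⟩

theorem map_π (f : A →+ B) (hf : ∀ k x, x ∈ 𝒜 k → f x ∈ ℬ k) (k : ℕ) (x : A) :
    f (G.π k x) = H.π k (f x) := by
  obtain ⟨m, hm⟩ := G.sum x
  conv_rhs => rw [← hm (max m (k + 1)) (le_max_left _ _)]
  rw [map_sum, map_sum, Finset.sum_eq_single k]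
  · exact (H.π_same (hf k _ (G.π_mem k x))).symm
  · intro l _ hl
    exact H.π_ne (hf l _ (G.π_mem l x)) hl
  · intro h
    exact absurd (Finset.mem_range.mpr (by omega)) h

include G H in
/-- A graded surjection is surjective on homogeneous components. -/
theorem exists_lift (f : A →+ B) (hf : ∀ k x, x ∈ 𝒜 k → f x ∈ ℬ k) (hs : Function.Surjective f)
    {k : ℕ} {y : B} (hy : y ∈ ℬ k) : ∃ x ∈ 𝒜 k, f x = y := by
  obtain ⟨x, rfl⟩ := hs y
  exact ⟨G.π k x, G.π_mem k x, by rw [G.map_π H f hf, H.π_same hy]⟩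

include H in
/-- The kernel of a graded homomorphism is graded. -/
def ker (f : A →+ B) (hf : ∀ k x, x ∈ 𝒜 k → f x ∈ ℬ k) :
    GroupGrading fun k => (𝒜 k).comap f.ker.subtype where
  π k := ((G.π k).comp f.ker.subtype).codRestrict f.ker fun x => by
    change f (G.π k x) = 0
    rw [G.map_π H f hf, show f x = 0 from x.2, map_zero]
  π_mem k x := G.π_mem k x
  π_same hx := Subtype.ext (G.π_same hx)
  π_ne hx h := Subtype.ext (G.π_ne hx h)
  sum x := by
    obtain ⟨m, hm⟩ := G.sum x
    refine ⟨m, fun M hM => Subtype.ext ?_⟩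
    rw [AddSubgroup.val_finsetSum]
    exact hm M hM

section Finsupp

variable {W : Type w} (d : W → ℕ)

/-- The homogeneous components of the finitely supported functions `W → A`, where the basis element
at `i` has degree `d i`. -/
def finsuppDeg (𝒜 : ℕ → AddSubgroup A) (d : W → ℕ) (k : ℕ) : AddSubgroup (W →₀ A) where
  carrier := {f | ∀ i, f i ∈ (if d i ≤ k then 𝒜 (k - d i) else ⊥ : AddSubgroup A)}
  zero_mem' := fun _ => zero_mem _
  add_mem' := fun hf hg i => add_mem (hf i) (hg i)
  neg_mem' := fun hf i => neg_mem (hf i)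

/-- The projections of the grading by `finsuppDeg`. -/
noncomputable def finsuppπ (k : ℕ) : (W →₀ A) →+ (W →₀ A) :=
  Finsupp.liftAddHom fun i =>
    (Finsupp.singleAddHom i).comp (if d i ≤ k then G.π (k - d i) else 0)

theorem finsuppπ_apply (k : ℕ) (f : W →₀ A) (i : W) :
    G.finsuppπ d k f i = (if d i ≤ k then G.π (k - d i) else 0) (f i) := by
  induction f using Finsupp.induction_linear with
  | zero => simp
  | add f g hf hg => rw [map_add, Finsupp.add_apply, hf, hg, Finsupp.add_apply, map_add]
  | single j x =>
    rw [finsuppπ, Finsupp.liftAddHom_apply_single, AddMonoidHom.comp_apply,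
      Finsupp.singleAddHom_apply]
    by_cases h : j = i
    · subst h
      rw [Finsupp.single_eq_same, Finsupp.single_eq_same]
    · rw [Finsupp.single_eq_of_ne (Ne.symm h), Finsupp.single_eq_of_ne (Ne.symm h), map_zero]

/-- The grading of the finitely supported functions `W → A`. -/
noncomputable def finsupp : GroupGrading (finsuppDeg 𝒜 d) where
  π := G.finsuppπ d
  π_mem k f i := by
    rw [finsuppπ_apply]
    split_ifs
    · exact G.π_mem _ _
    · exact zero_mem _
  π_same {k f} hf := Finsupp.ext fun i => by
    have h := hf i
    rw [finsuppπ_apply]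
    split_ifs at h ⊢
    · exact G.π_same h
    · exact h.symm
  π_ne {k l f} hf hkl := Finsupp.ext fun i => by
    have h := hf i
    rw [finsuppπ_apply]
    split_ifs at h ⊢
    · exact G.π_ne h (by omega)
    · rw [show f i = 0 from h, map_zero]; rfl
    · rfl
    · rfl
  sum f := by
    induction f using Finsupp.induction_linear with
    | zero => exact ⟨0, fun M _ => by simp⟩
    | add f g hf hg =>
      obtain ⟨⟨m, hm⟩, ⟨m', hm'⟩⟩ := And.intro hf hg
      refine ⟨max m m', fun M hM => ?_⟩
      simp only [map_add, Finset.sum_add_distrib]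
      rw [hm M (le_trans (le_max_left _ _) hM), hm' M (le_trans (le_max_right _ _) hM)]
    | single j x =>
      obtain ⟨m, hm⟩ := G.sum x
      refine ⟨m + d j, fun M hM => ?_⟩
      have h1 : ∀ k, G.finsuppπ d k (Finsupp.single j x) =
          Finsupp.single j ((if d j ≤ k then G.π (k - d j) else 0) x) := fun k => by
        rw [finsuppπ, Finsupp.liftAddHom_apply_single]; rfl
      rw [Finset.sum_congr rfl fun k _ => h1 k, ← Finsupp.single_finsetSum]
      congr 1
      obtain ⟨M, rfl⟩ := Nat.exists_eq_add_of_le' (le_trans (Nat.le_add_left _ _) hM)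
      rw [add_comm M, Finset.sum_range_add, Finset.sum_eq_zero, zero_add]
      · refine Eq.trans (Finset.sum_congr rfl fun k _ => ?_) (hm M (by omega))
        rw [if_pos (by omega), Nat.add_sub_cancel_left]
      · intro k hk
        rw [if_neg (by have := Finset.mem_range.mp hk; omega)]
        rfl

end Finsupp

end GroupGrading

/-! ### Graded modules, syzygies and dimension shifting. -/

section Modules

variable {A : Type a} [Ring A] {𝒜 : ℕ → AddSubgroup A}
  {N : Type b} [AddCommGroup N] [Module A N] {𝒩 : ℕ → AddSubgroup N}

/-- The components `𝒩` are compatible with the multiplication by homogeneous elements of `A`. -/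
def GradedSMulMem (𝒜 : ℕ → AddSubgroup A) (𝒩 : ℕ → AddSubgroup N) : Prop :=
  ∀ ⦃i j : ℕ⦄ ⦃x : A⦄ ⦃y : N⦄, x ∈ 𝒜 i → y ∈ 𝒩 j → x • y ∈ 𝒩 (i + j)

open GroupGrading

theorem linearCombination_mem {W : Type w} {d : W → ℕ} (hN : GradedSMulMem 𝒜 𝒩) {l : W → N}
    (hl : ∀ i, l i ∈ 𝒩 (d i)) {k : ℕ} {f : W →₀ A} (hf : f ∈ finsuppDeg 𝒜 d k) :
    Finsupp.linearCombination A l f ∈ 𝒩 k := by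
  rw [Finsupp.linearCombination_apply]
  refine sum_mem fun i _ => ?_
  have h := hf i
  split_ifs at h with h1
  · have h2 := hN h (hl i)
    rwa [Nat.sub_add_cancel h1] at h2
  · dsimp only
    rw [show f i = 0 from h, zero_smul]
    exact zero_mem _

theorem finsuppDeg_smulMem (hA : GradedSMulMem 𝒜 𝒜) {W : Type w} (d : W → ℕ) :
    GradedSMulMem 𝒜 (finsuppDeg 𝒜 d) := by
  intro i j x f hx hf q
  have h := hf q
  rw [Finsupp.smul_apply, smul_eq_mul]
  split_ifs at h with h1
  · rw [if_pos (by omega), Nat.add_sub_assoc h1]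
    exact hA hx h
  · rw [show f q = 0 from h, mul_zero]
    exact zero_mem _

theorem comap_smulMem (hN : GradedSMulMem 𝒜 𝒩) (K : Submodule A N) :
    GradedSMulMem 𝒜 fun k => (𝒩 k).comap K.subtype.toAddMonoidHom := fun _ _ _ _ hx hy => hN hx hy

/-- The grading of the kernel of a graded linear map. -/
def kerGrading {P : Type c} [AddCommGroup P] [Module A P] {𝒦 : ℕ → AddSubgroup P}
    (GP : GroupGrading 𝒦) (GN : GroupGrading 𝒩) (p : P →ₗ[A] N)
    (hp : ∀ k x, x ∈ 𝒦 k → p x ∈ 𝒩 k) :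
    GroupGrading fun k => (𝒦 k).comap (LinearMap.ker p).subtype.toAddMonoidHom :=
  GP.ker GN p.toAddMonoidHom hp

/-- Dimension shifting: a graded map `g : N' → N` with a section up to maps factoring through a
projective module induces such a map on syzygies. -/
theorem exists_syzygy_comparison {N' : Type b} [AddCommGroup N'] [Module A N']
    {𝒩' : ℕ → AddSubgroup N'} {P : Type c} [AddCommGroup P] [Module A P] {𝒦 : ℕ → AddSubgroup P}
    {M : Type u} [AddCommGroup M] [Module A M]
    [Module.Projective A M] [Module.Projective A P] (hP : GradedSMulMem 𝒜 𝒦)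
    (GP : GroupGrading 𝒦) (GN : GroupGrading 𝒩)
    (p : P →ₗ[A] N) (hp : ∀ k x, x ∈ 𝒦 k → p x ∈ 𝒩 k) (hps : Function.Surjective p)
    {W : Type w} {d : W → ℕ} {l' : W → N'} (hl' : ∀ i, l' i ∈ 𝒩' (d i))
    (hqs : Function.Surjective (Finsupp.linearCombination A l'))
    (f : N →ₗ[A] N') (g : N' →ₗ[A] N) (hg : ∀ k x, x ∈ 𝒩' k → g x ∈ 𝒩 k)
    (j : N →ₗ[A] M) (h : M →ₗ[A] N) (hgf : ∀ x, g (f x) = x + h (j x)) :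
    ∃ (f' : LinearMap.ker p →ₗ[A] LinearMap.ker (Finsupp.linearCombination A l'))
      (g' : LinearMap.ker (Finsupp.linearCombination A l') →ₗ[A] LinearMap.ker p)
      (h' : P →ₗ[A] LinearMap.ker p),
      (∃ F : P →ₗ[A] (W →₀ A), ∀ x, (f' x).1 = F x.1) ∧
      (∀ k x, x.1 ∈ finsuppDeg 𝒜 d k → (g' x).1 ∈ 𝒦 k) ∧ ∀ x, g' (f' x) = x + h' x.1 := by
  -- F lifts f ∘ p to the free module, and h₁ lifts h through p. The map back, G, sends each basis
  -- element to a homogeneous preimage, so that it preserves degrees.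
  obtain ⟨F, hF⟩ := Module.projective_lifting_property _ (f.comp p) hqs
  obtain ⟨h₁, hh₁⟩ := Module.projective_lifting_property p h hps
  have hl : ∀ i, ∃ y ∈ 𝒦 (d i), p y = g (l' i) := fun i =>
    GP.exists_lift GN p.toAddMonoidHom hp hps (hg _ _ (hl' i))
  choose l hld hl using hl
  have hG : ∀ x, p (Finsupp.linearCombination A l x) = g (Finsupp.linearCombination A l' x) := by
    intro x
    have : p.comp (Finsupp.linearCombination A l) = g.comp (Finsupp.linearCombination A l') := by
      refine Finsupp.lhom_ext' fun i => LinearMap.ext_ring ?_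
      simp [hl]
    exact DFunLike.congr_fun this x
  have hF' : ∀ x, Finsupp.linearCombination A l' (F x) = f (p x) := DFunLike.congr_fun hF
  have hh₁' : ∀ x, p (h₁ x) = h x := DFunLike.congr_fun hh₁
  -- The new error is h' = G F - 1 - h₁ j p. It takes values in ker p because p G F = g f p = p + h
  -- j p, and on ker p its last term vanishes, leaving G F = 1 + h'. Thus the error again factors
  -- through a projective module, namely P.
  refine ⟨F.restrict fun x hx => ?_, (Finsupp.linearCombination A l).restrict fun x hx => ?_,
    (Finsupp.linearCombination A l ∘ₗ F - LinearMap.id - h₁ ∘ₗ j ∘ₗ p).codRestrict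
      (LinearMap.ker p) fun x => ?_,
    ⟨F, fun _ => rfl⟩, fun k x hx => linearCombination_mem hP hld hx, fun x => Subtype.ext ?_⟩
  · rw [LinearMap.mem_ker] at hx ⊢
    rw [hF', hx, map_zero]
  · rw [LinearMap.mem_ker] at hx ⊢
    rw [hG, hx, map_zero]
  · have hx : p x.1 = 0 := x.2
    change Finsupp.linearCombination A l (F x.1) =
      x.1 + (Finsupp.linearCombination A l (F x.1) - x.1 - h₁ (j (p x.1)))
    rw [hx, map_zero, map_zero]
    abel
  · rw [LinearMap.mem_ker]
    simp [hG, hF', hgf, hh₁']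

theorem linearCombination_surjective_of_grading (GN : GroupGrading 𝒩) :
    Function.Surjective (Finsupp.linearCombination A fun i : Σ m, 𝒩 m => (i.2 : N)) := by
  intro x
  obtain ⟨M, hM⟩ := GN.exists_sum x
  refine ⟨∑ k ∈ Finset.range M, Finsupp.single ⟨k, GN.π k x, GN.π_mem k x⟩ 1, ?_⟩
  rw [map_sum]
  refine Eq.trans (Finset.sum_congr rfl fun k _ => ?_) hM
  rw [Finsupp.linearCombination_single, one_smul]

end Modules

namespace GrMod

open GroupGrading

variable {A : Type a} [Ring A] {𝒜 : ℕ → AddSubgroup A} (GA : GroupGrading 𝒜)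

theorem cover_surjective {N : GrMod A} (GN : GroupGrading N.deg) :
    Function.Surjective (cover 𝒜 N) :=
  linearCombination_surjective_of_grading GN

theorem cover_mem {N : GrMod A} (hN : GradedSMulMem 𝒜 N.deg) (k : ℕ) (x : free 𝒜 N)
    (hx : x ∈ (free 𝒜 N).deg k) : cover 𝒜 N x ∈ N.deg k :=
  linearCombination_mem (W := Σ m, N.deg m) (d := Sigma.fst) hN (fun i => i.2.2) hx

/-- The gradings of the syzygies of a graded module. -/
noncomputable def syzygiesGrading (hA : GradedSMulMem 𝒜 𝒜) {N : GrMod A}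
    (GN : GroupGrading N.deg) (hN : GradedSMulMem 𝒜 N.deg) :
    ∀ i, { _G : GroupGrading (syzygies 𝒜 N i).deg // GradedSMulMem 𝒜 (syzygies 𝒜 N i).deg }
  | 0 => ⟨GN, hN⟩
  | i + 1 =>
    let G := syzygiesGrading hA GN hN i
    ⟨kerGrading (𝒦 := (free 𝒜 (syzygies 𝒜 N i)).deg) (GA.finsupp Sigma.fst) G.1
      (cover 𝒜 (syzygies 𝒜 N i)) (cover_mem G.2),
      comap_smulMem (finsuppDeg_smulMem hA Sigma.fst) (LinearMap.ker (cover 𝒜 (syzygies 𝒜 N i)))⟩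

end GrMod
-- Modules induced from projective S-modules.
section Induced

open GroupGrading

variable {S : Type u} [Ring S] {A : Type a} [Ring A] (φ : S →+* A)
  {W : Type w} [AddCommGroup W] [Module S W] (σ : W →ₗ[S] W →₀ S)

/-- The element `1 ⊗ w` of `A ⊗_S W`, written in terms of a section `σ : W → S^(W)`. -/
noncomputable def indLift : W →+ (W →₀ A) where
  toFun x := (σ x).mapRange φ (map_zero φ)
  map_zero' := by ext; simp
  map_add' x y := by ext; simp

theorem indLift_apply (x i : W) : indLift φ σ x i = φ (σ x i) := rfl

theorem indLift_smul (s : S) (x : W) : indLift φ σ (s • x) = φ s • indLift φ σ x := by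
  ext; simp [indLift_apply]

/-- The idempotent of the free module `A^(W)` whose image is `A ⊗_S W`. -/
noncomputable def indProj : (W →₀ A) →ₗ[A] (W →₀ A) :=
  Finsupp.linearCombination A (indLift φ σ)

/-- The induced module `A ⊗_S W` of a projective module `W`, as a direct summand of `A^(W)`. -/
noncomputable def indMod : Submodule A (W →₀ A) := LinearMap.ker (LinearMap.id - indProj φ σ)

variable {φ σ}

theorem mem_indMod {x : W →₀ A} : x ∈ indMod φ σ ↔ indProj φ σ x = x := by
  rw [indMod, LinearMap.mem_ker, LinearMap.sub_apply, sub_eq_zero, LinearMap.id_apply, eq_comm]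

variable {𝒜 : ℕ → AddSubgroup A}

theorem indLift_mem (hφ : ∀ s, φ s ∈ 𝒜 0) (d : ℕ) (x : W) :
    indLift φ σ x ∈ finsuppDeg 𝒜 (fun _ => d) d := by
  intro i
  rw [if_pos le_rfl, Nat.sub_self]
  exact hφ _

theorem indProj_mem (hA : GradedSMulMem 𝒜 𝒜) (hφ : ∀ s, φ s ∈ 𝒜 0) (d k : ℕ) (x : W →₀ A)
    (hx : x ∈ finsuppDeg 𝒜 (fun _ => d) k) :
    indProj φ σ x ∈ finsuppDeg 𝒜 (fun _ => d) k :=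
  linearCombination_mem (finsuppDeg_smulMem hA _) (indLift_mem hφ d) hx

variable (φ σ) in
/-- The homogeneous components of `A ⊗_S W`, for `W` concentrated in degree `d`. -/
noncomputable def indDeg (𝒜 : ℕ → AddSubgroup A) (d k : ℕ) : AddSubgroup (indMod φ σ) :=
  (finsuppDeg 𝒜 (fun _ : W => d) k).comap (indMod φ σ).subtype.toAddMonoidHom

variable (σ) in
/-- The grading of `A ⊗_S W`. -/
noncomputable def indGrading (GA : GroupGrading 𝒜) (hA : GradedSMulMem 𝒜 𝒜)
    (hφ : ∀ s, φ s ∈ 𝒜 0) (d : ℕ) : GroupGrading (indDeg φ σ 𝒜 d) :=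
  kerGrading (GA.finsupp fun _ => d) (GA.finsupp fun _ => d) (LinearMap.id - indProj φ σ)
    (fun k x hx => sub_mem hx (indProj_mem hA hφ d k x hx))

theorem indDeg_smulMem (hA : GradedSMulMem 𝒜 𝒜) (d : ℕ) :
    GradedSMulMem 𝒜 (indDeg φ σ 𝒜 d) :=
  comap_smulMem (finsuppDeg_smulMem hA _) (indMod φ σ)

variable (hσ : ∀ x, Finsupp.linearCombination S id (σ x) = x)

include hσ

/-- The universal property of A⊗W evaluated on 1⊗w: a φ-semilinear map j is recovered from its
extension to the free module. -/
theorem linearCombination_indLift {M : Type b} [AddCommGroup M] [Module A M] (j : W →+ M)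
    (hj : ∀ s x, j (s • x) = φ s • j x) (x : W) :
    Finsupp.linearCombination A j (indLift φ σ x) = j x := by
  conv_rhs => rw [← hσ x]
  rw [Finsupp.linearCombination_apply, Finsupp.linearCombination_apply, indLift]
  change Finsupp.sum ((σ x).mapRange φ (map_zero φ)) _ = _
  rw [Finsupp.sum_mapRange_index (h := fun v c => c • j v) (fun _ => zero_smul _ _),
    Finsupp.sum, Finsupp.sum, map_sum]
  exact Finset.sum_congr rfl fun v _ => (hj _ _).symm

/-- Extensions of semilinear maps do not see the idempotent; this plays the role of well-definedness
on A⊗W. -/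
theorem linearCombination_indProj {M : Type b} [AddCommGroup M] [Module A M] (j : W →+ M)
    (hj : ∀ s x, j (s • x) = φ s • j x) (x : W →₀ A) :
    Finsupp.linearCombination A j (indProj φ σ x) = Finsupp.linearCombination A j x := by
  have h : (Finsupp.linearCombination A j).comp (indProj φ σ) = Finsupp.linearCombination A j := by
    refine Finsupp.lhom_ext' fun i => LinearMap.ext_ring ?_
    simp [indProj, linearCombination_indLift hσ j hj]
  exact DFunLike.congr_fun h x

theorem indProj_indLift (x : W) : indProj φ σ (indLift φ σ x) = indLift φ σ x :=
  linearCombination_indLift hσ (indLift φ σ) (indLift_smul φ σ) x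

theorem indProj_indProj (x : W →₀ A) : indProj φ σ (indProj φ σ x) = indProj φ σ x :=
  linearCombination_indProj hσ (indLift φ σ) (indLift_smul φ σ) x

theorem indLift_mem_indMod (x : W) : indLift φ σ x ∈ indMod φ σ :=
  mem_indMod.mpr (indProj_indLift hσ x)

theorem projective_indMod : Module.Projective A (indMod φ σ) :=
  Module.Projective.of_split (indMod φ σ).subtype
    ((indProj φ σ).codRestrict _ fun x => mem_indMod.mpr (indProj_indProj hσ x))
    (LinearMap.ext fun x => Subtype.ext (mem_indMod.mp x.2))

end Induced

/-! ### The gradings of A(R) and of S. -/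

namespace QuotRing

open TensorRing

variable {S : Type u} [Ring S] {V : Type v} [AddCommGroup V] [Module S V] [Module Sᵐᵒᵖ V]
  {R : SubBimod S (TensorRing S V)}

theorem gradingA_mul : GradedSMulMem (gradingA R) (gradingA R) := by
  rintro i j _ _ ⟨x, hx, rfl⟩ ⟨y, hy, rfl⟩
  exact ⟨x * y, homog_mul hx hy, map_mul (mk R) x y⟩

variable (R) in
/-- The structure map `S → A(R)`. -/
def scalar : S →+* QuotRing R := (mk R).comp (TensorRing.scalar S V)

theorem scalar_mem_gradingA (s : S) : scalar R s ∈ gradingA R 0 :=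
  ⟨_, scalar_mem_homog s, rfl⟩

variable {n : ℕ} (hR : ∀ x ∈ R, x ∈ TensorRing.homog S V n)

include hR in
/-- The ring homomorphism `A → A[X]` with `a ↦ a X ^ m` for `a ∈ A^m`. -/
noncomputable def weight : QuotRing R →+* Polynomial (QuotRing R) :=
  lift ((Polynomial.mapRingHom (mk R)).comp (TensorRing.weight S V)) fun x hx => by
    rw [RingHom.comp_apply, weight_of_mem_homog (hR x hx)]
    simp [mk_of_mem hx]

theorem coeff_weight_mk (k : ℕ) (t : TensorRing S V) :
    (weight hR (mk R t)).coeff k = mk R (proj S V k t) := by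
  rw [weight, lift_mk]
  simp [proj_apply]

/-- The grading of `A(R)` for homogeneous `R`. -/
noncomputable def grading : GroupGrading (gradingA R) where
  π k := (Polynomial.lcoeff (QuotRing R) k).toAddMonoidHom.comp (weight hR).toAddMonoidHom
  π_mem k x := by
    obtain ⟨t, rfl⟩ := mk_surjective R x
    exact ⟨_, proj_mem k t, (coeff_weight_mk hR k t).symm⟩
  π_same {k x} hx := by
    obtain ⟨t, ht, rfl⟩ := hx
    refine (coeff_weight_mk hR k t).trans ?_
    rw [proj_same ht]
    rfl
  π_ne {k l x} hx hkl := by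
    obtain ⟨t, ht, rfl⟩ := hx
    refine (coeff_weight_mk hR l t).trans ?_
    rw [proj_ne ht hkl, map_zero]
  sum x := by
    obtain ⟨t, rfl⟩ := mk_surjective R x
    obtain ⟨m, hm⟩ := exists_mem_filt t
    refine ⟨m + 1, fun M hM => ?_⟩
    obtain ⟨M, rfl⟩ := Nat.exists_eq_add_of_le' (Nat.le_of_add_left_le hM)
    conv_rhs => rw [sum_proj (filt_mono (show m ≤ M by omega) hm), map_sum]
    exact Finset.sum_congr rfl fun k _ => coeff_weight_mk hR k t

theorem grading_π_mk (k : ℕ) (t : TensorRing S V) :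
    (grading hR).π k (mk R t) = mk R (proj S V k t) := coeff_weight_mk hR k t

end QuotRing

namespace AugMod

variable {A : Type a} [Ring A] {S : Type c} [Ring S] (ε : A →+* S)

/-- The unit of `S`. -/
def one : AugMod ε := ULift.up 1

theorem smul_one_def (x : A) : x • one ε = ULift.up (ε x) :=
  congrArg ULift.up (mul_one (ε x))

/-- The trivial grading of `S`. -/
def grading : GroupGrading (AugMod.deg ε) where
  π k := if k = 0 then AddMonoidHom.id _ else 0
  π_mem k x := by
    cases k with
    | zero => exact AddSubgroup.mem_top _
    | succ k => exact (AugMod.deg ε (k + 1)).zero_mem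
  π_same {k x} hx := by
    cases k with
    | zero => rfl
    | succ k => exact (show x = 0 from hx).symm
  π_ne {k l x} hx hkl := by
    cases l with
    | zero =>
      obtain ⟨k, rfl⟩ := Nat.exists_eq_succ_of_ne_zero hkl
      exact hx
    | succ l => rfl
  sum x := by
    refine ⟨1, fun M hM => ?_⟩
    rw [Finset.sum_eq_single 0]
    · rfl
    · intro k _ hk
      rw [if_neg hk]
      rfl
    · intro h
      exact absurd (Finset.mem_range.mpr (by omega)) h

end AugMod
-- The complex A⊗R → A⊗V → A → S and its exactness.
namespace TensorRing

variable {S : Type u} [Ring S] {V : Type v} [AddCommGroup V] [Module S V] [Module Sᵐᵒᵖ V]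

theorem augmentation_scalar (s : S) : augmentation S V (scalar S V s) = s := lift_scalar _ _ _ _ s

theorem augmentation_ι (x : V) : augmentation S V (ι S V x) = 0 := lift_ι _ _ _ _ x

theorem proj_zero_eq (t : TensorRing S V) : proj S V 0 t = scalar S V (augmentation S V t) := by
  obtain ⟨m, hm⟩ := exists_mem_filt t
  obtain ⟨s, hs⟩ := exists_scalar_of_mem_homog_zero (proj_mem 0 t)
  have h : augmentation S V t = augmentation S V (proj S V 0 t) := by
    conv_lhs => rw [sum_proj hm, map_sum]
    rw [Finset.sum_eq_single 0]
    · intro k _ hk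
      exact augmentation_proj hk t
    · intro h
      exact absurd (Finset.mem_range.mpr (Nat.succ_pos m)) h
  rw [h, hs, augmentation_scalar]

theorem proj_zero_of_augmentation {t : TensorRing S V} (h : augmentation S V t = 0) :
    proj S V 0 t = 0 := by
  rw [proj_zero_eq, h, map_zero]

theorem proj_zero_linearCombination (y : V →₀ TensorRing S V) :
    proj S V 0 (Finsupp.linearCombination (TensorRing S V) (ι S V) y) = 0 := by
  rw [Finsupp.linearCombination_apply, proj_zero_eq, Finsupp.sum, map_sum,
    Finset.sum_eq_zero, map_zero]
  intro v _
  rw [smul_eq_mul, map_mul, augmentation_ι, mul_zero]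

end TensorRing

namespace QuotRing

open TensorRing GroupGrading

variable {S : Type u} [Ring S] {V : Type v} [AddCommGroup V] [Module S V] [Module Sᵐᵒᵖ V]
  (R : SubBimod S (TensorRing S V))

/-- The map `V → A(R)`. -/
def mkι : V →+ QuotRing R := (mk R).toAddMonoidHom.comp (ι S V)

theorem mkι_apply (x : V) : mkι R x = mk R (ι S V x) := rfl

theorem mkι_smul (s : S) (x : V) : mkι R (s • x) = scalar R s • mkι R x :=
  (congrArg (mk R) (ι_smul s x)).trans (map_mul (mk R) _ _)

theorem mkι_mem (x : V) : mkι R x ∈ gradingA R 1 := ⟨_, ι_mem_homog x, rfl⟩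

variable [SMulCommClass S Sᵐᵒᵖ V] (σ : V →ₗ[S] V →₀ S)

/-- The map `T → A ⊗_S V` with `t x ↦ t ⊗ x` for `x ∈ V` which vanishes on `S`. -/
noncomputable def mkDeriv : TensorRing S V →+ (V →₀ QuotRing R) :=
  (Finsupp.mapRange.addMonoidHom (mk R).toAddMonoidHom).comp (deriv σ)

theorem mkDeriv_apply (t : TensorRing S V) (v : V) : mkDeriv R σ t v = mk R (deriv σ t v) := rfl

theorem mkDeriv_mul_ι (t : TensorRing S V) (x : V) :
    mkDeriv R σ (t * ι S V x) = mk R t • indLift (scalar R) σ x := by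
  refine Finsupp.ext fun v => ?_
  rw [mkDeriv_apply, deriv_mul_ι]
  exact map_mul (mk R) _ _

theorem mkDeriv_mul (t : TensorRing S V) {u : TensorRing S V} (hu : proj S V 0 u = 0) :
    mkDeriv R σ (t * u) = mk R t • mkDeriv R σ u := by
  refine Finsupp.ext fun v => ?_
  rw [mkDeriv_apply, deriv_mul σ t hu]
  exact map_mul (mk R) _ _

/-- Multiplying out y and splitting off the last letter again is the idempotent, after reduction to
A. -/
theorem mkDeriv_linearCombination (y : V →₀ TensorRing S V) :
    mkDeriv R σ (Finsupp.linearCombination (TensorRing S V) (ι S V) y) =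
      indProj (scalar R) σ (y.mapRange (mk R) (map_zero _)) := by
  induction y using Finsupp.induction_linear with
  | zero => simp
  | add y z hy hz =>
    rw [map_add, map_add, hy, hz, Finsupp.mapRange_add (fun x y => map_add (mk R) x y), map_add]
  | single v t =>
    rw [Finsupp.linearCombination_single, smul_eq_mul, mkDeriv_mul_ι, Finsupp.mapRange_single,
      indProj, Finsupp.linearCombination_single]

variable {R} {n : ℕ} (hR : ∀ x ∈ R, x ∈ TensorRing.homog S V n)

theorem mkDeriv_mem {k : ℕ} {t : TensorRing S V} (ht : t ∈ TensorRing.homog S V k) :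
    mkDeriv R σ t ∈ finsuppDeg (gradingA R) (fun _ => 1) k := by
  intro v
  cases k with
  | zero =>
    obtain ⟨s, rfl⟩ := exists_scalar_of_mem_homog_zero ht
    rw [mkDeriv_apply, deriv_scalar, Finsupp.zero_apply, map_zero]
    exact zero_mem _
  | succ k =>
    rw [if_pos (Nat.le_add_left 1 k), Nat.add_sub_cancel]
    exact ⟨_, deriv_mem_homog σ ht v, rfl⟩

variable (R) in
/-- The map `R → A ⊗_S V` induced by the inclusion of `R` in `T V`. -/
noncomputable def relDeriv : R →+ (V →₀ QuotRing R) :=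
  (mkDeriv R σ).comp (AddSubgroupClass.subtype R)

theorem relDeriv_apply (r : R) : relDeriv R σ r = mkDeriv R σ r.1 := rfl

include hR in
theorem relDeriv_mem (r : R) :
    relDeriv R σ r ∈ finsuppDeg (gradingA R) (fun _ : V => 1) n :=
  mkDeriv_mem σ (hR r.1 r.2)

variable {σ} (hσ : ∀ x, Finsupp.linearCombination S id (σ x) = x)

include hσ

/-- Multiplying out the derivative of t returns t up to its constant term, which has zero
derivative; hence the idempotent fixes `mkDeriv R σ t`. -/
theorem mkDeriv_mem_indMod (t : TensorRing S V) : mkDeriv R σ t ∈ indMod (scalar R) σ := by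
  rw [mem_indMod]
  change indProj (scalar R) σ ((deriv σ t).mapRange (mk R) (map_zero _)) = _
  rw [← mkDeriv_linearCombination, ← sub_add_cancel t (proj S V 0 t), map_add (deriv σ), map_add,
    linearCombination_deriv hσ (by rw [proj_sub, proj_same (proj_mem 0 t), sub_self]),
    proj_zero_eq, deriv_scalar, map_zero, add_zero, map_add, mkDeriv]
  simp [deriv_scalar]

theorem linearCombination_mkDeriv {t : TensorRing S V} (ht : proj S V 0 t = 0) :
    Finsupp.linearCombination (QuotRing R) (mkι R) (mkDeriv R σ t) = mk R t := by
  have h := mem_closure_of_proj_zero ht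
  clear ht
  induction h using AddSubgroup.closure_induction with
  | mem z hz =>
    obtain ⟨t, x, rfl⟩ := hz
    rw [mkDeriv_mul_ι, map_smul, linearCombination_indLift hσ _ (mkι_smul R), smul_eq_mul,
      mkι_apply, map_mul]
  | zero => simp
  | add x y _ _ hx hy => rw [map_add, map_add, hx, hy, map_add]
  | neg x _ hx => rw [map_neg, map_neg, hx, map_neg]

section Resolution

variable (hε : ∀ x ∈ R, TensorRing.augmentation S V x = 0)

omit hσ in
omit [SMulCommClass S Sᵐᵒᵖ V] in
theorem augmentation_mk (t : TensorRing S V) :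
    QuotRing.augmentation R hε (mk R t) = TensorRing.augmentation S V t := rfl

omit [SMulCommClass S Sᵐᵒᵖ V] hσ in
theorem augmentation_of_mem {k : ℕ} (hk : k ≠ 0) {x : QuotRing R} (hx : x ∈ gradingA R k) :
    QuotRing.augmentation R hε x = 0 := by
  obtain ⟨t, ht, rfl⟩ := hx
  exact (augmentation_mk hε t).trans (by rw [← proj_same ht, augmentation_proj hk])

omit [SMulCommClass S Sᵐᵒᵖ V] hσ in
theorem gradedS_smulMem : GradedSMulMem (gradingA R) (AugMod.deg (QuotRing.augmentation R hε)) := by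
  intro i j x y hx hy
  rcases Nat.eq_zero_or_pos j with rfl | hj
  · rcases Nat.eq_zero_or_pos i with rfl | hi
    · exact AddSubgroup.mem_top _
    · have h : x • y = 0 := by
        change ULift.up (QuotRing.augmentation R hε x * y.down) = ULift.up 0
        rw [augmentation_of_mem hε hi.ne' hx, zero_mul]
      rw [h]
      exact zero_mem _
  · obtain ⟨j, rfl⟩ := Nat.exists_eq_succ_of_ne_zero hj.ne'
    rw [show y = 0 from hy, smul_zero]
    exact zero_mem _

/-- The augmentation `A → S` as a map of left modules. -/
def res₀ : QuotRing R →ₗ[QuotRing R] AugMod.{max u v, u} (QuotRing.augmentation R hε) :=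
  LinearMap.toSpanSingleton _ _ (AugMod.one _)

omit [SMulCommClass S Sᵐᵒᵖ V] hσ in
theorem res₀_mem (k : ℕ) (x : QuotRing R) (hx : x ∈ gradingA R k) :
    res₀ hε x ∈ AugMod.deg (QuotRing.augmentation R hε) k :=
  gradedS_smulMem hε hx (show AugMod.one _ ∈ AugMod.deg (QuotRing.augmentation R hε) 0 from
    AddSubgroup.mem_top _)

omit [SMulCommClass S Sᵐᵒᵖ V] hσ in
theorem mem_ker_res₀ {x : QuotRing R} :
    x ∈ LinearMap.ker (res₀ hε) ↔ QuotRing.augmentation R hε x = 0 := by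
  rw [LinearMap.mem_ker, res₀, LinearMap.toSpanSingleton_apply, AugMod.smul_one_def]
  exact ⟨fun h => congrArg ULift.down h, fun h => congrArg ULift.up h⟩

omit [SMulCommClass S Sᵐᵒᵖ V] hσ in
theorem res₀_surjective : Function.Surjective (res₀ hε) := by
  rintro ⟨s⟩
  refine ⟨scalar R s, ?_⟩
  rw [res₀, LinearMap.toSpanSingleton_apply, AugMod.smul_one_def]
  exact congrArg ULift.up (augmentation_scalar s)

variable (σ) in
/-- The map `A ⊗_S V → A_+`. -/
noncomputable def res₁ : indMod (scalar R) σ →ₗ[QuotRing R] LinearMap.ker (res₀ hε) :=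
  ((Finsupp.linearCombination (QuotRing R) (mkι R)).domRestrict _).codRestrict _ fun x => by
    rw [mem_ker_res₀, LinearMap.domRestrict_apply, Finsupp.linearCombination_apply, Finsupp.sum,
      map_sum]
    refine Finset.sum_eq_zero fun v _ => ?_
    rw [smul_eq_mul, map_mul, augmentation_of_mem hε one_ne_zero (mkι_mem R v), mul_zero]

omit [SMulCommClass S Sᵐᵒᵖ V] hσ in
theorem res₁_mem (k : ℕ) (x : indMod (scalar R) σ) (hx : x ∈ indDeg (scalar R) σ (gradingA R) 1 k) :
    (res₁ σ hε x : QuotRing R) ∈ gradingA R k :=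
  linearCombination_mem gradingA_mul (fun v => mkι_mem R v) hx

theorem res₁_surjective : Function.Surjective (res₁ σ hε) := by
  rintro ⟨x, hx⟩
  obtain ⟨t, rfl⟩ := mk_surjective R x
  rw [mem_ker_res₀, augmentation_mk] at hx
  exact ⟨⟨_, mkDeriv_mem_indMod hσ t⟩, Subtype.ext (linearCombination_mkDeriv hσ
    (proj_zero_of_augmentation hx))⟩

theorem linearCombination_relDeriv_mem {σ' : R →ₗ[S] R →₀ S} (x : indMod (scalar R) σ') :
    Finsupp.linearCombination (QuotRing R) (relDeriv R σ) x.1 ∈ indMod (scalar R) σ := by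
  rw [Finsupp.linearCombination_apply]
  exact sum_mem fun r _ => Submodule.smul_mem _ _ (mkDeriv_mem_indMod hσ _)

include hε in
theorem linearCombination_linearCombination_relDeriv (x : R →₀ QuotRing R) :
    Finsupp.linearCombination (QuotRing R) (mkι R)
      (Finsupp.linearCombination (QuotRing R) (relDeriv R σ) x) = 0 := by
  rw [Finsupp.linearCombination_apply (QuotRing R) x, Finsupp.sum, map_sum]
  refine Finset.sum_eq_zero fun r _ => ?_
  rw [map_smul, relDeriv_apply,
    linearCombination_mkDeriv hσ (proj_zero_of_augmentation (hε _ r.2)), mk_of_mem r.2, smul_zero]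

/-- The map `A ⊗_S R → ker (A ⊗_S V → A)`. -/
noncomputable def res₂ (σ' : R →ₗ[S] R →₀ S) :
    indMod (scalar R) σ' →ₗ[QuotRing R] LinearMap.ker (res₁ σ hε) where
  toFun x := ⟨⟨Finsupp.linearCombination (QuotRing R) (relDeriv R σ) x.1,
      linearCombination_relDeriv_mem hσ x⟩,
    LinearMap.mem_ker.mpr
      (Subtype.ext (linearCombination_linearCombination_relDeriv hσ hε x.1))⟩
  map_add' x y := Subtype.ext (Subtype.ext
    (map_add (Finsupp.linearCombination (QuotRing R) (relDeriv R σ)) x.1 y.1))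
  map_smul' a x := Subtype.ext (Subtype.ext
    (map_smul (Finsupp.linearCombination (QuotRing R) (relDeriv R σ)) a x.1))

include hR in
theorem res₂_mem (σ' : R →ₗ[S] R →₀ S) (k : ℕ) (x : indMod (scalar R) σ')
    (hx : x ∈ indDeg (scalar R) σ' (gradingA R) n k) :
    (res₂ hσ hε σ' x).1 ∈ indDeg (scalar R) σ (gradingA R) 1 k :=
  linearCombination_mem (W := R) (l := relDeriv R σ) (𝒩 := finsuppDeg (gradingA R) fun _ => 1)
    (d := fun _ => n) (finsuppDeg_smulMem gradingA_mul _) (fun r => relDeriv_mem σ hR r) hx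

variable {σ' : R →ₗ[S] R →₀ S} (hσ' : ∀ x, Finsupp.linearCombination S id (σ' x) = x)

omit hσ in
include hε in
theorem relDeriv_smul (s : S) (r : R) : relDeriv R σ (s • r) = scalar R s • relDeriv R σ r := by
  exact mkDeriv_mul R σ (TensorRing.scalar S V s) (proj_zero_of_augmentation (hε _ r.2))

omit hσ in
include hε hσ' in
theorem linearCombination_relDeriv (r : R) :
    Finsupp.linearCombination (QuotRing R) (relDeriv R σ) (indLift (scalar R) σ' r) =
      relDeriv R σ r :=
  linearCombination_indLift hσ' (relDeriv R σ) (relDeriv_smul hε) r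

-- The ideal is T R + ⟨R⟩ V. The first summand gives the image of A⊗R, the second dies in A⊗V
-- because its coefficients vanish in A.
omit hσ in
include hε hσ' in
theorem exists_linearCombination_relDeriv {t : TensorRing S V}
    (ht : t ∈ TwoSidedIdeal.span (R : Set (TensorRing S V))) :
    ∃ x ∈ indMod (scalar R) σ',
      Finsupp.linearCombination (QuotRing R) (relDeriv R σ) x = mkDeriv R σ t := by
  have h := mem_sup_of_mem_span ht
  rw [← AddSubgroup.closure_union] at h
  refine AddSubgroup.closure_induction (p := fun t _ => ∃ x ∈ indMod (scalar R) σ',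
      Finsupp.linearCombination (QuotRing R) (relDeriv R σ) x = mkDeriv R σ t) ?_ ?_ ?_ ?_ h
  · rintro _ (⟨x, p, hp, rfl⟩ | ⟨w, hw, y, rfl⟩)
    · refine ⟨mk R x • indLift (scalar R) σ' ⟨p, hp⟩,
        Submodule.smul_mem _ _ (indLift_mem_indMod hσ' _), ?_⟩
      rw [map_smul, linearCombination_relDeriv hε hσ', relDeriv_apply,
        mkDeriv_mul R σ x (u := p) (proj_zero_of_augmentation (hε p hp))]
    · refine ⟨0, zero_mem _, ?_⟩
      rw [mkDeriv_mul_ι, mk_eq_zero.mpr hw, zero_smul, map_zero]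
  · exact ⟨0, zero_mem _, by rw [map_zero, map_zero]⟩
  · rintro x y _ _ ⟨x', hx', hx⟩ ⟨y', hy', hy⟩
    exact ⟨x' + y', add_mem hx' hy', by rw [map_add, map_add, hx, hy]⟩
  · rintro x _ ⟨x', hx', hx⟩
    exact ⟨-x', neg_mem hx', by rw [map_neg, map_neg, hx]⟩

-- Exactness at A⊗V: lift a cycle to T^(V) and multiply out. The result vanishes in A, so it lies in
-- ⟨R⟩, and its derivative, which is the given cycle, comes from A⊗R.
include hσ' in
theorem res₂_surjective : Function.Surjective (res₂ hσ hε σ') := by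
  rintro ⟨⟨x, hx⟩, hx'⟩
  obtain ⟨y, rfl⟩ := Finsupp.mapRange_surjective (mk R) (map_zero _) (mk_surjective R) x
  have h1 := mkDeriv_linearCombination R σ y
  rw [mem_indMod.mp hx] at h1
  have h3 : mk R (Finsupp.linearCombination (TensorRing S V) (ι S V) y) = 0 := by
    rw [← linearCombination_mkDeriv hσ (proj_zero_linearCombination y), h1]
    exact congrArg Subtype.val (LinearMap.mem_ker.mp hx')
  obtain ⟨z, hz, hzy⟩ := exists_linearCombination_relDeriv (σ := σ) hε hσ' (mk_eq_zero.mp h3)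
  exact ⟨⟨z, hz⟩, Subtype.ext (Subtype.ext (hzy.trans h1))⟩

end Resolution

end QuotRing
-- Tor and the syzygies modulo A_+.
namespace AugMod

variable {A : Type a} [Ring A] {S : Type c} [Ring S] (ε : A →+* S)

/-- The identification of `AugMod ε` with `S`. -/
def val : AugMod ε →+ S where
  toFun s := s.down
  map_zero' := rfl
  map_add' _ _ := rfl

theorem val_one : val ε (one ε) = 1 := rfl

theorem val_op_smul (x : A) (s : AugMod ε) : val ε (op x • s) = val ε s * ε x := rfl

end AugMod

section TorComparison

variable {A : Type a} [Ring A] {S : Type c} [Ring S] (ε : A →+* S)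

/-- The subgroup `A_+ M` for the kernel `A_+` of a ring homomorphism `ε`. -/
def augMul (M : Type b) [AddCommGroup M] [Module A M] : AddSubgroup M :=
  AddSubgroup.closure {z | ∃ (x : A) (m : M), ε x = 0 ∧ z = x • m}

variable {ε}

theorem smul_mem_augMul {M : Type b} [AddCommGroup M] [Module A M] {x : A} (hx : ε x = 0) (m : M) :
    x • m ∈ augMul ε M := AddSubgroup.subset_closure ⟨x, m, hx, rfl⟩

theorem map_mem_augMul {M : Type b} [AddCommGroup M] [Module A M] {N : Type w} [AddCommGroup N]
    [Module A N] (f : M →ₗ[A] N) {m : M} (hm : m ∈ augMul ε M) : f m ∈ augMul ε N := by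
  refine (AddSubgroup.closure_le ((augMul ε N).comap f.toAddMonoidHom)).mpr ?_ hm
  rintro _ ⟨x, m, hx, rfl⟩
  change f (x • m) ∈ augMul ε N
  rw [map_smul]
  exact smul_mem_augMul hx _

theorem tmul_one_eq_zero {M : Type b} [AddCommGroup M] [Module A M] {m : M}
    (hm : m ∈ augMul ε M) : BalTensor.tmul A (AugMod.one ε) m = 0 := by
  have hadd : ∀ m m' : M, BalTensor.tmul A (AugMod.one ε) (m + m') =
      BalTensor.tmul A (AugMod.one ε) m + BalTensor.tmul A (AugMod.one ε) m' := fun m m' => by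
    rw [BalTensor.tmul, TensorProduct.tmul_add, map_add]; rfl
  let f : M →+ BalTensor A (AugMod ε) M :=
    AddMonoidHom.mk' (fun m => BalTensor.tmul A (AugMod.one ε) m) hadd
  refine (AddSubgroup.closure_le f.ker).mpr ?_ hm
  rintro _ ⟨x, m, hx, rfl⟩
  have h0 : op x • AugMod.one ε = 0 := by
    change ULift.up (1 * ε x) = ULift.up 0
    rw [hx, mul_zero]
  have h1 : BalTensor.tmul A (op x • AugMod.one ε) m = BalTensor.tmul A (AugMod.one ε) (x • m) := by
    rw [← sub_eq_zero]
    change BalTensor.mk A _ - BalTensor.mk A _ = 0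
    rw [← map_sub]
    exact (QuotientAddGroup.eq_zero_iff _).mpr (AddSubgroup.subset_closure ⟨_, x, m, rfl⟩)
  change BalTensor.tmul A (AugMod.one ε) (x • m) = 0
  rw [← h1, h0, BalTensor.tmul, TensorProduct.zero_tmul, map_zero]

variable (φ : S →+* A) (hφ : ∀ s, ε (φ s) = s)

include hφ in
/-- The map `S ⊗_A Q → K / A_+ K` induced by a linear map `Q → K`. -/
noncomputable def augTensorMap {Q : Type a} [AddCommGroup Q] [Module A Q] {K : Type b}
    [AddCommGroup K] [Module A K] (g : Q →ₗ[A] K) :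
    BalTensor A (AugMod ε) Q →+ K ⧸ augMul ε K :=
  BalTensor.lift
    (AddMonoidHom.mk' (fun s : AugMod ε => (QuotientAddGroup.mk' (augMul ε K)).comp
      ((DistribSMul.toAddMonoidHom K (φ (AugMod.val ε s))).comp g.toAddMonoidHom)) fun s t => by
        ext q
        change QuotientAddGroup.mk' (augMul ε K) (φ (AugMod.val ε (s + t)) • g q) =
          QuotientAddGroup.mk' (augMul ε K) (φ (AugMod.val ε s) • g q) +
            QuotientAddGroup.mk' (augMul ε K) (φ (AugMod.val ε t) • g q)
        rw [map_add, map_add, add_smul, map_add])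
    (fun s x q => by
      change QuotientAddGroup.mk' (augMul ε K) (φ (AugMod.val ε (op x • s)) • g q) =
        QuotientAddGroup.mk' (augMul ε K) (φ (AugMod.val ε s) • g (x • q))
      rw [← sub_eq_zero, ← map_sub, map_smul g, smul_smul, ← sub_smul]
      -- Balancedness: φ(s ε(x)) - φ(s) x is killed by ε, so it acts as zero on K / A_+ K.
      refine (QuotientAddGroup.eq_zero_iff _).mpr (smul_mem_augMul ?_ _)
      rw [map_sub, map_mul, hφ, hφ, AugMod.val_op_smul, sub_self])

theorem augTensorMap_tmul {Q : Type a} [AddCommGroup Q] [Module A Q] {K : Type b} [AddCommGroup K]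
    [Module A K] (g : Q →ₗ[A] K) (s : AugMod ε) (q : Q) :
    augTensorMap φ hφ g (BalTensor.tmul A s q) =
      QuotientAddGroup.mk' _ (φ (AugMod.val ε s) • g q) := rfl

/-- The canonical surjection from the `i`-th term of the free resolution to the `i`-th syzygy. -/
noncomputable def GrMod.coverRes (𝒜 : ℕ → AddSubgroup A) (N : GrMod A) (i : ℕ) :
    res 𝒜 N i →ₗ[A] syzygies 𝒜 N i := cover 𝒜 (syzygies 𝒜 N i)

open GrMod

variable {𝒜 : ℕ → AddSubgroup A} (N : GrMod A) {P : Type a} [AddCommGroup P] [Module A P]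
  {K : Submodule A P} {i : ℕ} (f : K →ₗ[A] syzygies 𝒜 N (i + 1))
  (F : P →ₗ[A] res 𝒜 N i) (hF : ∀ x, (f x).1 = F x.1)
  (g : syzygies 𝒜 N (i + 1) →ₗ[A] K) (h : P →ₗ[A] K) (hgf : ∀ x, g (f x) = x + h x.1)
  (GN : GroupGrading (syzygies 𝒜 N (i + 1)).deg) (hK : ∀ x : K, x.1 ∈ augMul ε P)

-- Tor_{i+1} covers K / A_+ K. For k in K lift f k to q in the canonical resolution; the
-- differential of q is F k, in A_+ times the module since K ⊆ A_+ P, so 1⊗q is a cycle. It goes to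
-- the class of g (f k) = k + h k, and h k is in A_+ K for the same reason.
include hF hgf hK GN in
theorem exists_cycle (k : K) : ∃ z : torCycles 𝒜 (AugMod ε) N (i + 1),
    augTensorMap φ hφ (g.comp (coverRes 𝒜 N (i + 1))) z.1 =
      QuotientAddGroup.mk' _ k := by
  obtain ⟨q, hq⟩ : ∃ q : res 𝒜 N (i + 1), coverRes 𝒜 N (i + 1) q = f k :=
    cover_surjective GN (f k)
  refine ⟨⟨BalTensor.tmul A (AugMod.one ε) q, ?_⟩, ?_⟩
  · change BalTensor.tmul A (AugMod.one ε) (resD 𝒜 N i q) = 0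
    refine tmul_one_eq_zero ?_
    have h1 : resD 𝒜 N i q = F k.1 := (congrArg Subtype.val hq).trans (hF k)
    rw [h1]
    exact map_mem_augMul F (hK k)
  · change augTensorMap φ hφ _ (BalTensor.tmul A (AugMod.one ε) q) = _
    rw [augTensorMap_tmul]
    have h1 : g.comp (coverRes 𝒜 N (i + 1)) q = k + h k.1 := by
      rw [← hgf, ← hq]; rfl
    rw [h1, AugMod.val_one, map_one φ, one_smul, map_add]
    rw [(QuotientAddGroup.eq_zero_iff (h k.1)).mpr (map_mem_augMul h (hK k)) |> fun e =>
      show QuotientAddGroup.mk' (augMul ε K) (h k.1) = 0 from e, add_zero]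

/-- Boundaries go to 0, so the map to K / A_+ K is defined on Tor. -/
theorem augTensorMap_range {z : BalTensor A (AugMod ε) (N.res 𝒜 (i + 1))}
    (hz : z ∈ (BalTensor.lTensor (AugMod ε) (N.resD 𝒜 (i + 1))).range) :
    augTensorMap φ hφ (g.comp (coverRes 𝒜 N (i + 1))) z = 0 := by
  obtain ⟨z, rfl⟩ := hz
  refine BalTensor.induction_tmul (p := fun z => augTensorMap φ hφ
    (g.comp (coverRes 𝒜 N (i + 1)))
      (BalTensor.lTensor (AugMod ε) (N.resD 𝒜 (i + 1)) z) = 0) z ?_ ?_ ?_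
  · rw [map_zero, map_zero]
  · intro s q
    rw [BalTensor.lTensor_tmul, augTensorMap_tmul]
    have h1 : coverRes 𝒜 N (i + 1) (N.resD 𝒜 (i + 1) q) = 0 :=
      (cover 𝒜 (syzygies 𝒜 N (i + 2)) q).2
    rw [LinearMap.comp_apply, h1, map_zero, smul_zero, map_zero]
  · intro x y hx hy
    rw [map_add, map_add, hx, hy, add_zero]

-- If Tor_{i+1} = 0, the cycle above k is a boundary, whence K = A_+ K.
include hF hgf hK GN hφ in
theorem mem_augMul_of_subsingleton (hTor : Subsingleton (GrTor 𝒜 (AugMod ε) N (i + 1))) (k : K) :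
    k ∈ augMul ε K := by
  obtain ⟨z, hz⟩ := exists_cycle φ hφ N f F hF g h hgf GN hK k
  have h1 : (QuotientAddGroup.mk' _ z : GrTor 𝒜 (AugMod ε) N (i + 1)) = 0 :=
    hTor.elim _ _
  have h2 := (QuotientAddGroup.eq_zero_iff z).mp h1
  exact (QuotientAddGroup.eq_zero_iff k).mp (hz.symm.trans (augTensorMap_range φ hφ N g h2))

-- If Tor_{i+1} is concentrated in degree m, the cycle above k may be replaced by one of degree m,
-- and g preserves degrees; so K is generated modulo A_+ K in degree m.
include hF hgf hK GN hφ in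
theorem exists_sub_mem_augMul (𝒦 : ℕ → AddSubgroup K)
    (hg : ∀ k x, x ∈ (syzygies 𝒜 N (i + 1)).deg k → g x ∈ 𝒦 k)
    (h𝒦 : GradedSMulMem 𝒜 𝒦) (hN : GradedSMulMem 𝒜 (syzygies 𝒜 N (i + 1)).deg)
    (hφ0 : ∀ s, φ s ∈ 𝒜 0) {m : ℕ}
    (hTor : GrTor.component 𝒜 (AugMod ε) (AugMod.deg ε) N (i + 1) m = ⊤) (k : K) :
    ∃ k' ∈ 𝒦 m, k - k' ∈ augMul ε K := by
  obtain ⟨z, hz⟩ := exists_cycle φ hφ N f F hF g h hgf GN hK k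
  have h1 : (QuotientAddGroup.mk' _ z : GrTor 𝒜 (AugMod ε) N (i + 1)) ∈
    GrTor.component 𝒜 (AugMod ε) (AugMod.deg ε) N (i + 1) m := hTor ▸ AddSubgroup.mem_top _
  obtain ⟨y, hy, hyz⟩ := h1
  have h2 := (QuotientAddGroup.eq_zero_iff (z - y)).mp ((map_sub (QuotientAddGroup.mk' _) z y).trans
    (sub_eq_zero.mpr hyz.symm))
  have h3 := augTensorMap_range φ hφ N g h2
  have h4 : ∃ k' ∈ 𝒦 m, QuotientAddGroup.mk' (augMul ε K) k' =
      augTensorMap φ hφ (g.comp (coverRes 𝒜 N (i + 1))) y.1 := by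
    have h5 : y.1 ∈ tensorDeg 𝒜 (AugMod ε) (AugMod.deg ε) N (i + 1) m := hy
    generalize y.1 = y at h5
    induction h5 using AddSubgroup.closure_induction with
    | mem y hy =>
      obtain ⟨a, l, s, q, hal, hs, hq, rfl⟩ := hy
      rw [augTensorMap_tmul]
      -- S sits in degree 0, so only a = 0 contributes.
      rcases Nat.eq_zero_or_pos a with rfl | ha
      · rw [zero_add] at hal
        subst hal
        refine ⟨_, ?_, rfl⟩
        have h6 := h𝒦 (hφ0 (AugMod.val ε s)) (hg l _ (cover_mem hN l q hq))
        rwa [zero_add] at h6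
      · obtain ⟨a, rfl⟩ := Nat.exists_eq_succ_of_ne_zero ha.ne'
        have hs0 : φ (AugMod.val ε s) = 0 := by rw [show s = 0 from hs, map_zero, map_zero]
        exact ⟨0, zero_mem _, by rw [hs0, zero_smul]⟩
    | zero => exact ⟨0, zero_mem _, by rw [map_zero, map_zero]⟩
    | add x y _ _ hx hy =>
      obtain ⟨⟨x', hx', hx⟩, ⟨y', hy', hy⟩⟩ := And.intro hx hy
      exact ⟨x' + y', add_mem hx' hy', by rw [map_add, map_add, hx, hy]⟩
    | neg x _ hx =>
      obtain ⟨x', hx', hx⟩ := hx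
      exact ⟨-x', neg_mem hx', by rw [map_neg, map_neg, hx]⟩
  obtain ⟨k', hk', hkk'⟩ := h4
  refine ⟨k', hk', (QuotientAddGroup.eq_zero_iff (k - k')).mp ?_⟩
  refine (map_sub (QuotientAddGroup.mk' (augMul ε K)) k k').trans ?_
  rw [hkk', ← hz, ← map_sub]
  exact h3

end TorComparison
section Comparison

open GroupGrading GrMod

variable {A : Type a} [Ring A] {𝒜 : ℕ → AddSubgroup A} (GA : GroupGrading 𝒜)
  (hA : GradedSMulMem 𝒜 𝒜) {N : GrMod A} (GN : GroupGrading N.deg) (hN : GradedSMulMem 𝒜 N.deg)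
  {P₀ : Type a} [AddCommGroup P₀] [Module A P₀] [Module.Projective A P₀]
  {𝒦₀ : ℕ → AddSubgroup P₀} (G₀ : GroupGrading 𝒦₀) (h₀ : GradedSMulMem 𝒜 𝒦₀)
  {P₁ : Type a} [AddCommGroup P₁] [Module A P₁] [Module.Projective A P₁]
  {𝒦₁ : ℕ → AddSubgroup P₁} (G₁ : GroupGrading 𝒦₁) (h₁ : GradedSMulMem 𝒜 𝒦₁)
  {P₂ : Type a} [AddCommGroup P₂] [Module A P₂] [Module.Projective A P₂]
  {𝒦₂ : ℕ → AddSubgroup P₂} (G₂ : GroupGrading 𝒦₂) (h₂ : GradedSMulMem 𝒜 𝒦₂)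
  (p₀ : P₀ →ₗ[A] N) (hp₀ : ∀ k x, x ∈ 𝒦₀ k → p₀ x ∈ N.deg k) (hs₀ : Function.Surjective p₀)
  (p₁ : P₁ →ₗ[A] LinearMap.ker p₀) (hp₁ : ∀ k x, x ∈ 𝒦₁ k → (p₁ x).1 ∈ 𝒦₀ k)
  (hs₁ : Function.Surjective p₁)
  (p₂ : P₂ →ₗ[A] LinearMap.ker p₁) (hp₂ : ∀ k x, x ∈ 𝒦₂ k → (p₂ x).1 ∈ 𝒦₁ k)
  (hs₂ : Function.Surjective p₂)

include GA hA GN hN G₀ h₀ G₁ h₁ G₂ h₂ hp₀ hs₀ hp₁ hs₁ hp₂ hs₂ in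
/-- Comparison of the canonical resolution with another graded projective resolution. -/
theorem exists_resolution_comparison :
    ∃ (f : LinearMap.ker p₂ →ₗ[A] syzygies 𝒜 N 3) (F : P₂ →ₗ[A] res 𝒜 N 2)
      (g : syzygies 𝒜 N 3 →ₗ[A] LinearMap.ker p₂) (h : P₂ →ₗ[A] LinearMap.ker p₂),
      (∀ x, (f x).1 = F x.1) ∧ (∀ k x, x ∈ (syzygies 𝒜 N 3).deg k → (g x).1 ∈ 𝒦₂ k) ∧
      ∀ x, g (f x) = x + h x.1 := by
  let K₀ := kerGrading G₀ GN p₀ hp₀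
  let K₁ := kerGrading G₁ K₀ p₁ hp₁
  let GS := syzygiesGrading GA hA GN hN
  -- Dimension shifting starts from the identity of N with zero error, so the projective module M is
  -- arbitrary here. In the later rounds the error factors through the projective term of the
  -- previous round.
  obtain ⟨f1, g1, h1, -, hg1, e1⟩ := exists_syzygy_comparison
    (𝒩' := N.deg) (M := A) (W := Σ m, N.deg m) (d := Sigma.fst)
    (l' := fun i => i.2) h₀ G₀ GN p₀ hp₀ hs₀
    (fun i => i.2.2) (linearCombination_surjective_of_grading GN) LinearMap.id LinearMap.id
    (fun _ _ h => h) 0 0 (fun x => (add_zero x).symm)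
  obtain ⟨f2, g2, h2, -, hg2, e2⟩ := exists_syzygy_comparison
    (𝒩' := (syzygies 𝒜 N 1).deg)
    (W := Σ m, (syzygies 𝒜 N 1).deg m) (d := Sigma.fst)
    (l' := fun i => i.2) h₁ G₁ K₀ p₁ hp₁ hs₁
    (fun i => i.2.2) (linearCombination_surjective_of_grading (GS 1).1) f1 g1
    hg1 (LinearMap.ker p₀).subtype h1 e1
  obtain ⟨f3, g3, h3, ⟨F, hF⟩, hg3, e3⟩ := exists_syzygy_comparison
    (𝒩' := (syzygies 𝒜 N 2).deg)
    (W := Σ m, (syzygies 𝒜 N 2).deg m) (d := Sigma.fst)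
    (l' := fun i => i.2) h₂ G₂ K₁ p₂ hp₂ hs₂
    (fun i => i.2.2) (linearCombination_surjective_of_grading (GS 2).1) f2 g2
    hg2 (LinearMap.ker p₁).subtype h2 e2
  exact ⟨f3, F, g3, h3, hF, hg3, e3⟩

end Comparison
-- Graded Nakayama lemma and generators of the third syzygy.
section Nakayama

variable {A : Type a} [Ring A] {S : Type c} [Ring S] {ε : A →+* S} {𝒜 : ℕ → AddSubgroup A}
  (GA : GroupGrading 𝒜) (hε : ∀ x, ε x = 0 → GA.π 0 x = 0)
  {K : Type b} [AddCommGroup K] [Module A K] {𝒦 : ℕ → AddSubgroup K} (GK : GroupGrading 𝒦)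
  (hK : GradedSMulMem 𝒜 𝒦)

/-- The component of degree `m` of the submodule generated by elements `E` of degree `e`. -/
def genDeg (𝒜 : ℕ → AddSubgroup A) (E : AddSubgroup K) (e m : ℕ) : AddSubgroup K :=
  AddSubgroup.closure {z | ∃ (p : ℕ) (x : A) (y : K), p + e = m ∧ x ∈ 𝒜 p ∧ y ∈ E ∧ z = x • y}

theorem smul_mem_genDeg (hA : GradedSMulMem 𝒜 𝒜) {E : AddSubgroup K} {e m p : ℕ} {x : A} {y : K}
    (hx : x ∈ 𝒜 p) (hy : y ∈ genDeg 𝒜 E e m) : x • y ∈ genDeg 𝒜 E e (p + m) := by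
  refine (AddSubgroup.closure_le ((genDeg 𝒜 E e (p + m)).comap
    (DistribSMul.toAddMonoidHom K x))).mpr ?_ hy
  rintro _ ⟨q, z, y, hq, hz, hy, rfl⟩
  exact AddSubgroup.subset_closure ⟨p + q, x * z, y, by omega, hA hx hz, hy, smul_smul _ _ _⟩

-- Elements of A_+ have no degree 0 part, so a given degree of A_+ K only involves strictly lower
-- degrees of K.
include hε hK in
theorem π_mem_closure_of_mem_augMul (m : ℕ) {w : K} (hw : w ∈ augMul ε K) :
    GK.π m w ∈ AddSubgroup.closure {z | ∃ (p l : ℕ) (x : A) (y : K), p ≠ 0 ∧ p + l = m ∧ x ∈ 𝒜 p ∧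
      y ∈ 𝒦 l ∧ z = x • y} := by
  set C := AddSubgroup.closure {z | ∃ (p l : ℕ) (x : A) (y : K), p ≠ 0 ∧ p + l = m ∧ x ∈ 𝒜 p ∧
      y ∈ 𝒦 l ∧ z = x • y}
  refine (AddSubgroup.closure_le (C.comap (GK.π m))).mpr ?_ hw
  rintro _ ⟨x, y, hx, rfl⟩
  obtain ⟨M, hM⟩ := GA.exists_sum x
  obtain ⟨L, hL⟩ := GK.exists_sum y
  change GK.π m (x • y) ∈ C
  rw [← hM, ← hL, Finset.sum_smul, map_sum]
  refine sum_mem fun p _ => ?_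
  rw [Finset.smul_sum, map_sum]
  refine sum_mem fun l _ => ?_
  rw [GK.π_of_mem (hK (GA.π_mem p x) (GK.π_mem l y))]
  split_ifs with h
  · rcases Nat.eq_zero_or_pos p with rfl | hp
    · rw [hε x hx, zero_smul]
      exact zero_mem _
    · exact AddSubgroup.subset_closure ⟨p, l, _, _, hp.ne', h, GA.π_mem p x, GK.π_mem l y, rfl⟩
  · exact zero_mem _

-- Induction on the degree: modulo E, an element of degree m is a combination of elements of lower
-- degree with coefficients of positive degree. Degrees are natural numbers, so no finiteness is
-- needed.
include GA hε GK hK in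
theorem mem_genDeg (hA : GradedSMulMem 𝒜 𝒜) (h1 : (1 : A) ∈ 𝒜 0) {E : AddSubgroup K} {e : ℕ}
    (hE : E ≤ 𝒦 e) (hgen : ∀ k : K, ∃ k' ∈ E, k - k' ∈ augMul ε K) {m : ℕ} {k : K}
    (hk : k ∈ 𝒦 m) : k ∈ genDeg 𝒜 E e m := by
  induction m using Nat.strong_induction_on generalizing k with
  | _ m ih =>
    obtain ⟨k', hk', hkk'⟩ := hgen k
    have h2 : k = GK.π m k' + GK.π m (k - k') := by rw [map_sub, GK.π_same hk]; abel
    rw [h2]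
    refine add_mem ?_ ?_
    · rw [GK.π_of_mem (hE hk')]
      split_ifs with h
      · exact AddSubgroup.subset_closure
          ⟨0, 1, k', by rw [zero_add, h], h1, hk', (one_smul A k').symm⟩
      · exact zero_mem _
    · refine (AddSubgroup.closure_le _).mpr ?_ (π_mem_closure_of_mem_augMul GA hε GK hK m hkk')
      rintro _ ⟨p, l, x, y, hp, hpl, hx, hy, rfl⟩
      subst hpl
      exact smul_mem_genDeg hA hx (ih l (by omega) hy)

end Nakayama

section Comparison

open GroupGrading GrMod

variable {A : Type a} [Ring A] {S : Type c} [Ring S] {ε : A →+* S} (φ : S →+* A)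
  (hφ : ∀ s, ε (φ s) = s) {𝒜 : ℕ → AddSubgroup A} (GA : GroupGrading 𝒜)
  (hA : GradedSMulMem 𝒜 𝒜) (hε : ∀ x, ε x = 0 → GA.π 0 x = 0) (hφ0 : ∀ s, φ s ∈ 𝒜 0)
  {N : GrMod A} (GN : GroupGrading N.deg) (hN : GradedSMulMem 𝒜 N.deg)
  {P₀ : Type a} [AddCommGroup P₀] [Module A P₀] [Module.Projective A P₀]
  {𝒦₀ : ℕ → AddSubgroup P₀} (G₀ : GroupGrading 𝒦₀) (h₀ : GradedSMulMem 𝒜 𝒦₀)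
  {P₁ : Type a} [AddCommGroup P₁] [Module A P₁] [Module.Projective A P₁]
  {𝒦₁ : ℕ → AddSubgroup P₁} (G₁ : GroupGrading 𝒦₁) (h₁ : GradedSMulMem 𝒜 𝒦₁)
  {P₂ : Type a} [AddCommGroup P₂] [Module A P₂] [Module.Projective A P₂]
  {𝒦₂ : ℕ → AddSubgroup P₂} (G₂ : GroupGrading 𝒦₂) (h₂ : GradedSMulMem 𝒜 𝒦₂)
  (p₀ : P₀ →ₗ[A] N) (hp₀ : ∀ k x, x ∈ 𝒦₀ k → p₀ x ∈ N.deg k) (hs₀ : Function.Surjective p₀)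
  (p₁ : P₁ →ₗ[A] LinearMap.ker p₀) (hp₁ : ∀ k x, x ∈ 𝒦₁ k → (p₁ x).1 ∈ 𝒦₀ k)
  (hs₁ : Function.Surjective p₁)
  (p₂ : P₂ →ₗ[A] LinearMap.ker p₁) (hp₂ : ∀ k x, x ∈ 𝒦₂ k → (p₂ x).1 ∈ 𝒦₁ k)
  (hs₂ : Function.Surjective p₂) (hK : ∀ x : LinearMap.ker p₂, x.1 ∈ augMul ε P₂)

include hφ hε hφ0 GA hA GN hN G₀ h₀ G₁ h₁ G₂ h₂ hp₀ hs₀ hp₁ hs₁ hp₂ hs₂ hK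

theorem mem_genDeg_of_component_eq_top {m : ℕ}
    (hTor : GrTor.component 𝒜 (AugMod ε) (AugMod.deg ε) N 3 m = ⊤) {k : ℕ}
    {x : LinearMap.ker p₂} (hx : x.1 ∈ 𝒦₂ k) :
    x ∈ genDeg 𝒜 ((𝒦₂ m).comap (LinearMap.ker p₂).subtype.toAddMonoidHom) m k := by
  obtain ⟨f, F, g, h, hF, hg, hgf⟩ := exists_resolution_comparison GA hA GN hN G₀ h₀ G₁ h₁ G₂ h₂
    p₀ hp₀ hs₀ p₁ hp₁ hs₁ p₂ hp₂ hs₂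
  have GS := syzygiesGrading GA hA GN hN 3
  exact mem_genDeg GA hε (kerGrading G₂ (kerGrading G₁ (kerGrading G₀ GN p₀ hp₀) p₁ hp₁) p₂ hp₂)
    (comap_smulMem h₂ _) hA (φ.map_one ▸ hφ0 1) le_rfl
    (exists_sub_mem_augMul φ hφ N f F hF g h hgf GS.1 hK
      (fun k => (𝒦₂ k).comap (LinearMap.ker p₂).subtype.toAddMonoidHom)
      hg (comap_smulMem h₂ _) GS.2 hφ0 hTor) hx

theorem eq_zero_of_subsingleton_grTor (hTor : Subsingleton (GrTor 𝒜 (AugMod ε) N 3)) {k : ℕ}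
    {x : LinearMap.ker p₂} (hx : x.1 ∈ 𝒦₂ k) : x = 0 := by
  obtain ⟨f, F, g, h, hF, hg, hgf⟩ := exists_resolution_comparison GA hA GN hN G₀ h₀ G₁ h₁ G₂ h₂
    p₀ hp₀ hs₀ p₁ hp₁ hs₁ p₂ hp₂ hs₂
  have GS := syzygiesGrading GA hA GN hN 3
  have h1 := mem_augMul_of_subsingleton φ hφ N f F hF g h hgf GS.1 hK hTor
  -- Nakayama with no generators at all; the degree assigned to E = ⊥ is immaterial.
  have h2 := mem_genDeg (e := 0) GA hε
    (kerGrading G₂ (kerGrading G₁ (kerGrading G₀ GN p₀ hp₀) p₁ hp₁) p₂ hp₂)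
    (comap_smulMem h₂ _) hA (φ.map_one ▸ hφ0 1) bot_le
    (fun k => ⟨0, zero_mem _, by rw [sub_zero]; exact h1 k⟩) hx
  rw [← AddSubgroup.mem_bot]
  refine (AddSubgroup.closure_le _).mpr ?_ h2
  rintro _ ⟨p, a, y, -, -, hy, rfl⟩
  rw [AddSubgroup.mem_bot.mp hy, smul_zero]
  exact zero_mem _

end Comparison

/-! ### Minimality of the resolution and the kernel of A⊗R → A⊗V. -/

namespace QuotRing

open TensorRing GroupGrading GrMod

variable {S : Type u} [Ring S] {V : Type v} [AddCommGroup V] [Module S V] [Module Sᵐᵒᵖ V]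
  [SMulCommClass S Sᵐᵒᵖ V] {R : SubBimod S (TensorRing S V)} {n : ℕ}
  (hR : ∀ x ∈ R, x ∈ TensorRing.homog S V n)
  (hε : ∀ x ∈ R, TensorRing.augmentation S V x = 0)
  {σ : V →ₗ[S] V →₀ S} (hσ : ∀ x, Finsupp.linearCombination S id (σ x) = x)
  {σ' : R →ₗ[S] R →₀ S} (hσ' : ∀ x, Finsupp.linearCombination S id (σ' x) = x)

noncomputable instance : AddCommGroup (LinearMap.ker (res₁ σ hε)) :=
  @Submodule.addCommGroup (QuotRing R) (indMod (scalar R) σ) _ _ _ (LinearMap.ker (res₁ σ hε))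

noncomputable instance : AddCommGroup (LinearMap.ker (res₂ hσ hε σ')) :=
  @Submodule.addCommGroup (QuotRing R) (indMod (scalar R) σ') _ _ _ (LinearMap.ker (res₂ hσ hε σ'))

variable (σ') in
/-- The homogeneous components of the kernel of `res₂`. -/
noncomputable def kerDeg (n k : ℕ) :
    AddSubgroup (LinearMap.ker (res₂ hσ hε σ')) :=
  (indDeg (scalar R) σ' (gradingA R) n k).comap
    (LinearMap.ker (res₂ hσ hε σ')).subtype.toAddMonoidHom

variable (σ') in
/-- The grading of the kernel of `res₂`. -/
noncomputable def kerDegGrading : GroupGrading (kerDeg hε hσ σ' n) :=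
  kerGrading (indGrading σ' (grading hR) gradingA_mul scalar_mem_gradingA n)
    (kerGrading (indGrading σ (grading hR) gradingA_mul scalar_mem_gradingA 1)
      (kerGrading (grading hR) (AugMod.grading (QuotRing.augmentation R hε)) (res₀ hε)
        (res₀_mem hε)) (res₁ σ hε) (res₁_mem hε))
    (res₂ hσ hε σ') (res₂_mem hR hσ hε σ')

omit [SMulCommClass S Sᵐᵒᵖ V] in
theorem augmentation_comp_scalar (s : S) : QuotRing.augmentation R hε (scalar R s) = s :=
  augmentation_scalar s

omit [SMulCommClass S Sᵐᵒᵖ V] in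
theorem π_zero_of_augmentation (x : QuotRing R) (hx : QuotRing.augmentation R hε x = 0) :
    (grading hR).π 0 x = 0 := by
  obtain ⟨t, rfl⟩ := mk_surjective R x
  rw [grading_π_mk, proj_zero_of_augmentation hx, map_zero]

-- R embeds in A⊗V: the derivatives of r have degree n - 1, where T and A agree, so if they vanish
-- in A they vanish in T and r = 0.
include hR hσ in
theorem eq_zero_of_relDeriv_eq_zero (hn : 2 ≤ n) {r : R} (hr : relDeriv R σ r = 0) : r = 0 := by
  obtain ⟨n, rfl⟩ := Nat.exists_eq_add_of_le' hn
  have h0 : TensorRing.proj S V 0 r.1 = 0 := proj_zero_of_augmentation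
    (by rw [← proj_same (hR r.1 r.2), augmentation_proj (by omega)])
  have h1 : deriv σ r.1 = 0 := Finsupp.ext fun v => by
    have h2 := deriv_mem_homog σ (m := n + 1) (hR r.1 r.2) v
    rw [← proj_same h2]
    refine proj_eq_zero_of_mem_span hR (mk_eq_zero.mp ?_) (Nat.lt_succ_self _)
    exact DFunLike.congr_fun hr v
  refine Subtype.ext ?_
  rw [← linearCombination_deriv hσ h0, h1, map_zero]
  rfl

-- A⊗R is zero below degree n and is 1⊗R in degree n, and R embeds in A⊗V.
include hR in
theorem kerDeg_eq_zero (hn : 2 ≤ n) {k : ℕ} (hk : k ≤ n) {x : LinearMap.ker (res₂ hσ hε σ')}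
    (hx : x ∈ kerDeg hε hσ σ' n k) : x = 0 := by
  have hx' : ∀ r, x.1.1 r ∈ (if n ≤ k then gradingA R (k - n) else ⊥ : AddSubgroup _) := hx
  have hs : ∀ r, ∃ s, x.1.1 r = scalar R s := fun r => by
    have h := hx' r
    split_ifs at h with h1
    · rw [Nat.sub_eq_zero_of_le hk] at h
      obtain ⟨t, ht, h⟩ := h
      obtain ⟨s, rfl⟩ := exists_scalar_of_mem_homog_zero ht
      exact ⟨s, h.symm⟩
    · exact ⟨0, by rw [map_zero]; exact h⟩
  choose s hs using hs
  -- With scalar coefficients x is 1 ⊗ Σ s_r r, and this sum is a relation with zero image in A⊗V.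
  have h1 : ∑ r ∈ x.1.1.support, s r • r = 0 := by
    refine eq_zero_of_relDeriv_eq_zero hR hσ hn ?_
    have h2 : Finsupp.linearCombination (QuotRing R) (relDeriv R σ) x.1.1 = 0 :=
      congrArg (fun z => z.1.1) (LinearMap.mem_ker.mp x.2)
    rw [map_sum, ← h2, Finsupp.linearCombination_apply]
    exact Finset.sum_congr rfl fun r _ => by rw [relDeriv_smul hε, hs]
  refine Subtype.ext (Subtype.ext ?_)
  have h3 := mem_indMod.mp x.1.2
  rw [indProj, Finsupp.linearCombination_apply] at h3
  rw [← h3]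
  have h4 : ∑ r ∈ x.1.1.support, indLift (scalar R) σ' (s r • r) = 0 := by
    rw [← map_sum, h1, map_zero]
  exact Eq.trans (Finset.sum_congr rfl fun r _ => by dsimp only; rw [indLift_smul, hs]) h4

omit [SMulCommClass S Sᵐᵒᵖ V] in
include hσ' in
theorem mem_augMul_of_mem_indDeg {k : ℕ} (hk : n < k) {x : indMod (scalar R) σ'}
    (hx : x ∈ indDeg (scalar R) σ' (gradingA R) n k) :
    x ∈ augMul (QuotRing.augmentation R hε) (indMod (scalar R) σ') := by
  have h : x = ∑ r ∈ x.1.support, x.1 r • (⟨indLift (scalar R) σ' r, indLift_mem_indMod hσ' r⟩ :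
      indMod (scalar R) σ') := by
    refine Subtype.ext ?_
    rw [AddSubmonoidClass.coe_finsetSum]
    exact (mem_indMod.mp x.2).symm.trans (Finsupp.linearCombination_apply _ _)
  rw [h]
  refine sum_mem fun r _ => smul_mem_augMul ?_ _
  have h1 := hx r
  rw [if_pos hk.le] at h1
  exact augmentation_of_mem hε (Nat.sub_ne_zero_of_lt hk) h1

-- Minimality: the kernel lives in degrees above n, where all coefficients of an element of A⊗R lie
-- in A_+.
include hσ' hR in
theorem mem_augMul_of_mem_ker (hn : 2 ≤ n) (x : LinearMap.ker (res₂ hσ hε σ')) :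
    x.1 ∈ augMul (QuotRing.augmentation R hε) (indMod (scalar R) σ') := by
  obtain ⟨M, hM⟩ := (kerDegGrading hR hε hσ σ').exists_sum x
  rw [← hM, AddSubmonoidClass.coe_finsetSum]
  refine sum_mem fun k _ => ?_
  have h := (kerDegGrading hR hε hσ σ').π_mem k x
  rcases le_or_gt k n with hk | hk
  · rw [kerDeg_eq_zero hR hε hσ hn hk h]
    exact zero_mem _
  · exact mem_augMul_of_mem_indDeg hε hσ' hk h

include hR hσ' in
theorem eq_zero_of_subsingleton_tor (hn : 2 ≤ n) (hTor : Subsingleton (TorSS R hε 3)) {k : ℕ}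
    {x : LinearMap.ker (res₂ hσ hε σ')} (hx : x ∈ kerDeg hε hσ σ' n k) : x = 0 :=
  have := projective_indMod (φ := scalar R) hσ
  have := projective_indMod (φ := scalar R) hσ'
  eq_zero_of_subsingleton_grTor (scalar R) (augmentation_comp_scalar hε) (grading hR) gradingA_mul
    (π_zero_of_augmentation hR hε) scalar_mem_gradingA (N := gradedS R hε)
    (AugMod.grading (QuotRing.augmentation R hε)) (gradedS_smulMem hε)
    (grading hR) gradingA_mul
    (indGrading σ (grading hR) gradingA_mul scalar_mem_gradingA 1) (indDeg_smulMem gradingA_mul 1)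
    (indGrading σ' (grading hR) gradingA_mul scalar_mem_gradingA n) (indDeg_smulMem gradingA_mul n)
    (res₀ hε) (res₀_mem hε) (res₀_surjective hε)
    (res₁ σ hε) (res₁_mem hε) (res₁_surjective hσ hε)
    (res₂ hσ hε σ') (res₂_mem hR hσ hε σ') (res₂_surjective hσ hε hσ')
    (mem_augMul_of_mem_ker hR hε hσ hσ' hn) hTor hx

include hR hσ' in
theorem mem_genDeg_of_pure (hn : 2 ≤ n) (hTor : TorSSIsPure R hε 3 (n + 1)) {k : ℕ}
    {x : LinearMap.ker (res₂ hσ hε σ')} (hx : x ∈ kerDeg hε hσ σ' n k) :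
    x ∈ genDeg (gradingA R) (kerDeg hε hσ σ' n (n + 1)) (n + 1) k :=
  have := projective_indMod (φ := scalar R) hσ
  have := projective_indMod (φ := scalar R) hσ'
  mem_genDeg_of_component_eq_top (scalar R) (augmentation_comp_scalar hε) (grading hR) gradingA_mul
    (π_zero_of_augmentation hR hε) scalar_mem_gradingA (N := gradedS R hε)
    (AugMod.grading (QuotRing.augmentation R hε)) (gradedS_smulMem hε)
    (grading hR) gradingA_mul
    (indGrading σ (grading hR) gradingA_mul scalar_mem_gradingA 1) (indDeg_smulMem gradingA_mul 1)
    (indGrading σ' (grading hR) gradingA_mul scalar_mem_gradingA n) (indDeg_smulMem gradingA_mul n)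
    (res₀ hε) (res₀_mem hε) (res₀_surjective hε)
    (res₁ σ hε) (res₁_mem hε) (res₁_surjective hσ hε)
    (res₂ hσ hε σ') (res₂_mem hR hσ hε σ') (res₂_surjective hσ hε hσ')
    (mem_augMul_of_mem_ker hR hε hσ hσ' hn) hTor hx

end QuotRing
-- The visible filtration of the ideal generated by P.
namespace TensorRing

variable {S : Type u} [Ring S] {V : Type v} [AddCommGroup V] [Module S V] [Module Sᵐᵒᵖ V]

/-- The part of the ideal `⟨P⟩`, for `P ⊆ T^{≤ n}`, that is visibly contained in `T^{≤ m}`: the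
subgroup `∑ T^i P T^j` over `i + n + j ≤ m`. -/
def relFilt (n : ℕ) (P : SubBimod S (TensorRing S V)) (m : ℕ) : AddSubgroup (TensorRing S V) :=
  AddSubgroup.closure {z | ∃ (i j : ℕ) (x p y : TensorRing S V), x ∈ homog S V i ∧ p ∈ P ∧
    y ∈ homog S V j ∧ i + n + j ≤ m ∧ z = x * p * y}

/-- The subgroup of `T` generated by the products of elements of `relFilt n P m` and `V`. -/
def relFiltMulι (n : ℕ) (P : SubBimod S (TensorRing S V)) (m : ℕ) : AddSubgroup (TensorRing S V) :=
  AddSubgroup.closure {z | ∃ w ∈ relFilt n P m, ∃ v : V, z = w * ι S V v}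

variable {n : ℕ} {P : SubBimod S (TensorRing S V)}

theorem mul_mul_mem_relFilt {i j m : ℕ} {x p y : TensorRing S V} (hx : x ∈ homog S V i)
    (hp : p ∈ P) (hy : y ∈ homog S V j) (h : i + n + j ≤ m) : x * p * y ∈ relFilt n P m :=
  AddSubgroup.subset_closure ⟨i, j, x, p, y, hx, hp, hy, h, rfl⟩

theorem mul_mem_relFilt_of_mem {i m : ℕ} {x p : TensorRing S V} (hx : x ∈ homog S V i)
    (hp : p ∈ P) (h : i + n ≤ m) : x * p ∈ relFilt n P m := by
  have := mul_mul_mem_relFilt hx hp one_mem_homog h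
  rwa [mul_one] at this

theorem mem_relFilt_of_mem {m : ℕ} {p : TensorRing S V} (hp : p ∈ P) (h : n ≤ m) :
    p ∈ relFilt n P m := by
  have := mul_mem_relFilt_of_mem (n := n) (m := m) one_mem_homog hp (by omega)
  rwa [one_mul] at this

theorem relFilt_mono {m m' : ℕ} (h : m ≤ m') : relFilt n P m ≤ relFilt n P m' := by
  refine AddSubgroup.closure_mono ?_
  rintro _ ⟨i, j, x, p, y, hx, hp, hy, hm, rfl⟩
  exact ⟨i, j, x, p, y, hx, hp, hy, hm.trans h, rfl⟩

theorem mul_mem_relFilt {i m : ℕ} {x z : TensorRing S V} (hx : x ∈ homog S V i)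
    (hz : z ∈ relFilt n P m) : x * z ∈ relFilt n P (i + m) := by
  rw [← mul_one (x * z)]
  refine mul_mem_of_mem_closure hz ?_
  rintro _ ⟨k, j, t, p, y, ht, hp, hy, hm, rfl⟩
  rw [mul_one, ← mul_assoc, ← mul_assoc]
  exact mul_mul_mem_relFilt (homog_mul hx ht) hp hy (by omega)

theorem mem_relFilt_mul {j m : ℕ} {y z : TensorRing S V} (hy : y ∈ homog S V j)
    (hz : z ∈ relFilt n P m) : z * y ∈ relFilt n P (m + j) := by
  rw [← one_mul z]
  refine mul_mem_of_mem_closure hz ?_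
  rintro _ ⟨i, k, x, p, t, hx, hp, ht, hm, rfl⟩
  rw [one_mul, mul_assoc]
  exact mul_mul_mem_relFilt hx hp (homog_mul ht hy) (by omega)

theorem relFiltMulι_mono {m m' : ℕ} (h : m ≤ m') : relFiltMulι n P m ≤ relFiltMulι n P m' := by
  refine AddSubgroup.closure_mono ?_
  rintro _ ⟨w, hw, v, rfl⟩
  exact ⟨w, relFilt_mono h hw, v, rfl⟩

theorem mul_mem_relFiltMulι {i m : ℕ} {x z : TensorRing S V} (hx : x ∈ homog S V i)
    (hz : z ∈ relFiltMulι n P m) : x * z ∈ relFiltMulι n P (i + m) := by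
  rw [← mul_one (x * z)]
  refine mul_mem_of_mem_closure hz ?_
  rintro _ ⟨w, hw, v, rfl⟩
  rw [mul_one, ← mul_assoc]
  exact AddSubgroup.subset_closure ⟨_, mul_mem_relFilt hx hw, v, rfl⟩

theorem mul_homog_mem_relFiltMulι {m j : ℕ} {w y : TensorRing S V} (hw : w ∈ relFilt n P m)
    (hy : y ∈ homog S V (j + 1)) : w * y ∈ relFiltMulι n P (m + j) := by
  rw [← mul_one (w * y)]
  refine mul_mem_of_mem_closure (mem_closure_of_mem_homog_succ hy) ?_
  rintro _ ⟨t, ht, v, rfl⟩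
  rw [mul_one, ← mul_assoc]
  exact AddSubgroup.subset_closure ⟨_, mem_relFilt_mul ht hw, v, rfl⟩

theorem relFilt_le_filt (hP : ∀ p ∈ P, p ∈ filt S V n) (m : ℕ) :
    relFilt n P m ≤ (filt S V m).toAddSubgroup := by
  refine (AddSubgroup.closure_le _).mpr ?_
  rintro _ ⟨i, j, x, p, y, hx, hp, hy, hm, rfl⟩
  exact filt_mono hm (filt_mul (filt_mul (homog_le_filt le_rfl hx) (hP p hp))
    (homog_le_filt le_rfl hy))

/-- The top component of x p y is that of x p^n(p) y. Hence the PBW property follows once every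
element of ⟨P⟩ ∩ T^{≤m} is known to be in `relFilt n P m`. -/
theorem proj_mem_span_of_mem_relFilt (hP : ∀ p ∈ P, p ∈ filt S V n) {m : ℕ} {z : TensorRing S V}
    (hz : z ∈ relFilt n P m) :
    proj S V m z ∈ TwoSidedIdeal.span (pureRel n P : Set (TensorRing S V)) := by
  induction hz using AddSubgroup.closure_induction with
  | mem z hz =>
    obtain ⟨i, j, x, p, y, hx, hp, hy, hm, rfl⟩ := hz
    rcases hm.lt_or_eq with hm | rfl
    · rw [proj_eq_zero (filt_mul (filt_mul (homog_le_filt le_rfl hx) (hP p hp))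
        (homog_le_filt le_rfl hy)) hm]
      exact zero_mem _
    · rw [proj_mul_right hy, proj_mul_left hx]
      exact TwoSidedIdeal.mul_mem_right _ _ _ (TwoSidedIdeal.mul_mem_left _ _ _
        (TwoSidedIdeal.subset_span (proj_mem_pureRel hp)))
  | zero => rw [proj_zero]; exact zero_mem _
  | add x y _ _ hx hy => rw [proj_add]; exact add_mem hx hy
  | neg x _ hx => rw [proj_neg]; exact neg_mem hx

/-- Replace each relation p^n(p) by p itself: this changes only lower components. -/
theorem exists_mem_relFilt_proj_eq {g : TensorRing S V}
    (hg : g ∈ TwoSidedIdeal.span (pureRel n P : Set (TensorRing S V))) (m : ℕ) :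
    ∃ z ∈ relFilt n P m, proj S V m z = proj S V m g := by
  have h := mem_closure_of_mem_span hg
  clear hg
  induction h using AddSubgroup.closure_induction with
  | mem z hz =>
    obtain ⟨i, j, x, y, _, ⟨p, hp, rfl⟩, hx, hy, rfl⟩ := hz
    by_cases hm : i + n + j = m
    · subst hm
      refine ⟨x * p * y, mul_mul_mem_relFilt hx hp hy le_rfl, ?_⟩
      rw [proj_mul_right hy, proj_mul_left hx, proj_mul_right hy, proj_mul_left hx]
      exact congrArg (fun t => x * t * y) (proj_same (proj_mem n p)).symm
    · refine ⟨0, zero_mem _, ?_⟩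
      rw [proj_zero]
      exact (proj_ne (homog_mul (homog_mul hx (proj_mem n p)) hy) hm).symm
  | zero => exact ⟨0, zero_mem _, rfl⟩
  | add x y _ _ hx hy =>
    obtain ⟨⟨x', hx', hx⟩, ⟨y', hy', hy⟩⟩ := And.intro hx hy
    exact ⟨x' + y', add_mem hx' hy', by rw [proj_add, hx, hy, proj_add]⟩
  | neg x _ hx =>
    obtain ⟨x', hx', hx⟩ := hx
    exact ⟨-x', neg_mem hx', by rw [proj_neg, hx, proj_neg]⟩

theorem exists_mem_relFilt {t : TensorRing S V}
    (ht : t ∈ TwoSidedIdeal.span (P : Set (TensorRing S V))) (n : ℕ) :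
    ∃ m, t ∈ relFilt n P m := by
  have h := mem_closure_of_mem_span ht
  clear ht
  induction h using AddSubgroup.closure_induction with
  | mem z hz =>
    obtain ⟨i, j, x, y, p, hp, hx, hy, rfl⟩ := hz
    exact ⟨_, mul_mul_mem_relFilt hx hp hy le_rfl⟩
  | zero => exact ⟨0, zero_mem _⟩
  | add x y _ _ hx hy =>
    obtain ⟨⟨i, hx⟩, ⟨j, hy⟩⟩ := And.intro hx hy
    exact ⟨max i j, add_mem (relFilt_mono (le_max_left _ _) hx) (relFilt_mono (le_max_right _ _) hy)⟩
  | neg x _ hx => exact ⟨hx.choose, neg_mem hx.choose_spec⟩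

theorem proj_mem_span_of_mem_relFiltMulι (hP : ∀ p ∈ P, p ∈ filt S V n) {m : ℕ}
    {z : TensorRing S V} (hz : z ∈ relFiltMulι n P m) :
    proj S V (m + 1) z ∈ AddSubgroup.closure {z | ∃ w ∈ TwoSidedIdeal.span
      (pureRel n P : Set (TensorRing S V)), ∃ v : V, z = w * ι S V v} := by
  induction hz using AddSubgroup.closure_induction with
  | mem z hz =>
    obtain ⟨w, hw, v, rfl⟩ := hz
    rw [proj_mul_right (ι_mem_homog v)]
    exact AddSubgroup.subset_closure ⟨_, proj_mem_span_of_mem_relFilt hP hw, v, rfl⟩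
  | zero => rw [proj_zero]; exact zero_mem _
  | add x y _ _ hx hy => rw [proj_add]; exact add_mem hx hy
  | neg x _ hx => rw [proj_neg]; exact neg_mem hx

/-- For w x with x in V the derivative is w times scalars, and right multiplication by scalars does
not raise the filtration. -/
theorem deriv_mem_relFilt [SMulCommClass S Sᵐᵒᵖ V] (σ : V →ₗ[S] V →₀ S) {m : ℕ}
    {z : TensorRing S V} (hz : z ∈ relFiltMulι n P m) (v : V) : deriv σ z v ∈ relFilt n P m := by
  induction hz using AddSubgroup.closure_induction with
  | mem z hz =>
    obtain ⟨w, hw, x, rfl⟩ := hz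
    rw [deriv_mul_ι]
    exact mem_relFilt_mul (j := 0) (y := scalar S V (σ x v)) (scalar_mem_homog _) hw
  | zero => rw [map_zero (deriv σ), Finsupp.zero_apply]; exact zero_mem _
  | add x y _ _ hx hy => rw [map_add (deriv σ), Finsupp.add_apply]; exact add_mem hx hy
  | neg x _ hx => rw [map_neg (deriv σ), Finsupp.neg_apply]; exact neg_mem hx

theorem proj_zero_of_mem_relFiltMulι {m : ℕ} {z : TensorRing S V} (hz : z ∈ relFiltMulι n P m) :
    proj S V 0 z = 0 := by
  induction hz using AddSubgroup.closure_induction with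
  | mem z hz =>
    obtain ⟨w, hw, v, rfl⟩ := hz
    exact proj_zero_mul_ι _ _
  | zero => exact proj_zero 0
  | add x y _ _ hx hy => rw [proj_add, hx, hy, add_zero]
  | neg x _ hx => rw [proj_neg, hx, neg_zero]

/-- Reduction of elements `∑ w x`, `w ∈ relFilt n P m`, `x ∈ V`, of `T^{≤ m}`. -/
theorem mem_relFilt_of_mem_relFiltMulι [SMulCommClass S Sᵐᵒᵖ V] {σ : V →ₗ[S] V →₀ S}
    (hσ : ∀ x, Finsupp.linearCombination S id (σ x) = x) {m : ℕ}
    (ih : ∀ k < m, ∀ u ∈ relFilt n P (k + 1), u ∈ filt S V k → u ∈ relFilt n P k)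
    {z : TensorRing S V} (hz : z ∈ relFiltMulι n P m) (hzm : z ∈ filt S V m) :
    z ∈ relFilt n P m := by
  have h0 := proj_zero_of_mem_relFiltMulι hz
  rw [← linearCombination_deriv hσ h0, Finsupp.linearCombination_apply]
  refine sum_mem fun v _ => ?_
  cases m with
  | zero =>
    rw [← proj_same (mem_homog_zero_of_mem_filt hzm), h0, map_zero (deriv σ), Finsupp.zero_apply]
    dsimp only
    rw [zero_smul]
    exact zero_mem _
  | succ m =>
    -- Stripping the last letter lowers the degree by one, so each coefficient is in `relFilt n P (m
    -- + 1)` and in T^{≤m}; the induction hypothesis lowers its filtration, and multiplying by the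
    -- letter restores it.
    refine mem_relFilt_mul (ι_mem_homog v) (ih m (Nat.lt_succ_self m) _ (deriv_mem_relFilt σ hz v) ?_)
    rw [sum_proj hzm, map_sum, Finsupp.finsetSum_apply]
    refine sum_mem fun k hk => ?_
    rcases k with _ | k
    · rw [h0, map_zero]; exact zero_mem _
    · exact homog_le_filt (by have := Finset.mem_range.mp hk; omega)
        (deriv_mem_homog σ (proj_mem _ z) v)

end TensorRing
-- The map T⊗R → T given by α, modulo lower filtration.
namespace TensorRing

variable (S : Type u) [Ring S] (V : Type v) [AddCommGroup V] [Module S V] [Module Sᵐᵒᵖ V]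

/-- The homogeneous components of `T`, as subgroups. -/
def deg (k : ℕ) : AddSubgroup (TensorRing S V) := (homog S V k).toAddSubgroup

variable {S V}

theorem deg_smulMem : GradedSMulMem (deg S V) (deg S V) := fun _ _ _ _ hx hy => homog_mul hx hy

theorem scalar_mem_deg (s : S) : scalar S V s ∈ deg S V 0 := scalar_mem_homog s

end TensorRing

open TensorRing GroupGrading

section

variable {S : Type u} [Ring S] {V : Type v} [AddCommGroup V] [Module S V] [Module Sᵐᵒᵖ V]

/-- The map `T ⊗ R → T`, `t ⊗ r ↦ t f(r)`. -/
noncomputable def BimodHom.extend {R : SubBimod S (TensorRing S V)}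
    (f : BimodHom S R (TensorRing S V)) :
    (R →₀ TensorRing S V) →ₗ[TensorRing S V] TensorRing S V :=
  Finsupp.linearCombination (TensorRing S V) f

theorem BimodHom.extend_apply {R : SubBimod S (TensorRing S V)}
    (f : BimodHom S R (TensorRing S V)) (y : R →₀ TensorRing S V) :
    f.extend y = y.sum fun r t => t * f r := Finsupp.linearCombination_apply _ _

theorem BimodHom.extend_indProj {R : SubBimod S (TensorRing S V)}
    (f : BimodHom S R (TensorRing S V)) {σ' : R →ₗ[S] R →₀ S}
    (hσ' : ∀ x, Finsupp.linearCombination S id (σ' x) = x) (y : R →₀ TensorRing S V) :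
    f.extend (indProj (scalar S V) σ' y) = f.extend y :=
  linearCombination_indProj (φ := scalar S V) hσ' f.toLinearMap.toAddMonoidHom
    (fun s x => f.toLinearMap.map_smul s x) y

theorem indProj_mapRange_mk {R : SubBimod S (TensorRing S V)} (σ' : R →ₗ[S] R →₀ S)
    (y : R →₀ TensorRing S V) :
    indProj (QuotRing.scalar R) σ' (y.mapRange (QuotRing.mk R) (map_zero _)) =
      (indProj (scalar S V) σ' y).mapRange (QuotRing.mk R) (map_zero _) := by
  induction y using Finsupp.induction_linear with
  | zero => simp
  | add y z hy hz =>
    rw [Finsupp.mapRange_add (fun x y => map_add (QuotRing.mk R) x y), map_add, map_add, hy, hz,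
      Finsupp.mapRange_add (fun x y => map_add (QuotRing.mk R) x y)]
  | single r t =>
    rw [Finsupp.mapRange_single, indProj, indProj, Finsupp.linearCombination_single,
      Finsupp.linearCombination_single]
    refine Finsupp.ext fun i => ?_
    exact (map_mul (QuotRing.mk R) _ _).symm

variable {n : ℕ} {P : SubBimod S (TensorRing S V)} (α : FilteredMap (pureRel n P))
  (hα : P = SubBimod.range α.toBimodHom)

include hα in
theorem FilteredMap.apply_mem (r : pureRel n P) : α.toBimodHom r ∈ P := by
  have h : α.toBimodHom r ∈ SubBimod.range α.toBimodHom := ⟨r, rfl⟩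
  rwa [← hα] at h

include hα in
theorem FilteredMap.exists_apply_eq {p : TensorRing S V} (hp : p ∈ P) :
    ∃ r, α.toBimodHom r = p := by
  rw [hα] at hp
  exact hp

theorem FilteredMap.proj_extend {m : ℕ} {y : pureRel n P →₀ TensorRing S V}
    (hy : y ∈ finsuppDeg (deg S V) (fun _ => n) m) :
    proj S V m (α.toBimodHom.extend y) = (pureRel n P).incl.extend y := by
  rw [BimodHom.extend_apply, BimodHom.extend_apply]
  refine (map_sum (proj S V m).toLinearMap _ _).trans (Finset.sum_congr rfl fun r _ => ?_)
  have h := hy r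
  split_ifs at h with h1
  · have h2 := proj_mul_left h n (α.toBimodHom r)
    rw [Nat.sub_add_cancel h1, α.proj_apply (pureRel_mem_homog n P)] at h2
    exact h2
  · have h2 : y r = 0 := h
    rw [h2]
    exact (congrArg (proj S V m) (zero_mul _)).trans ((proj_zero m).trans (zero_mul _).symm)

include hα in
/-- The elements of `relFilt n P (m + 1)` modulo those of `relFilt n P m`. -/
theorem exists_of_mem_relFilt_succ {m : ℕ} {u : TensorRing S V} (hu : u ∈ relFilt n P (m + 1)) :
    ∃ u' ∈ relFilt n P m, ∃ y ∈ finsuppDeg (deg S V) (fun _ : pureRel n P => n) (m + 1),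
      ∃ w ∈ relFiltMulι n P m, u = u' + α.toBimodHom.extend y + w := by
  induction hu using AddSubgroup.closure_induction with
  | mem z hz =>
    obtain ⟨i, j, x, p, y, hx, hp, hy, hm, rfl⟩ := hz
    rcases hm.lt_or_eq with hm | hm
    · exact ⟨_, mul_mul_mem_relFilt hx hp hy (by omega), 0, zero_mem _, 0, zero_mem _,
        by rw [map_zero, add_zero, add_zero]⟩
    -- At the exact level m + 1 a scalar right factor is absorbed into P = α(R), which contributes
    -- to y; otherwise the last letter splits off, which contributes to w.
    · rcases j with _ | j
      · obtain ⟨s, rfl⟩ := exists_scalar_of_mem_homog_zero hy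
        obtain ⟨r, hr⟩ := FilteredMap.exists_apply_eq α hα (SubBimod.mul_scalar_mem hp s)
        refine ⟨0, zero_mem _, Finsupp.single r x, ?_, 0, zero_mem _, ?_⟩
        · intro r'
          have hi : m + 1 - n = i := by omega
          rw [if_pos (show n ≤ m + 1 by omega), hi]
          by_cases h : r = r'
          · rw [← h, Finsupp.single_eq_same]
            exact hx
          · rw [Finsupp.single_eq_of_ne (Ne.symm h)]
            exact zero_mem _
        · rw [BimodHom.extend, Finsupp.linearCombination_single, hr, zero_add, add_zero, mul_assoc]
          rfl
      · refine ⟨0, zero_mem _, 0, zero_mem _, x * p * y, ?_, by rw [map_zero, zero_add, zero_add]⟩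
        obtain rfl : m = i + n + j := by omega
        exact mul_homog_mem_relFiltMulι (mul_mem_relFilt_of_mem hx hp le_rfl) hy
  | zero => exact ⟨0, zero_mem _, 0, zero_mem _, 0, zero_mem _,
      by rw [map_zero, add_zero, add_zero]⟩
  | add x x' _ _ hx hx' =>
    obtain ⟨u, hu, y, hy, w, hw, rfl⟩ := hx
    obtain ⟨u', hu', y', hy', w', hw', rfl⟩ := hx'
    exact ⟨u + u', add_mem hu hu', y + y', add_mem hy hy', w + w', add_mem hw hw',
      by rw [map_add]; abel⟩
  | neg x _ hx =>
    obtain ⟨u, hu, y, hy, w, hw, rfl⟩ := hx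
    exact ⟨-u, neg_mem hu, -y, neg_mem hy, -w, neg_mem hw, by rw [map_neg]; abel⟩

-- The case of two relations without overlap. Write g as the top part of some z in `relFilt n P i`.
-- Then (z - g) α(r) has a left factor of degree below i and is of lower filtration. In z α(r) the
-- lower terms of α(r) are of lower filtration too, while the term z r of top degree ends in a
-- letter, as n > 0.
include hα in
theorem mul_apply_mem_of_mem_span (hP : ∀ p ∈ P, p ∈ filt S V n) (hn : n ≠ 0) {i m : ℕ}
    (him : i + n = m + 1) {g : TensorRing S V}
    (hg : g ∈ TwoSidedIdeal.span (pureRel n P : Set (TensorRing S V))) (hgi : g ∈ homog S V i)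
    (r : pureRel n P) : g * α.toBimodHom r ∈ relFilt n P m ⊔ relFiltMulι n P m := by
  obtain ⟨z, hz, hzg⟩ := exists_mem_relFilt_proj_eq hg i
  rw [proj_same hgi] at hzg
  have hp := FilteredMap.apply_mem α hα r
  have h1 : (z - g) * α.toBimodHom r ∈ relFilt n P m := by
    rw [sum_proj (sub_mem (relFilt_le_filt hP i hz) (homog_le_filt le_rfl hgi)), Finset.sum_mul]
    refine sum_mem fun k hk => ?_
    rcases (Nat.lt_succ_iff.mp (Finset.mem_range.mp hk)).lt_or_eq with hk | rfl
    · exact mul_mem_relFilt_of_mem (proj_mem _ _) hp (by omega)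
    · rw [proj_sub, hzg, proj_same hgi, sub_self, zero_mul]
      exact zero_mem _
  have h2 : z * α.toBimodHom r ∈ relFilt n P m ⊔ relFiltMulι n P m := by
    rw [sum_proj (α.apply_mem_filt (pureRel_mem_homog n P) r), Finset.mul_sum]
    refine sum_mem fun k hk => ?_
    rcases (Nat.lt_succ_iff.mp (Finset.mem_range.mp hk)).lt_or_eq with hk | rfl
    · exact AddSubgroup.mem_sup_left
        (relFilt_mono (by omega) (mem_relFilt_mul (proj_mem _ _) hz))
    · obtain ⟨k, rfl⟩ := Nat.exists_eq_succ_of_ne_zero hn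
      exact AddSubgroup.mem_sup_right
        (relFiltMulι_mono (by omega) (mul_homog_mem_relFiltMulι hz (proj_mem _ _)))
  have h3 : g * α.toBimodHom r = z * α.toBimodHom r - (z - g) * α.toBimodHom r := by
    rw [sub_mul]; abel
  rw [h3]
  exact sub_mem h2 (AddSubgroup.mem_sup_left h1)

variable {σ' : pureRel n P →ₗ[S] pureRel n P →₀ S}
  (hσ' : ∀ x, Finsupp.linearCombination S id (σ' x) = x)

-- Modulo `relFilt n P m` and its products with V, the value Σ y_r α(r) depends only on the class of
-- y in A⊗R: if the class is zero, the coefficients, after applying the idempotent, are in ⟨R⟩.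
include hα hσ' in
theorem extend_mem_of_indProj_eq_zero (hP : ∀ p ∈ P, p ∈ filt S V n) (hn : n ≠ 0) {m : ℕ}
    {y : pureRel n P →₀ TensorRing S V} (hy : y ∈ finsuppDeg (deg S V) (fun _ => n) (m + 1))
    (hy0 : indProj (QuotRing.scalar (pureRel n P)) σ'
      (y.mapRange (QuotRing.mk (pureRel n P)) (map_zero _)) = 0) :
    α.toBimodHom.extend y ∈ relFilt n P m ⊔ relFiltMulι n P m := by
  rw [indProj_mapRange_mk] at hy0
  rw [← BimodHom.extend_indProj _ hσ', BimodHom.extend_apply]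
  have h1 := indProj_mem (σ := σ') (φ := scalar S V) deg_smulMem scalar_mem_deg n (m + 1) y hy
  refine sum_mem fun r _ => ?_
  have h2 := h1 r
  split_ifs at h2 with h3
  · exact mul_apply_mem_of_mem_span α hα hP hn (Nat.sub_add_cancel h3)
      (QuotRing.mk_eq_zero.mp (DFunLike.congr_fun hy0 r)) h2 r
  · dsimp only
    rw [show indProj (scalar S V) σ' y r = 0 from h2, zero_mul]
    exact zero_mem _

end
-- Syzygies and overlaps of relations.
open TensorRing GroupGrading

section

variable {S : Type u} [Ring S] {V : Type v} [AddCommGroup V] [Module S V] [Module Sᵐᵒᵖ V]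
  [SMulCommClass S Sᵐᵒᵖ V]

theorem mkDeriv_extend_incl {R : SubBimod S (TensorRing S V)}
    (hε : ∀ x ∈ R, augmentation S V x = 0) (σ : V →ₗ[S] V →₀ S) (y : R →₀ TensorRing S V) :
    QuotRing.mkDeriv R σ (R.incl.extend y) = Finsupp.linearCombination (QuotRing R)
      (QuotRing.relDeriv R σ) (y.mapRange (QuotRing.mk R) (map_zero _)) := by
  rw [BimodHom.extend_apply, Finsupp.linearCombination_apply,
    Finsupp.sum_mapRange_index (h := fun r a => a • QuotRing.relDeriv R σ r)
      (fun _ => zero_smul _ _), Finsupp.sum, map_sum]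
  exact Finset.sum_congr rfl fun r _ =>
    QuotRing.mkDeriv_mul R σ (y r) (proj_zero_of_augmentation (hε r.1 r.2))

theorem mkDeriv_eq_zero {R : SubBimod S (TensorRing S V)} (σ : V →ₗ[S] V →₀ S)
    {z : TensorRing S V} (hz : z ∈ AddSubgroup.closure {z | ∃ w ∈ TwoSidedIdeal.span
      (R : Set (TensorRing S V)), ∃ v : V, z = w * ι S V v}) : QuotRing.mkDeriv R σ z = 0 := by
  refine (AddSubgroup.closure_le (QuotRing.mkDeriv R σ).ker).mpr ?_ hz
  rintro _ ⟨w, hw, v, rfl⟩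
  change QuotRing.mkDeriv R σ _ = 0
  rw [QuotRing.mkDeriv_mul_ι, QuotRing.mk_eq_zero.mpr hw, zero_smul]

omit [SMulCommClass S Sᵐᵒᵖ V] in
theorem exists_ι_of_mem_homog_one {t : TensorRing S V} (ht : t ∈ homog S V 1) :
    ∃ v, t = ι S V v := by
  have h := mem_closure_of_mem_homog_succ ht
  refine (AddSubgroup.closure_le (ι S V).range).mpr ?_ h |>.imp fun _ => Eq.symm
  rintro _ ⟨t, ht, v, rfl⟩
  obtain ⟨s, rfl⟩ := exists_scalar_of_mem_homog_zero ht
  exact ⟨s • v, ι_smul s v⟩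

omit [SMulCommClass S Sᵐᵒᵖ V] in
theorem map_mk_mem_gradingA {R : SubBimod S (TensorRing S V)} {W : Type w} {d : W → ℕ} {m : ℕ}
    {y : W →₀ TensorRing S V} (hy : y ∈ finsuppDeg (deg S V) d m) :
    y.mapRange (QuotRing.mk R) (map_zero _) ∈ finsuppDeg (gradingA R) d m := by
  intro i
  have h := hy i
  rw [Finsupp.mapRange_apply]
  split_ifs at h ⊢
  · exact ⟨_, h, rfl⟩
  · rw [show y i = 0 from h, map_zero]
    exact zero_mem _

variable {n : ℕ} {P : SubBimod S (TensorRing S V)} (hn : 2 ≤ n)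
  {σ : V →ₗ[S] V →₀ S} (hσ : ∀ x, Finsupp.linearCombination S id (σ x) = x)
  {σ' : pureRel n P →ₗ[S] pureRel n P →₀ S}
  (hσ' : ∀ x, Finsupp.linearCombination S id (σ' x) = x)

-- Elements of ⟨R⟩ V have zero derivative in A⊗V, so a cancellation of leading terms modulo ⟨R⟩ V is
-- a cycle of A⊗R → A⊗V.
include hσ' in
theorem exists_kerDeg_of_extend_incl_mem {m : ℕ} {y : pureRel n P →₀ TensorRing S V}
    (hy : y ∈ finsuppDeg (deg S V) (fun _ => n) m)
    (h : (pureRel n P).incl.extend y ∈ AddSubgroup.closure {z | ∃ w ∈ TwoSidedIdeal.span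
      (pureRel n P : Set (TensorRing S V)), ∃ v : V, z = w * ι S V v}) :
    ∃ x : LinearMap.ker (QuotRing.res₂ hσ (augmentation_pureRel hn P) σ'),
      x ∈ QuotRing.kerDeg (augmentation_pureRel hn P) hσ σ' n m ∧
      x.1.1 = indProj (QuotRing.scalar (pureRel n P)) σ'
        (y.mapRange (QuotRing.mk (pureRel n P)) (map_zero _)) := by
  refine ⟨⟨⟨_, mem_indMod.mpr (indProj_indProj hσ' _)⟩, ?_⟩, ?_, rfl⟩
  · refine LinearMap.mem_ker.mpr (Subtype.ext (Subtype.ext ?_))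
    refine (linearCombination_indProj hσ' (QuotRing.relDeriv (pureRel n P) σ)
      (QuotRing.relDeriv_smul (augmentation_pureRel hn P)) _).trans ?_
    rw [← mkDeriv_extend_incl (augmentation_pureRel hn P), mkDeriv_eq_zero σ h]
    rfl
  · exact indProj_mem QuotRing.gradingA_mul QuotRing.scalar_mem_gradingA n m _
      (map_mk_mem_gradingA hy)

/-- Elements of `ker res₂` of degree `n + 1` come from elements of `X`. -/
theorem exists_overlap_of_mem_kerDeg
    {x : LinearMap.ker (QuotRing.res₂ hσ (augmentation_pureRel hn P) σ')}
    (hx : x ∈ QuotRing.kerDeg (augmentation_pureRel hn P) hσ σ' n (n + 1)) :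
    ∃ y ∈ finsuppDeg (deg S V) (fun _ : pureRel n P => n) (n + 1),
      y.mapRange (QuotRing.mk (pureRel n P)) (map_zero _) = x.1.1 ∧
      ∃ z : overlap (pureRel n P), ∀ f : BimodHom S (pureRel n P) (TensorRing S V),
        f.extend y = leftTensor f z.1.1 := by
  have hε := augmentation_pureRel hn P
  have hR := pureRel_mem_homog n P
  -- In degree n + 1 the coefficients have degree 1 and lift to V; zero is lifted to zero to keep
  -- the support finite.
  have h1 : ∀ r, ∃ v, QuotRing.mk (pureRel n P) (ι S V v) = x.1.1 r ∧ (x.1.1 r = 0 → v = 0) := by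
    intro r
    have h := hx r
    rw [if_pos (Nat.le_succ n), Nat.add_sub_cancel_left] at h
    obtain ⟨t, ht, h⟩ := h
    obtain ⟨v, rfl⟩ := exists_ι_of_mem_homog_one ht
    by_cases h0 : x.1.1 r = 0
    · exact ⟨0, by rw [map_zero, map_zero, h0], fun _ => rfl⟩
    · exact ⟨v, h, fun h' => absurd h' h0⟩
  choose v hv hv0 using h1
  let vf : pureRel n P →₀ V := Finsupp.onFinset x.1.1.support v fun r h =>
    Finsupp.mem_support_iff.mpr (mt (hv0 r) h)
  let y := vf.mapRange (ι S V) (map_zero _)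
  have hy : y ∈ finsuppDeg (deg S V) (fun _ : pureRel n P => n) (n + 1) := fun r => by
    rw [if_pos (Nat.le_succ n), Nat.add_sub_cancel_left]
    exact ι_mem_homog (v r)
  have hyx : y.mapRange (QuotRing.mk (pureRel n P)) (map_zero _) = x.1.1 := Finsupp.ext hv
  let b₁ : BalTensor S V (pureRel n P) := vf.sum fun r v => BalTensor.tmul S v r
  have hb₁ : ∀ f : BimodHom S (pureRel n P) (TensorRing S V), f.extend y = leftTensor f b₁ := by
    intro f
    rw [BimodHom.extend_apply]
    exact (Finsupp.sum_mapRange_index (h := fun r t => t * f r) (fun _ => zero_mul _)).trans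
      (map_sum (leftTensor f) (fun r => BalTensor.tmul S (vf r) r) vf.support).symm
  have hq : QuotRing.mkDeriv (pureRel n P) σ (leftTensor (pureRel n P).incl b₁) = 0 := by
    rw [← hb₁, mkDeriv_extend_incl hε, hyx]
    exact congrArg (fun z => z.1.1) (LinearMap.mem_ker.mp x.2)
  have hqd : leftTensor (pureRel n P).incl b₁ ∈ homog S V (n + 1) :=
    leftTensor_mem (K := (homog S V (n + 1)).toAddSubgroup)
      (fun v r => add_comm 1 n ▸ homog_mul (ι_mem_homog v) (hR r.1 r.2)) b₁
  -- The element of VR is a cycle, so its derivatives vanish in A. They have degree n, hence lie in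
  -- R, and they exhibit the same element in RV.
  have hρ : ∀ v, deriv σ (leftTensor (pureRel n P).incl b₁) v ∈ pureRel n P := fun v => by
    rw [← proj_same (deriv_mem_homog σ hqd v)]
    exact proj_mem_of_mem_span hR (QuotRing.mk_eq_zero.mp (DFunLike.congr_fun hq v))
  let b₂ : BalTensor S (pureRel n P) V :=
    ∑ v ∈ (deriv σ (leftTensor (pureRel n P).incl b₁)).support, BalTensor.tmul S ⟨_, hρ v⟩ v
  refine ⟨y, hy, hyx, ⟨(b₁, b₂), ?_⟩, hb₁⟩
  change leftTensor (pureRel n P).incl b₁ = rightTensor (pureRel n P).incl b₂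
  exact ((linearCombination_deriv hσ (proj_ne hqd (Nat.succ_ne_zero n))).symm.trans
    (Finsupp.linearCombination_apply _ _)).trans (map_sum (rightTensor (pureRel n P).incl)
      (fun v => BalTensor.tmul S (⟨_, hρ v⟩ : pureRel n P) v) _).symm

variable (α : FilteredMap (pureRel n P)) (hα : P = SubBimod.range α.toBimodHom)

-- For a generator x in X the Jacobi conditions give (V⊗α)(x) = α(r) + (α⊗V)(x), in P + PV. A left
-- factor t of degree p puts the two terms in `relFilt n P m` and `relFiltMulι n P m`, with m = p +
-- n.
include hα in
theorem exists_extend_mem_of_mem_genDeg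
    (hJ : ∀ x : overlap (pureRel n P), ∃ r, α.toBimodHom r = overlapDiff α.toBimodHom x) {m : ℕ}
    {x : LinearMap.ker (QuotRing.res₂ hσ (augmentation_pureRel hn P) σ')}
    (hx : x ∈ genDeg (gradingA (pureRel n P))
      (QuotRing.kerDeg (augmentation_pureRel hn P) hσ σ' n (n + 1)) (n + 1) (m + 1)) :
    ∃ y ∈ finsuppDeg (deg S V) (fun _ : pureRel n P => n) (m + 1),
      y.mapRange (QuotRing.mk (pureRel n P)) (map_zero _) = x.1.1 ∧
      α.toBimodHom.extend y ∈ relFilt n P m ⊔ relFiltMulι n P m := by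
  induction hx using AddSubgroup.closure_induction with
  | mem z hz =>
    obtain ⟨p, a, x, hpm, ⟨t, ht, rfl⟩, hx, rfl⟩ := hz
    obtain rfl : m = p + n := by omega
    obtain ⟨y, hy, hyx, z, hz⟩ := exists_overlap_of_mem_kerDeg hn hσ hx
    obtain ⟨r, hr⟩ := hJ z
    have hty : t • y ∈ finsuppDeg (deg S V) (fun _ : pureRel n P => n) (p + (n + 1)) :=
      finsuppDeg_smulMem deg_smulMem _ ht hy
    refine ⟨t • y, hty, ?_, ?_⟩
    · refine Finsupp.ext fun i => ?_
      exact (map_mul (QuotRing.mk _) _ _).trans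
        (congrArg (QuotRing.mk _ t * ·) (DFunLike.congr_fun hyx i))
    · rw [map_smul, hz, show leftTensor α.toBimodHom z.1.1 =
        α.toBimodHom r + rightTensor α.toBimodHom z.1.2 by rw [hr, overlapDiff_apply]; abel,
        smul_eq_mul, mul_add]
      refine add_mem (AddSubgroup.mem_sup_left (mul_mem_relFilt ht (mem_relFilt_of_mem
        (α.apply_mem hα r) le_rfl))) (AddSubgroup.mem_sup_right (mul_mem_relFiltMulι ht ?_))
      exact rightTensor_mem (K := relFiltMulι n P n) (fun r v => AddSubgroup.subset_closure
        ⟨_, mem_relFilt_of_mem (α.apply_mem hα r) le_rfl, v, rfl⟩) _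
  | zero => exact ⟨0, zero_mem _, by ext; simp, by rw [map_zero]; exact zero_mem _⟩
  | add x x' _ _ hx hx' =>
    obtain ⟨y, hy, hyx, hyα⟩ := hx
    obtain ⟨y', hy', hyx', hyα'⟩ := hx'
    exact ⟨y + y', add_mem hy hy',
      (Finsupp.mapRange_add (fun x y => map_add (QuotRing.mk _) x y) y y').trans
        (congrArg₂ (· + ·) hyx hyx'), by rw [map_add]; exact add_mem hyα hyα'⟩
  | neg x _ hx =>
    obtain ⟨y, hy, hyx, hyα⟩ := hx
    exact ⟨-y, neg_mem hy, (Finsupp.mapRange_neg (fun x => map_neg (QuotRing.mk _) x) y).trans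
        (congrArg Neg.neg hyx), by rw [map_neg]; exact neg_mem hyα⟩

end

/-! ### Sufficiency and the theorem. -/

open TensorRing GroupGrading

section

variable {S : Type u} [Ring S] {V : Type v} [AddCommGroup V] [Module S V] [Module Sᵐᵒᵖ V]
  [SMulCommClass S Sᵐᵒᵖ V] {n : ℕ} {P : SubBimod S (TensorRing S V)} (hn : 2 ≤ n)
  (hP : ∀ p ∈ P, p ∈ filt S V n)
  {σ : V →ₗ[S] V →₀ S} (hσ : ∀ x, Finsupp.linearCombination S id (σ x) = x)
  {σ' : pureRel n P →ₗ[S] pureRel n P →₀ S}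
  (hσ' : ∀ x, Finsupp.linearCombination S id (σ' x) = x)
  (hTor : TorSSIsPure (pureRel n P) (augmentation_pureRel hn P) 3 (n + 1))
  (α : FilteredMap (pureRel n P)) (hα : P = SubBimod.range α.toBimodHom)
  (hJ : Subsingleton (TorSS (pureRel n P) (augmentation_pureRel hn P) 3) ∨ α.Jacobi n)

-- The class of y in A⊗R is a cycle. If Tor_3 = 0 it is zero; otherwise it has another
-- representative y' built from overlaps, for which the claim is known. The difference y - y' has
-- class zero.
include hP hσ hσ' hTor hα hJ in
theorem extend_mem_of_extend_incl_mem {m : ℕ} {y : pureRel n P →₀ TensorRing S V}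
    (hy : y ∈ finsuppDeg (deg S V) (fun _ => n) (m + 1))
    (h : (pureRel n P).incl.extend y ∈ AddSubgroup.closure {z | ∃ w ∈ TwoSidedIdeal.span
      (pureRel n P : Set (TensorRing S V)), ∃ v : V, z = w * ι S V v}) :
    α.toBimodHom.extend y ∈ relFilt n P m ⊔ relFiltMulι n P m := by
  have hn0 : n ≠ 0 := by omega
  have hR := pureRel_mem_homog n P
  obtain ⟨x, hx, hxy⟩ := exists_kerDeg_of_extend_incl_mem hn hσ hσ' hy h
  obtain ⟨y', hy', hyx', hyα'⟩ : ∃ y' ∈ finsuppDeg (deg S V) (fun _ : pureRel n P => n) (m + 1),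
      y'.mapRange (QuotRing.mk (pureRel n P)) (map_zero _) = x.1.1 ∧
      α.toBimodHom.extend y' ∈ relFilt n P m ⊔ relFiltMulι n P m := by
    rcases hJ with hJ | hJ
    · refine ⟨0, zero_mem _, ?_, by rw [map_zero]; exact zero_mem _⟩
      rw [QuotRing.eq_zero_of_subsingleton_tor hR _ hσ hσ' hn hJ hx, Finsupp.mapRange_zero]
      rfl
    · exact exists_extend_mem_of_mem_genDeg hn hσ α hα ((α.jacobi_iff hR hn0).mp hJ)
        (QuotRing.mem_genDeg_of_pure hR _ hσ hσ' hn hTor hx)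
  have h1 := extend_mem_of_indProj_eq_zero α hα hσ' hP hn0 (sub_mem hy hy') (by
    rw [Finsupp.mapRange_sub (fun x y => map_sub (QuotRing.mk _) x y), map_sub, ← hxy, hyx',
      mem_indMod.mp x.1.2, sub_self])
  rw [← sub_add_cancel y y', map_add]
  exact add_mem h1 hyα'

-- The heart of sufficiency: cancellation of leading terms never produces anything outside the
-- visible filtration.
include hP hσ hσ' hTor hα hJ in
theorem mem_relFilt_of_mem_filt (m : ℕ) : ∀ u ∈ relFilt n P (m + 1), u ∈ filt S V m →
    u ∈ relFilt n P m := by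
  induction m using Nat.strong_induction_on with
  | _ m ih =>
    intro u hu hum
    obtain ⟨u', hu', y, hy, w, hw, rfl⟩ := exists_of_mem_relFilt_succ α hα hu
    have h1 : proj S V (m + 1) (u' + α.toBimodHom.extend y + w) = 0 :=
      proj_eq_zero hum (Nat.lt_succ_self m)
    rw [proj_add, proj_add, proj_eq_zero (relFilt_le_filt hP m hu') (Nat.lt_succ_self m),
      α.proj_extend hy, zero_add] at h1
    -- In degree m + 1 only y and w contribute, so Σ y_r r is minus the leading part of w, which is
    -- in ⟨R⟩ V.
    have h2 := extend_mem_of_extend_incl_mem hn hP hσ hσ' hTor α hα hJ hy (by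
      rw [eq_neg_of_add_eq_zero_left h1]
      exact neg_mem (proj_mem_span_of_mem_relFiltMulι hP hw))
    obtain ⟨u₁, hu₁, w₁, hw₁, h3⟩ := AddSubgroup.mem_sup.mp h2
    have h4 : u' + α.toBimodHom.extend y + w = (u' + u₁) + (w₁ + w) := by rw [← h3]; abel
    have hu₂ := add_mem hu' hu₁
    rw [h4] at hum ⊢
    -- What remains is a sum of products ending in V whose total has degree at most m, to which the
    -- induction applies.
    refine add_mem hu₂ (mem_relFilt_of_mem_relFiltMulι hσ ih (add_mem hw₁ hw) ?_)
    have h5 := sub_mem hum (relFilt_le_filt hP m hu₂)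
    rwa [add_sub_cancel_left] at h5

include hP hσ hσ' hTor hα hJ in
theorem isPBWDeformation_of_filteredMap : IsPBWDeformation (pureRel n P) P := by
  refine (isPBWDeformation_iff hP).mpr fun m t ht htm => ?_
  obtain ⟨M, hM⟩ := exists_mem_relFilt ht n
  refine proj_mem_span_of_mem_relFilt hP ?_
  -- t lies in some level of the filtration; as its degree is at most m, it descends one level at a
  -- time down to m.
  have key : ∀ k, t ∈ relFilt n P (m + k) → t ∈ relFilt n P m := by
    intro k
    induction k with
    | zero => exact id
    | succ k ih => exact fun h => ih (mem_relFilt_of_mem_filt hn hP hσ hσ' hTor α hα hJ (m + k) t h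
        (filt_mono (Nat.le_add_right m k) htm))
  exact key M (relFilt_mono (Nat.le_add_left M m) hM)

end

theorem mainTheorem10 {S : Type u} [Ring S] {V : Type v} [AddCommGroup V] [Module S V]
    [Module Sᵐᵒᵖ V] [SMulCommClass S Sᵐᵒᵖ V]
    (n : ℕ) (hn : 2 ≤ n)
    (P : SubBimod S (TensorRing S V)) (hP : ∀ x ∈ P, x ∈ TensorRing.filt S V n)
    (hA : Module.Projective S (QuotRing.homog (pureRel n P) 1))
    (hR : Module.Projective S (pureRel n P))
    (hTor : TorSSIsPure (pureRel n P) (augmentation_pureRel hn P) 3 (n + 1)) :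
    IsPBWDeformation (pureRel n P) P ↔
      ∃ α : FilteredMap (pureRel n P),
        P = SubBimod.range α.toBimodHom ∧
        (Subsingleton (TorSS (pureRel n P) (augmentation_pureRel hn P) 3) ∨ α.Jacobi n) := by
  constructor
  · intro h
    obtain ⟨α, hα, hJ⟩ := exists_filteredMap (by omega) hP ((isPBWDeformation_iff hP).mp h)
    exact ⟨α, hα, Or.inr hJ⟩
  · rintro ⟨α, hα, hJ⟩
    -- V is isomorphic to A^1 because relations start in degree n ≥ 2, so V is projective and has a
    -- section σ.
    obtain ⟨σ, hσ⟩ := (Module.projective_def (R := S) (P := V)).mp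
      (QuotRing.projective_of_homog_one hn (pureRel_mem_homog n P))
    obtain ⟨σ', hσ'⟩ := (Module.projective_def (R := S) (P := pureRel n P)).mp hR
    exact isPBWDeformation_of_filteredMap hn hP hσ hσ' hTor α hα hJ
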